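/- **Setting.** Each point of $\mathbb Z^d$ carries one qubit. A lattice state is a family $\rho=(\rho_A)$ of density matrices, one for each finite $A\subset\mathbb Z^d$, consistent under partial traces. A neighbourhood scheme is a finite $N\subset\mathbb Z^d$ with $0\in N$; distinct points $x,y$ are *neighbours* if $y-x\in N$ or $x-y\in N$. A colouring is a periodic map $C:\mathbb Z^d\to\{0,\dots,k-1\}$; it is *correct* if neighbours have different colours, and $C_1$ *refines* $C$ if $C_1(x)=C_1(y)$ implies $C(x)=C(y)$. A *continuous-time QCA* $T$ consists of $N$, a (not necessarily correct) colouring $C$, and Hermitian two-qubit coupling Hamiltonians $h_{ab}(t)$, $t\ge 0$, for the pairs of colours, independent of the order in which the two spins are listed and with locally integrable entries. A finite region $A$ has the Hamiltonian $H_A(t)=\sum_{x<y} h_{C(x)C(y)}(t)$, summed over the pairs of neighbours $x,y\in A$, and the evolution operator $U_A(t)$, the time-ordered exponential of $-iH_A$ over $[0,t]$. The evolution of the lattice is $(T_t\rho)_A=\lim_{B\uparrow\mathbb Z^d}\operatorname{tr}_{B\setminus A}\bigl(U_B(t)\rho_BU_B(t)^\dagger\bigr)$. Fix a Hermitian single-qubit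 observable $\sigma$ that is not a multiple of the identity. A *coloured QCA* consists of a neighbourhood scheme $N'$, a correct colouring and, for each time step, a finite list of field-controlled unitaries, performed one after the other. A field-controlled unitary is given by a colour $l$, a one-qubit unitary $u$ and a set $S$ of vectors: simultaneously, $u$ is applied to those points $x$ of colour $l$ whose vector of fields lies in $S$, where, on products of eigenvectors of $\sigma$, the $m$-field of $x$ is the sum of the $\sigma$-eigenvalues at the points $r\neq x$ of $x+N'$ of colour $m$. On a finite region only the points of the region are updated and contribute to fields. Say that $T$ *can be approximated with colouring* $C_1$ if there are coloured QCAs $Q_{\Delta T}$, one for each length $\Delta T>0$ of the time step, with colouring $C_1$, observable $\sigma$ and $N'=N\cup(-N)$, such that the list of colours updated in a time step is the same for all steps and all $\Delta T$; every unitary is controlled by the field of a single colour; all time steps are identical if the couplings of $T$ do not depend on time; and, as $\Delta T\to 0$, for every finite region $A$ and every $\tau$, uniformly in $t\in[0,\tau]$: (a) the evolution operator of $Q_{\Delta T}$ on the region $A$ after $\lfloor t/\Delta T\rfloor$ steps converges to $U_A(t)$; (b) $(Q_{\Delta T}^{\lfloor t/\Delta T\rfloor}\rho)_A\to(T_t\rho)_A$,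 uniformly in the lattice state $\rho$. **Theorem.** Let $T$ be any continuous-time QCA. 1. For every $t\ge 0$ and every lattice state $\rho$, the limits defining $T_t\rho$ exist, and $T_t\rho$ is a lattice state. 2. $T$ can be approximated by coloured QCAs: there is a correct colouring $C_1$ that refines the colouring of $T$ such that $T$ can be approximated with colouring $C_1$. 3. There is a correct colouring that refines the colouring of $T$ and breaks up only colours that have neighbouring points of the same colour. If $\operatorname{tr}\sigma\neq 0$ (for example $\sigma=|1\rangle\langle 1|$), then $T$ can be approximated with every correct colouring that refines the colouring of $T$; in particular with the colouring of $T$ itself, if that is correct. -/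

import Mathlib

open Filter Topology MeasureTheory
open scoped Pointwise ComplexOrder

noncomputable section

namespace QCA

/-- Points of the integer lattice of dimension `d`; every point carries one qubit. -/
abbrev Site (d : ℕ) : Type := Fin d → ℤ

/-- Computational basis labels of the qubits in a finite region. -/
abbrev Config {d : ℕ} (A : Finset (Site d)) : Type := A → Fin 2

/-- Operators on the Hilbert space of the qubits in a finite region. -/
abbrev Op {d : ℕ} (A : Finset (Site d)) : Type := Matrix (Config A) (Config A) ℂ

/-- The configuration on `B` which is `s` on `A` and `e` on the rest of `B`. -/
def glue {d : ℕ} (A B : Finset (Site d)) (s : Config A)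
    (e : Config (B \ A)) : Config B :=
  fun x => if h : x.1 ∈ A then s ⟨x.1, h⟩ else e ⟨x.1, Finset.mem_sdiff.2 ⟨x.2, h⟩⟩

/-- Partial trace from the region `B` to the region `A` (used for `A ⊆ B`). -/
def ptrace {d : ℕ} (A B : Finset (Site d)) (M : Op B) : Op A :=
  Matrix.of fun s s' => ∑ e : Config (B \ A), M (glue A B s e) (glue A B s' e)

/-- A family of operators, one for each finite region. -/
abbrev Family (d : ℕ) : Type := ∀ A : Finset (Site d), Op A

/-- A state of the infinite lattice: a family of density matrices on all finite regions,
consistent under partial traces. -/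
structure IsState {d : ℕ} (ρ : Family d) : Prop where
  posSemidef : ∀ A, (ρ A).PosSemidef
  trace_eq_one : ∀ A, (ρ A).trace = 1
  consistent : ∀ A B, A ⊆ B → ptrace A B (ρ B) = ρ A

/-- `x` and `y` are (distinct) neighbours with respect to the neighbourhood scheme `N`. -/
def Neighbours {d : ℕ} (N : Finset (Site d)) (x y : Site d) : Prop :=
  x ≠ y ∧ (y - x ∈ N ∨ x - y ∈ N)

/-- A colouring of the lattice with `k` colours: a periodic map from lattice points to
`{0, …, k - 1}`. Periodicity under a sublattice of full rank is the same as periodicity under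
all translations by vectors of `M ℤ ^ d`, for some `M ≥ 1`. -/
structure Colouring (d k : ℕ) where
  toFun : Site d → Fin k
  periodic : ∃ M : ℕ, 0 < M ∧ ∀ x v : Site d, toFun (x + (M : ℤ) • v) = toFun x

/-- A colouring is correct if no two neighbours have the same colour. -/
def Colouring.Correct {d k : ℕ} (C : Colouring d k) (N : Finset (Site d)) : Prop :=
  ∀ x y, Neighbours N x y → C.toFun x ≠ C.toFun y

/-- `C₁` is obtained from `C` by breaking colours into new colours. -/
def Colouring.Refines {d k k₁ : ℕ} (C₁ : Colouring d k₁) (C : Colouring d k) : Prop :=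
  ∀ x y, C₁.toFun x = C₁.toFun y → C.toFun x = C.toFun y

/-! ### Continuous-time QCA -/

/-- A continuous-time QCA. The matrix `h a b t` is the coupling Hamiltonian at time `t` of a spin
of colour `a` (first tensor factor) with a neighbour of colour `b` (second tensor factor);
`symm` says that it does not matter which of the two spins is listed first. -/
structure CTQCA (d k : ℕ) where
  nbhd : Finset (Site d)
  zero_mem : 0 ∈ nbhd
  colouring : Colouring d k
  h : Fin k → Fin k → ℝ → Matrix (Fin 2 × Fin 2) (Fin 2 × Fin 2) ℂ
  herm : ∀ a b t, (h a b t).IsHermitian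
  symm : ∀ a b t, h b a t = (h a b t).submatrix Prod.swap Prod.swap
  integrable : ∀ a b i j t, 0 ≤ t → IntervalIntegrable (fun s => h a b s i j) volume 0 t

/-- The two-qubit operator `m` acting on the qubits at `x` and `y`, and as the identity on the
other qubits of the region. -/
def pairOp {d : ℕ} {A : Finset (Site d)} (x y : A)
    (m : Matrix (Fin 2 × Fin 2) (Fin 2 × Fin 2) ℂ) : Op A :=
  open Classical in
  Matrix.of fun s s' =>
    if ∀ z, z ≠ x → z ≠ y → s z = s' z then m (s x, s y) (s' x, s' y) else 0

/-- Terms of the Dyson series of a time-dependent Hamiltonian `H`. -/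
def dyson {d : ℕ} {A : Finset (Site d)} (H : ℝ → Op A) : ℕ → ℝ → Op A
  | 0, _ => 1
  | n + 1, t => Matrix.of fun i j =>
      -Complex.I * ∫ s in (0 : ℝ)..t, (H s * dyson H n s) i j

/-- The time-ordered exponential of `-i H` from time `0` to time `t`. -/
def propagator {d : ℕ} {A : Finset (Site d)} (H : ℝ → Op A) (t : ℝ) : Op A :=
  ∑' n, dyson H n t

namespace CTQCA

variable {d k : ℕ} (T : CTQCA d k)

/-- The Hamiltonian of a finite region: the sum over `x < y` (in a fixed linear order of the
lattice) of the couplings of all neighbouring pairs inside the region. -/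
def hamiltonian (A : Finset (Site d)) (t : ℝ) : Op A :=
  open Classical in
  ∑ x : A, ∑ y : A,
    if Neighbours T.nbhd x.1 y.1 ∧ toLex x.1 < toLex y.1 then
      pairOp x y (T.h (T.colouring.toFun x.1) (T.colouring.toFun y.1) t)
    else 0

/-- The evolution operator of a finite region over the time period from `0` to `t`. -/
def regionEvolution (A : Finset (Site d)) (t : ℝ) : Op A :=
  propagator (T.hamiltonian A) t

/-- The state of the region `A` at time `t` if the dynamics is that of the region `B`. -/
def evolveIn (B : Finset (Site d)) (t : ℝ) (ρ : Family d) (A : Finset (Site d)) : Op A :=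
  ptrace A B (T.regionEvolution B t * ρ B * (T.regionEvolution B t).conjTranspose)

/-- The evolution of the infinite lattice: the limit of `evolveIn` as the region `B` grows to the
whole lattice. -/
def evolve (t : ℝ) (ρ : Family d) : Family d :=
  fun A => limUnder atTop (fun B : Finset (Site d) => T.evolveIn B t ρ A)

/-- The coupling Hamiltonians do not depend on time. -/
def TimeIndependent : Prop := ∀ a b t, T.h a b t = T.h a b 0

end CTQCA

/-! ### Coloured QCA -/

/-- A field-controlled unitary on the points of one colour: `u` is applied to exactly those
points of that colour whose vector of `l`-fields lies in `cond`. -/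
structure FieldControlled (k : ℕ) where
  colour : Fin k
  cond : Set (Fin k → ℝ)
  u : Matrix.unitaryGroup (Fin 2) ℂ

/-- The unitary is controlled by the `l`-field only. -/
def FieldControlled.ControlledBy {k : ℕ} (g : FieldControlled k) (l : Fin k) : Prop :=
  ∀ φ ψ : Fin k → ℝ, φ l = ψ l → (φ ∈ g.cond ↔ ψ ∈ g.cond)

/-- A coloured QCA. Its time step number `n` consists of the field-controlled unitaries in the
list `program n`, performed one after the other; at each of them only the points of one colour
are updated. -/
structure CQCA (d k : ℕ) where
  nbhd : Finset (Site d)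
  zero_mem : 0 ∈ nbhd
  colouring : Colouring d k
  correct : colouring.Correct nbhd
  obs : Matrix (Fin 2) (Fin 2) ℂ
  obs_herm : obs.IsHermitian
  program : ℕ → List (FieldControlled k)

namespace CQCA

variable {d k : ℕ} (Q : CQCA d k)

/-- The unitary whose columns are an eigenbasis of the observable. -/
def basis : Matrix (Fin 2) (Fin 2) ℂ := (Q.obs_herm.eigenvectorUnitary).1

/-- The fields at `x` when the qubits of the region are in the product of eigenvectors of the
observable labelled by `s`: the `l`-field is the sum of the eigenvalues at the `l`-coloured
points of the neighbourhood of `x`. Points outside the region do not contribute. -/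
def field {A : Finset (Site d)} (s : Config A) (x : A) : Fin k → ℝ :=
  fun l => open Classical in
    ∑ r : A, if r ≠ x ∧ r.1 - x.1 ∈ Q.nbhd ∧ Q.colouring.toFun r.1 = l then
      Q.obs_herm.eigenvalues (s r) else 0

/-- The simultaneous update by a field-controlled unitary of all points of a region, as a matrix
in the product eigenbasis of the observable. -/
def layerMatrix (A : Finset (Site d)) (g : FieldControlled k) : Op A :=
  open Classical in
  Matrix.of fun s s' => ∏ x : A,
    (if Q.colouring.toFun x.1 = g.colour ∧ Q.field s x ∈ g.cond then
        Q.basis.conjTranspose * g.u.1 * Q.basis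
      else (1 : Matrix (Fin 2) (Fin 2) ℂ)) (s x) (s' x)

/-- The change of basis from the product eigenbasis to the computational basis. -/
def regionBasis (A : Finset (Site d)) : Op A :=
  Matrix.of fun s s' => ∏ x : A, Q.basis (s x) (s' x)

/-- The simultaneous update by a field-controlled unitary of all points of a region. -/
def layerOp (A : Finset (Site d)) (g : FieldControlled k) : Op A :=
  Q.regionBasis A * Q.layerMatrix A g * (Q.regionBasis A).conjTranspose

/-- The operator of time step number `n` on a finite region. -/
def stepOp (A : Finset (Site d)) (n : ℕ) : Op A :=
  (Q.program n).foldl (fun M g => Q.layerOp A g * M) 1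

/-- The evolution operator of a finite region over the first `n` time steps. -/
def regionEvolution (A : Finset (Site d)) : ℕ → Op A
  | 0 => 1
  | n + 1 => Q.stepOp A n * regionEvolution A n

/-- The action of a field-controlled unitary on families of local states. The reduced state on
`A` after the update is influenced by the points of `A - nbhd`, whose own neighbourhoods lie in
`A - nbhd + nbhd`. -/
def layerAct (g : FieldControlled k) (ρ : Family d) : Family d :=
  fun A => ptrace A (A - Q.nbhd + Q.nbhd)
    (Q.layerOp (A - Q.nbhd + Q.nbhd) g * ρ (A - Q.nbhd + Q.nbhd) *
      (Q.layerOp (A - Q.nbhd + Q.nbhd) g).conjTranspose)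

/-- Time step number `n` on the infinite lattice. -/
def stepAct (n : ℕ) (ρ : Family d) : Family d :=
  (Q.program n).foldl (fun ρ₁ g => Q.layerAct g ρ₁) ρ

/-- The first `n` time steps on the infinite lattice. -/
def evolve : ℕ → Family d → Family d
  | 0, ρ => ρ
  | n + 1, ρ => Q.stepAct n (evolve n ρ)

end CQCA

/-! ### Approximation -/

/-- The coloured QCAs `Q ΔT`, with time steps of duration `ΔT`, approximate `T` as `ΔT → 0`:
on every finite region the evolution operators converge, and on the infinite lattice the reduced
states of every finite region converge, uniformly in the initial state; both uniformly for times
in bounded intervals. Since the region is fixed, closeness of matrices may be measured on their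
entries. -/
def Approximates {d k k₁ : ℕ} (Q : ℝ → CQCA d k₁) (T : CTQCA d k) : Prop :=
  (∀ (A : Finset (Site d)) (τ ε : ℝ), 0 < ε → ∃ δ : ℝ, 0 < δ ∧
    ∀ ΔT : ℝ, 0 < ΔT → ΔT < δ → ∀ t : ℝ, 0 ≤ t → t ≤ τ → ∀ i j : Config A,
      ‖(Q ΔT).regionEvolution A ⌊t / ΔT⌋₊ i j - T.regionEvolution A t i j‖ < ε) ∧
  (∀ (A : Finset (Site d)) (τ ε : ℝ), 0 < ε → ∃ δ : ℝ, 0 < δ ∧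
    ∀ ΔT : ℝ, 0 < ΔT → ΔT < δ → ∀ t : ℝ, 0 ≤ t → t ≤ τ →
      ∀ ρ : Family d, IsState ρ → ∀ i j : Config A,
        ‖(Q ΔT).evolve ⌊t / ΔT⌋₊ ρ A i j - T.evolve t ρ A i j‖ < ε)

/-- `T` can be approximated by coloured QCAs with colouring `C₁`, with the same neighbours as `T`,
and with fields given by the observable `σ`. Every time step is one sequence of operations on
one colour controlled by one colour; the sequence of updated colours is the same for all steps
and all `ΔT`, and all steps are identical if `T` is time-independent. -/
def Approximable {d k k₁ : ℕ} (T : CTQCA d k) (σ : Matrix (Fin 2) (Fin 2) ℂ)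
    (C₁ : Colouring d k₁) : Prop :=
  ∃ (Q : ℝ → CQCA d k₁) (colours : List (Fin k₁)),
    (∀ ΔT : ℝ, 0 < ΔT →
      (Q ΔT).nbhd = T.nbhd ∪ -T.nbhd ∧ (Q ΔT).colouring = C₁ ∧ (Q ΔT).obs = σ ∧
      (∀ n, ((Q ΔT).program n).map FieldControlled.colour = colours) ∧
      (∀ n, ∀ g ∈ (Q ΔT).program n, ∃ l, g.ControlledBy l) ∧
      (T.TimeIndependent → ∀ n, (Q ΔT).program n = (Q ΔT).program 0)) ∧
    Approximates Q T

end QCA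

end

noncomputable section

namespace QCA

/-! ### Heisenberg evolution in a C⋆-algebra and a Lieb–Robinson bound for circuits -/

section LiebRobinson

variable {𝒜 : Type*} [CStarAlgebra 𝒜]

/-- The Heisenberg evolution of an observable. -/
def heis (g X : 𝒜) : 𝒜 := star g * X * g

/-- The unitary `exp (-i θ M)`. -/
def gate (M : 𝒜) (θ : ℝ) : 𝒜 := NormedSpace.exp ((-(Complex.I * θ)) • M)

theorem star_gate (M : 𝒜) (hM : IsSelfAdjoint M) (θ : ℝ) : star (gate M θ) = gate M (-θ) := by
  let _ : NormedAlgebra ℚ 𝒜 := NormedAlgebra.restrictScalars ℚ ℂ 𝒜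
  unfold gate
  rw [NormedSpace.star_exp, star_smul, hM.star_eq]
  simp

theorem gate_mul_gate_of_commute {M M' : 𝒜} (h : Commute M M') (θ : ℝ) :
    gate (M + M') θ = gate M θ * gate M' θ := by
  let _ : NormedAlgebra ℚ 𝒜 := NormedAlgebra.restrictScalars ℚ ℂ 𝒜
  unfold gate
  rw [smul_add, NormedSpace.exp_add_of_commute]
  exact (h.smul_left _).smul_right _

theorem gate_zero (θ : ℝ) : gate (0 : 𝒜) θ = 1 := by
  simp [gate]

theorem gate_mem_unitary (M : 𝒜) (hM : IsSelfAdjoint M) (θ : ℝ) :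
    gate M θ ∈ unitary 𝒜 := by
  let _ : NormedAlgebra ℚ 𝒜 := NormedAlgebra.restrictScalars ℚ ℂ 𝒜
  have h1 : ∀ θ : ℝ, gate M θ * gate M (-θ) = 1 := by
    intro θ
    unfold gate
    rw [← NormedSpace.exp_add_of_commute]
    · rw [← add_smul]; simp
    · exact ((Commute.refl M).smul_left _).smul_right _
  rw [Unitary.mem_iff, star_gate M hM]
  refine ⟨?_, h1 θ⟩
  simpa using h1 (-θ)

theorem Commute.gate_right {M Y : 𝒜} (h : Commute Y M) (θ : ℝ) : Commute Y (gate M θ) := by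
  let _ : NormedAlgebra ℚ 𝒜 := NormedAlgebra.restrictScalars ℚ ℂ 𝒜
  exact (h.smul_right _).exp_right

theorem hasDerivAt_gate (M : 𝒜) (θ : ℝ) :
    HasDerivAt (gate M) (gate M θ * ((-Complex.I) • M)) θ := by
  let _ : NormedAlgebra ℚ 𝒜 := NormedAlgebra.restrictScalars ℚ ℂ 𝒜
  have h := HasDerivAt.scomp θ (hasDerivAt_exp_smul_const (𝕂 := ℂ) ((-Complex.I) • M) (θ : ℂ))
    Complex.ofRealCLM.hasDerivAt
  have e : ∀ θ : ℝ, gate M θ = NormedSpace.exp ((θ : ℂ) • (-Complex.I) • M) := by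
    intro θ
    unfold gate
    rw [smul_smul]
    congr 2
    ring
  rw [e θ]
  refine (h.congr_of_eventuallyEq (Eventually.of_forall e)).congr_deriv ?_
  simp

theorem norm_heis {g : 𝒜} (hg : g ∈ unitary 𝒜) (X : 𝒜) : ‖heis g X‖ = ‖X‖ := by
  unfold heis
  rw [CStarRing.norm_mul_mem_unitary _ hg, CStarRing.norm_mem_unitary_mul _ (Unitary.star_mem hg)]

theorem heis_sub (g X X' : 𝒜) : heis g (X - X') = heis g X - heis g X' := by
  simp [heis, mul_sub, sub_mul]

theorem heis_mul (g g' X : 𝒜) : heis (g * g') X = heis g' (heis g X) := by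
  simp [heis, mul_assoc]

theorem heis_one (X : 𝒜) : heis 1 X = X := by
  simp [heis]

theorem heis_commutator {g : 𝒜} (hg : g ∈ unitary 𝒜) {Y : 𝒜} (h : Commute Y g) (X : 𝒜) :
    heis g X * Y - Y * heis g X = heis g (X * Y - Y * X) := by
  have h' : Commute Y (star g) := by
    have h1 := Unitary.mul_star_self_of_mem hg
    have h2 := Unitary.star_mul_self_of_mem hg
    calc Y * star g = star g * g * (Y * star g) := by rw [h2, one_mul]
      _ = star g * (Y * g) * star g := by rw [h.eq]; simp only [mul_assoc]
      _ = star g * Y := by simp only [mul_assoc]; rw [h1, mul_one]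
  rw [heis_sub]
  unfold heis
  congr 1
  · simp only [mul_assoc]; rw [h.eq]
  · simp only [← mul_assoc]; rw [h'.eq]

theorem norm_heis_gate_sub_le (M X : 𝒜) (hM : IsSelfAdjoint M) (θ : ℝ) :
    ‖heis (gate M θ) X - X‖ ≤ |θ| * ‖X * M - M * X‖ := by
  have hd : ∀ s : ℝ, HasDerivAt (fun s : ℝ => gate M (-s) * X * gate M s)
      (gate M (-s) * ((Complex.I) • (M * X - X * M)) * gate M s) s := by
    intro s
    have h1 := (((hasDerivAt_gate M (-s)).scomp s (hasDerivAt_neg s)).mul_const X).mul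
      (hasDerivAt_gate M s)
    refine h1.congr_deriv ?_
    have hc : gate M s * M = M * gate M s := (Commute.gate_right (Commute.refl M) s).eq.symm
    simp only [Function.comp, smul_mul_assoc, mul_smul_comm, neg_smul, one_smul, smul_sub, mul_sub,
      sub_mul, mul_assoc, mul_neg, neg_neg, hc, ← sub_eq_add_neg]
  have key := convex_univ.norm_image_sub_le_of_norm_hasDerivWithin_le
    (f := fun s : ℝ => gate M (-s) * X * gate M s) (C := ‖X * M - M * X‖)
    (fun s _ => (hd s).hasDerivWithinAt) (fun s _ => ?_) (Set.mem_univ 0) (Set.mem_univ θ)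
  · have h0 : gate M 0 = 1 := by simp [gate]
    simp only [neg_zero, h0, one_mul, mul_one, sub_zero, Real.norm_eq_abs] at key
    unfold heis
    rw [star_gate M hM, mul_comm]
    exact key
  · rw [CStarRing.norm_mul_mem_unitary _ (gate_mem_unitary M hM s),
      CStarRing.norm_mem_unitary_mul _ (gate_mem_unitary M hM (-s)), norm_smul, Complex.norm_I,
      one_mul, norm_sub_rev]

variable {P : Type*}

/-- `c` bounds the commutators of `X` with the observables `Y z` of the site `z`. -/
def Osc (Y : P → Set 𝒜) (X : 𝒜) (z : P) (c : ℝ) : Prop := ∀ y ∈ Y z, ‖X * y - y * X‖ ≤ c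

theorem Osc.mono {Y : P → Set 𝒜} {X : 𝒜} {z : P} {c c' : ℝ} (h : Osc Y X z c) (hc : c ≤ c') :
    Osc Y X z c' := fun y hy => (h y hy).trans hc

/-- `M` is an observable of the pair of sites `e`: it commutes with the other sites, and its
commutators are controlled by the commutators at the two sites. -/
structure PairTerm (Y : P → Set 𝒜) (c₀ : ℝ) (e : P × P) (M : 𝒜) : Prop where
  selfAdjoint : IsSelfAdjoint M
  commute : ∀ z, z ≠ e.1 → z ≠ e.2 → ∀ y ∈ Y z, Commute y M
  bound : ∀ X c₁ c₂, Osc Y X e.1 c₁ → Osc Y X e.2 c₂ → ‖X * M - M * X‖ ≤ c₀ * (c₁ + c₂)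

variable [DecidableEq P]

/-- The constants of the Lieb–Robinson bound: `w` is a weight on the sites which changes at most
by the factor `C` along the pairs in `S`, and every site belongs to at most `D` of them. -/
structure Layer (Y : P → Set 𝒜) (c₀ C : ℝ) (D : ℕ) (w : P → ℝ) (S : Finset (P × P))
    (M : P × P → 𝒜) : Prop where
  term : ∀ e ∈ S, PairTerm Y c₀ e (M e)
  comm : ∀ e ∈ S, ∀ e' ∈ S, Commute (M e) (M e')
  weight_left : ∀ e ∈ S, w e.1 ≤ C * w e.2
  weight_right : ∀ e ∈ S, w e.2 ≤ C * w e.1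
  deg : ∀ z, (S.filter fun e => e.1 = z ∨ e.2 = z).card ≤ D

theorem Layer.mono {Y : P → Set 𝒜} {c₀ C : ℝ} {D : ℕ} {w : P → ℝ} {S S' : Finset (P × P)}
    {M : P × P → 𝒜} (h : Layer Y c₀ C D w S M) (hS : S' ⊆ S) : Layer Y c₀ C D w S' M where
  term e he := h.term e (hS he)
  comm e he e' he' := h.comm e (hS he) e' (hS he')
  weight_left e he := h.weight_left e (hS he)
  weight_right e he := h.weight_right e (hS he)
  deg z := (Finset.card_le_card (Finset.filter_subset_filter _ hS)).trans (h.deg z)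

theorem Layer.selfAdjoint {Y : P → Set 𝒜} {c₀ C : ℝ} {D : ℕ} {w : P → ℝ} {S : Finset (P × P)}
    {M : P × P → 𝒜} (h : Layer Y c₀ C D w S M) : IsSelfAdjoint (∑ e ∈ S, M e) :=
  isSelfAdjoint_sum _ fun e he => (h.term e he).selfAdjoint

theorem Layer.gate_insert {Y : P → Set 𝒜} {c₀ C : ℝ} {D : ℕ} {w : P → ℝ} {S : Finset (P × P)}
    {M : P × P → 𝒜} {e : P × P} (he : e ∉ S) (h : Layer Y c₀ C D w (insert e S) M) (θ : ℝ) :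
    gate (∑ e ∈ insert e S, M e) θ = gate (∑ e ∈ S, M e) θ * gate (M e) θ := by
  rw [Finset.sum_insert he, add_comm, gate_mul_gate_of_commute]
  exact (Commute.sum_right _ _ _ fun e' he' => h.comm _ (Finset.mem_insert_self _ _) _
    (Finset.mem_insert_of_mem he')).symm

theorem Layer.osc_heis {Y : P → Set 𝒜} (hY : ∀ z, ∀ y ∈ Y z, ‖y‖ ≤ 1) {c₀ C : ℝ} {D : ℕ}
    {w : P → ℝ} {M : P × P → 𝒜} (hc₀ : 0 ≤ c₀) (hC : 0 ≤ C)
    (hw : ∀ z, 0 ≤ w z) {K θ : ℝ} (hK : 0 ≤ K) {X : 𝒜}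
    (hX : ∀ z, Osc Y X z (K * w z)) (hθ : 4 * c₀ * (1 + C) * |θ| * D ≤ 1) (S : Finset (P × P)) :
    Layer Y c₀ C D w S M → ∀ z, Osc Y (heis (gate (∑ e ∈ S, M e) θ) X) z
      (K * w z * (1 + 4 * c₀ * (1 + C) * |θ| * (S.filter fun e => e.1 = z ∨ e.2 = z).card)) := by
  induction S using Finset.induction_on with
  | empty =>
    intro _ z
    simpa [gate_zero, heis_one] using hX z
  | insert e S he ih =>
    intro h z y hy
    have hl := h.mono (Finset.subset_insert e S)
    have ih := ih hl
    rw [h.gate_insert he, heis_mul]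
    set X₁ := heis (gate (∑ e ∈ S, M e) θ) X with hX₁
    have ht := h.term e (Finset.mem_insert_self _ _)
    have hu := gate_mem_unitary (M e) ht.selfAdjoint θ
    set a := 4 * c₀ * (1 + C) * |θ| with ha
    have ha0 : 0 ≤ a := by positivity
    have hcrude : ∀ z, Osc Y X₁ z (2 * (K * w z)) := by
      intro z
      refine (ih z).mono ?_
      have h1 : a * ((S.filter fun e => e.1 = z ∨ e.2 = z).card : ℝ) ≤ 1 :=
        (mul_le_mul_of_nonneg_left (by exact_mod_cast hl.deg z) ha0).trans hθ
      have := mul_nonneg hK (hw z)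
      nlinarith
    by_cases hz : e.1 = z ∨ e.2 = z
    · have hcard : ((insert e S).filter fun e => e.1 = z ∨ e.2 = z).card =
          (S.filter fun e => e.1 = z ∨ e.2 = z).card + 1 := by
        rw [Finset.filter_insert, if_pos hz, Finset.card_insert_of_notMem]
        simp [he]
      rw [hcard]
      have h1 := ih z y hy
      have h2 := norm_heis_gate_sub_le (M e) X₁ ht.selfAdjoint θ
      have h3 := ht.bound X₁ _ _ (hcrude e.1) (hcrude e.2)
      have hsum : K * w e.1 + K * w e.2 ≤ (1 + C) * (K * w z) := by
        have hl := h.weight_left e (Finset.mem_insert_self _ _)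
        have hr := h.weight_right e (Finset.mem_insert_self _ _)
        rcases hz with rfl | rfl
        · nlinarith [mul_le_mul_of_nonneg_left hr hK]
        · nlinarith [mul_le_mul_of_nonneg_left hl hK]
      have h4 : ‖heis (gate (M e) θ) X₁ - X₁‖ ≤ |θ| * (c₀ * (2 * ((1 + C) * (K * w z)))) := by
        refine h2.trans (mul_le_mul_of_nonneg_left (h3.trans ?_) (abs_nonneg _))
        exact mul_le_mul_of_nonneg_left (by linarith) hc₀
      set Δ := heis (gate (M e) θ) X₁ - X₁ with hΔ
      have h5 : heis (gate (M e) θ) X₁ * y - y * heis (gate (M e) θ) X₁ =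
          (X₁ * y - y * X₁) + (Δ * y - y * Δ) := by
        rw [hΔ]; noncomm_ring
      have hyn := hY z y hy
      have h6 : ‖Δ * y - y * Δ‖ ≤ 2 * ‖Δ‖ := by
        refine (norm_sub_le _ _).trans ?_
        have h7 := (norm_mul_le Δ y).trans (mul_le_mul_of_nonneg_left hyn (norm_nonneg Δ))
        have h8 := (norm_mul_le y Δ).trans (mul_le_mul_of_nonneg_right hyn (norm_nonneg Δ))
        linarith
      rw [h5]
      refine (norm_add_le _ _).trans ?_
      push_cast
      rw [ha] at h1 ⊢
      linarith
    · push Not at hz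
      have hcard : ((insert e S).filter fun e => e.1 = z ∨ e.2 = z) =
          (S.filter fun e => e.1 = z ∨ e.2 = z) := by
        rw [Finset.filter_insert, if_neg (by tauto)]
      rw [hcard, heis_commutator hu, norm_heis hu]
      · exact ih z y hy
      · exact Commute.gate_right (ht.commute z hz.1.symm hz.2.symm y hy) θ

theorem Layer.osc_heis' {Y : P → Set 𝒜} (hY : ∀ z, ∀ y ∈ Y z, ‖y‖ ≤ 1) {c₀ C : ℝ} {D : ℕ}
    {w : P → ℝ} {M : P × P → 𝒜} (hc₀ : 0 ≤ c₀) (hC : 0 ≤ C)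
    (hw : ∀ z, 0 ≤ w z) {K θ : ℝ} (hK : 0 ≤ K) {X : 𝒜}
    (hX : ∀ z, Osc Y X z (K * w z)) (hθ : 4 * c₀ * (1 + C) * |θ| * D ≤ 1) {S : Finset (P × P)}
    (h : Layer Y c₀ C D w S M) (z : P) :
    Osc Y (heis (gate (∑ e ∈ S, M e) θ) X) z (K * (1 + 4 * c₀ * (1 + C) * D * |θ|) * w z) := by
  refine (h.osc_heis hY hc₀ hC hw hK hX hθ S z).mono ?_
  have h1 : 4 * c₀ * (1 + C) * |θ| * ((S.filter fun e => e.1 = z ∨ e.2 = z).card : ℝ) ≤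
      4 * c₀ * (1 + C) * |θ| * D :=
    mul_le_mul_of_nonneg_left (by exact_mod_cast h.deg z) (by positivity)
  have := mul_nonneg hK (hw z)
  nlinarith

theorem Layer.norm_heis_sub_heis_le {Y : P → Set 𝒜} (hY : ∀ z, ∀ y ∈ Y z, ‖y‖ ≤ 1) {c₀ C : ℝ}
    {D : ℕ} {w : P → ℝ} {M : P × P → 𝒜} (hc₀ : 0 ≤ c₀) (hC : 0 ≤ C)
    (hw : ∀ z, 0 ≤ w z) {K θ : ℝ} (hK : 0 ≤ K) {X : 𝒜}
    (hX : ∀ z, Osc Y X z (K * w z)) (hθ : 4 * c₀ * (1 + C) * |θ| * D ≤ 1) {S : Finset (P × P)}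
    (R : Finset (P × P)) : Disjoint S R → Layer Y c₀ C D w (S ∪ R) M →
    ‖heis (gate (∑ e ∈ S ∪ R, M e) θ) X - heis (gate (∑ e ∈ S, M e) θ) X‖ ≤
      2 * c₀ * |θ| * K * ∑ e ∈ R, (w e.1 + w e.2) := by
  induction R using Finset.induction_on with
  | empty => intro _ _; simp
  | insert e R he ih =>
    intro hd h
    have hd' : Disjoint S R := hd.mono_right (Finset.subset_insert e R)
    have hsub : S ∪ R ⊆ S ∪ insert e R := Finset.union_subset_union_right (Finset.subset_insert e R)
    have hl := h.mono hsub
    have heS : e ∉ S ∪ R := by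
      have := Finset.disjoint_right.1 hd (Finset.mem_insert_self e R)
      simp [this, he]
    have ih := ih hd' hl
    have ht := h.term e (by simp)
    rw [Finset.union_insert] at h ⊢
    rw [h.gate_insert heS, heis_mul, Finset.sum_insert he]
    set X₁ := heis (gate (∑ e ∈ S ∪ R, M e) θ) X with hX₁
    have hosc : ∀ z, Osc Y X₁ z (2 * (K * w z)) := by
      intro z
      refine (hl.osc_heis' hY hc₀ hC hw hK hX hθ z).mono ?_
      have := mul_nonneg hK (hw z)
      nlinarith
    have h2 := norm_heis_gate_sub_le (M e) X₁ ht.selfAdjoint θ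
    have h3 := ht.bound X₁ _ _ (hosc e.1) (hosc e.2)
    have h4 := h2.trans (mul_le_mul_of_nonneg_left h3 (abs_nonneg θ))
    have h5 := norm_sub_le_norm_sub_add_norm_sub (heis (gate (M e) θ) X₁) X₁
      (heis (gate (∑ e ∈ S, M e) θ) X)
    linarith

/-- The Heisenberg evolution by a circuit whose layers are listed in the order in which they are
performed. -/
def heisList {I : Type*} (H : I → 𝒜) : List (I × ℝ) → 𝒜 → 𝒜
  | [], X => X
  | p :: l, X => heis (gate (H p.1) p.2) (heisList H l X)

theorem osc_heisList {I : Type*} {Y : P → Set 𝒜} (hY : ∀ z, ∀ y ∈ Y z, ‖y‖ ≤ 1) {c₀ C : ℝ} {D : ℕ}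
    {w : P → ℝ} {M : I → P × P → 𝒜} (hc₀ : 0 ≤ c₀) (hC : 0 ≤ C)
    (hw : ∀ z, 0 ≤ w z) {K : ℝ} (hK : 0 ≤ K) {X : 𝒜}
    (hX : ∀ z, Osc Y X z (K * w z)) {S : I → Finset (P × P)}
    (h : ∀ i, Layer Y c₀ C D w (S i) (M i)) (l : List (I × ℝ))
    (hθ : ∀ p ∈ l, 4 * c₀ * (1 + C) * |p.2| * D ≤ 1) (z : P) :
    Osc Y (heisList (fun i => ∑ e ∈ S i, M i e) l X) z
      (K * Real.exp (4 * c₀ * (1 + C) * D * (l.map fun p => |p.2|).sum) * w z) := by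
  induction l generalizing z with
  | nil => simpa [heisList] using hX z
  | cons p l ih =>
    have ih := ih fun q hq => hθ q (List.mem_cons_of_mem _ hq)
    refine ((h p.1).osc_heis' hY hc₀ hC hw (by positivity) ih (hθ p List.mem_cons_self) z).mono ?_
    simp only [List.map_cons, List.sum_cons]
    refine mul_le_mul_of_nonneg_right ?_ (hw z)
    rw [mul_add (4 * c₀ * (1 + C) * D), Real.exp_add, mul_assoc K]
    refine mul_le_mul_of_nonneg_left ?_ hK
    rw [mul_comm]
    refine mul_le_mul_of_nonneg_right ?_ (Real.exp_nonneg _)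
    have := Real.add_one_le_exp (4 * c₀ * (1 + C) * D * |p.2|)
    linarith

/-- Lieb–Robinson bound: changing a circuit far away from the support of `X` has little effect on
the evolution of `X`. -/
theorem norm_heisList_sub_heisList_le {I : Type*} {Y : P → Set 𝒜}
    (hY : ∀ z, ∀ y ∈ Y z, ‖y‖ ≤ 1) {c₀ C : ℝ} {D : ℕ}
    {w : P → ℝ} {M : I → P × P → 𝒜} (hc₀ : 0 ≤ c₀) (hC : 0 ≤ C)
    (hw : ∀ z, 0 ≤ w z) {K : ℝ} (hK : 0 ≤ K) {X : 𝒜}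
    (hX : ∀ z, Osc Y X z (K * w z)) {S S' : I → Finset (P × P)} (hS : ∀ i, S i ⊆ S' i)
    (h : ∀ i, Layer Y c₀ C D w (S' i) (M i)) {τ : ℝ} (hτ0 : 0 ≤ τ)
    (hτ : ∀ i, ∑ e ∈ S' i \ S i, (w e.1 + w e.2) ≤ τ) (l : List (I × ℝ))
    (hθ : ∀ p ∈ l, 4 * c₀ * (1 + C) * |p.2| * D ≤ 1) :
    ‖heisList (fun i => ∑ e ∈ S' i, M i e) l X - heisList (fun i => ∑ e ∈ S i, M i e) l X‖ ≤
      2 * c₀ * K * Real.exp (4 * c₀ * (1 + C) * D * (l.map fun p => |p.2|).sum) *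
        (l.map fun p => |p.2|).sum * τ := by
  induction l with
  | nil => simp [heisList]
  | cons p l ih =>
    have hθ' : ∀ q ∈ l, 4 * c₀ * (1 + C) * |q.2| * D ≤ 1 :=
      fun q hq => hθ q (List.mem_cons_of_mem _ hq)
    have ih := ih hθ'
    have hosc := osc_heisList hY hc₀ hC hw hK hX (fun i => (h i).mono (hS i)) l hθ'
    set E := Real.exp (4 * c₀ * (1 + C) * D * (l.map fun p => |p.2|).sum) with hE
    set X₁ := heisList (fun i => ∑ e ∈ S i, M i e) l X with hX₁
    set X₂ := heisList (fun i => ∑ e ∈ S' i, M i e) l X with hX₂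
    have hu := gate_mem_unitary (∑ e ∈ S' p.1, M p.1 e) (h p.1).selfAdjoint p.2
    have hun : S p.1 ∪ (S' p.1 \ S p.1) = S' p.1 := Finset.union_sdiff_of_subset (hS p.1)
    have h1 := Layer.norm_heis_sub_heis_le hY hc₀ hC hw (by positivity) hosc
      (hθ p List.mem_cons_self) (S' p.1 \ S p.1) Finset.disjoint_sdiff (by rw [hun]; exact h p.1)
    rw [hun] at h1
    have h2 : ‖heis (gate (∑ e ∈ S' p.1, M p.1 e) p.2) X₂ -
        heis (gate (∑ e ∈ S' p.1, M p.1 e) p.2) X₁‖ = ‖X₂ - X₁‖ := by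
      rw [← heis_sub, norm_heis hu]
    have h3 := norm_sub_le_norm_sub_add_norm_sub (heis (gate (∑ e ∈ S' p.1, M p.1 e) p.2) X₂)
      (heis (gate (∑ e ∈ S' p.1, M p.1 e) p.2) X₁) (heis (gate (∑ e ∈ S p.1, M p.1 e) p.2) X₁)
    simp only [heisList, List.map_cons, List.sum_cons]
    refine h3.trans ?_
    rw [h2]
    set s := (l.map fun p => |p.2|).sum with hs
    have hs0 : 0 ≤ s := List.sum_nonneg fun x hx => by
      obtain ⟨q, _, rfl⟩ := List.mem_map.1 hx
      exact abs_nonneg _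
    have hEE : E ≤ Real.exp (4 * c₀ * (1 + C) * D * (|p.2| + s)) := by
      refine Real.exp_le_exp.2 (mul_le_mul_of_nonneg_left ?_ (by positivity))
      linarith [abs_nonneg p.2]
    have h4 : ‖X₂ - X₁‖ ≤ 2 * c₀ * K *
        Real.exp (4 * c₀ * (1 + C) * D * (|p.2| + s)) * s * τ := by
      refine ih.trans ?_
      gcongr
    have h5 : 2 * c₀ * |p.2| * (K * E) * ∑ e ∈ S' p.1 \ S p.1, (w e.1 + w e.2) ≤
        2 * c₀ * |p.2| * (K * Real.exp (4 * c₀ * (1 + C) * D * (|p.2| + s))) * τ := by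
      refine (mul_le_mul_of_nonneg_left (hτ p.1) (by positivity)).trans ?_
      gcongr
    linarith

end LiebRobinson

end QCA

namespace QCA

/-! ### The time-ordered exponential -/

theorem integral_mul_primitive_pow {h : ℝ → ℝ} {t : ℝ} (hh : IntervalIntegrable h volume 0 t)
    (n : ℕ) : ∫ s in (0 : ℝ)..t, h s * (∫ r in (0 : ℝ)..s, h r) ^ n =
      (∫ r in (0 : ℝ)..t, h r) ^ (n + 1) / (n + 1) := by
  set ω : ℝ → ℝ := fun s => ∫ r in (0 : ℝ)..s, h r with hω
  have hac : AbsolutelyContinuousOnInterval ω 0 t :=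
    hh.absolutelyContinuousOnInterval_intervalIntegral (by simp)
  have hpow : ∀ n : ℕ, AbsolutelyContinuousOnInterval (fun s => ω s ^ (n + 1)) 0 t := by
    intro n
    induction n with
    | zero => simpa using hac
    | succ n ih => simpa only [pow_succ _ (n + 1)] using ih.fun_mul hac
  have h1 := (hpow n).integral_deriv_eq_sub
  have h2 : ∫ s in (0 : ℝ)..t, deriv (fun s => ω s ^ (n + 1)) s =
      ∫ s in (0 : ℝ)..t, (n + 1) * (h s * ω s ^ n) := by
    apply intervalIntegral.integral_congr_ae
    filter_upwards [hh.ae_hasDerivAt_integral] with s hs hst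
    have hd := hs (Set.uIoc_subset_uIcc hst) 0 (by simp)
    have := (hd.pow (n + 1)).deriv
    simp only [Nat.add_sub_cancel, Nat.cast_add, Nat.cast_one] at this
    change deriv (ω ^ (n + 1)) s = _
    rw [this]
    simp only [hω]
    ring
  have h0 : ω 0 = 0 := by simp [hω]
  rw [h2, intervalIntegral.integral_const_mul, h0] at h1
  rw [eq_div_iff (by positivity), mul_comm, h1]
  simp [hω]

section TimeOrdered

variable {𝒜 : Type*} [CStarAlgebra 𝒜]

/-- `H` is locally integrable on the positive half-line and dominated by `h`. -/
structure Dominated (H : ℝ → 𝒜) (h : ℝ → ℝ) : Prop where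
  int : ∀ t, 0 ≤ t → IntervalIntegrable H volume 0 t
  int_bound : ∀ t, 0 ≤ t → IntervalIntegrable h volume 0 t
  le : ∀ t, ‖H t‖ ≤ h t

/-- Terms of the Dyson series in a C⋆-algebra. -/
def dysonTerm (H : ℝ → 𝒜) : ℕ → ℝ → 𝒜
  | 0, _ => 1
  | n + 1, t => (-Complex.I) • ∫ s in (0 : ℝ)..t, H s * dysonTerm H n s

/-- The time-ordered exponential in a C⋆-algebra. -/
def timeExp (H : ℝ → 𝒜) (t : ℝ) : 𝒜 := ∑' n, dysonTerm H n t

variable {H : ℝ → 𝒜} {h : ℝ → ℝ}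

theorem Dominated.continuousOn_primitive (hH : Dominated H h) (τ : ℝ) (hτ : 0 ≤ τ) :
    ContinuousOn (fun t => ∫ s in (0 : ℝ)..t, h s) (Set.Icc 0 τ) := by
  have := intervalIntegral.continuousOn_primitive_interval' (hH.int_bound τ hτ)
    (Set.left_mem_uIcc (a := (0 : ℝ)) (b := τ))
  rwa [Set.uIcc_of_le hτ] at this

theorem Dominated.int_of_le (hH : Dominated H h) {s t : ℝ} (hs : 0 ≤ s) (ht : 0 ≤ t) :
    IntervalIntegrable H volume s t := (hH.int s hs).symm.trans (hH.int t ht)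

theorem Dominated.int_bound_of_le (hH : Dominated H h) {s t : ℝ} (hs : 0 ≤ s) (ht : 0 ≤ t) :
    IntervalIntegrable h volume s t := (hH.int_bound s hs).symm.trans (hH.int_bound t ht)

theorem Dominated.nonneg (hH : Dominated H h) (t : ℝ) : 0 ≤ h t := (norm_nonneg _).trans (hH.le t)

theorem Dominated.integral_eq_sub (hH : Dominated H h) {s t : ℝ} (hs : 0 ≤ s) (ht : 0 ≤ t) :
    ∫ r in s..t, h r = (∫ r in (0 : ℝ)..t, h r) - ∫ r in (0 : ℝ)..s, h r :=
  (intervalIntegral.integral_interval_sub_left (hH.int_bound t ht) (hH.int_bound s hs)).symm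

theorem Dominated.primitive_mono (hH : Dominated H h) {s t : ℝ} (hs : 0 ≤ s) (hst : s ≤ t) :
    ∫ r in (0 : ℝ)..s, h r ≤ ∫ r in (0 : ℝ)..t, h r := by
  have := hH.integral_eq_sub hs (hs.trans hst)
  have h2 : 0 ≤ ∫ r in s..t, h r := intervalIntegral.integral_nonneg hst fun r _ => hH.nonneg r
  linarith

theorem Dominated.continuousOn_dysonTerm (hH : Dominated H h) (n : ℕ) (τ : ℝ) (hτ : 0 ≤ τ) :
    ContinuousOn (dysonTerm H n) (Set.Icc 0 τ) := by
  induction n with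
  | zero => exact continuousOn_const
  | succ n ih =>
    have hi : IntervalIntegrable (fun s => H s * dysonTerm H n s) volume 0 τ :=
      (hH.int τ hτ).mul_continuousOn (by rwa [Set.uIcc_of_le hτ])
    have := intervalIntegral.continuousOn_primitive_interval' hi
      (Set.left_mem_uIcc (a := (0 : ℝ)) (b := τ))
    rw [Set.uIcc_of_le hτ] at this
    exact this.const_smul (-Complex.I)

theorem Dominated.int_mul (hH : Dominated H h) {f : ℝ → 𝒜}
    (hf : ∀ τ, 0 ≤ τ → ContinuousOn f (Set.Icc 0 τ)) {τ : ℝ} (hτ : 0 ≤ τ) :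
    IntervalIntegrable (fun s => H s * f s) volume 0 τ :=
  (hH.int τ hτ).mul_continuousOn (by rw [Set.uIcc_of_le hτ]; exact hf τ hτ)

section Bounds

variable [Nontrivial 𝒜]

theorem Dominated.norm_dysonTerm_le (hH : Dominated H h) (n : ℕ) {t : ℝ} (ht : 0 ≤ t) :
    ‖dysonTerm H n t‖ ≤ (∫ r in (0 : ℝ)..t, h r) ^ n / n.factorial := by
  induction n generalizing t with
  | zero => simp [dysonTerm]
  | succ n ih =>
    have hi := hH.int_mul (hH.continuousOn_dysonTerm n) ht
    have hb : IntervalIntegrable (fun s => h s * (∫ r in (0 : ℝ)..s, h r) ^ n / n.factorial)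
        volume 0 t := by
      refine ((hH.int_bound t ht).mul_continuousOn ?_).div_const _
      rw [Set.uIcc_of_le ht]
      exact (hH.continuousOn_primitive t ht).pow n
    rw [dysonTerm, norm_smul, norm_neg, Complex.norm_I, one_mul]
    have h1 := intervalIntegral.norm_integral_le_of_norm_le (f := fun s => H s * dysonTerm H n s) ht
      (Eventually.of_forall fun s hs => ?_) hb
    · refine h1.trans (le_of_eq ?_)
      rw [intervalIntegral.integral_div, integral_mul_primitive_pow (hH.int_bound t ht),
        Nat.factorial_succ]
      push_cast
      field_simp
    · rw [mul_div_assoc]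
      exact (norm_mul_le _ _).trans (mul_le_mul (hH.le s) (ih hs.1.le) (norm_nonneg _)
        (hH.nonneg s))

theorem Dominated.summable_norm_dysonTerm (hH : Dominated H h) {t : ℝ} (ht : 0 ≤ t) :
    Summable fun n => ‖dysonTerm H n t‖ :=
  (Real.summable_pow_div_factorial _).of_nonneg_of_le (fun _ => norm_nonneg _)
    fun n => hH.norm_dysonTerm_le n ht

theorem Dominated.norm_timeExp_le (hH : Dominated H h) {t : ℝ} (ht : 0 ≤ t) :
    ‖timeExp H t‖ ≤ Real.exp (∫ r in (0 : ℝ)..t, h r) := by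
  refine (norm_tsum_le_tsum_norm (hH.summable_norm_dysonTerm ht)).trans ?_
  rw [Real.exp_eq_exp_ℝ, NormedSpace.exp_eq_tsum_div]
  exact (hH.summable_norm_dysonTerm ht).tsum_le_tsum (fun n => hH.norm_dysonTerm_le n ht)
    (Real.summable_pow_div_factorial _)

theorem Dominated.continuousOn_timeExp (hH : Dominated H h) (τ : ℝ) (hτ : 0 ≤ τ) :
    ContinuousOn (timeExp H) (Set.Icc 0 τ) := by
  refine continuousOn_tsum (fun n => hH.continuousOn_dysonTerm n τ hτ)
    (Real.summable_pow_div_factorial (∫ r in (0 : ℝ)..τ, h r)) fun n t ht =>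
    (hH.norm_dysonTerm_le n ht.1).trans ?_
  have h0 : 0 ≤ ∫ r in (0 : ℝ)..t, h r :=
    intervalIntegral.integral_nonneg ht.1 fun r _ => hH.nonneg r
  have := hH.primitive_mono ht.1 ht.2
  gcongr

theorem Dominated.timeExp_eq (hH : Dominated H h) {t : ℝ} (ht : 0 ≤ t) :
    timeExp H t = 1 - Complex.I • ∫ s in (0 : ℝ)..t, H s * timeExp H s := by
  have hs := (hH.summable_norm_dysonTerm ht).of_norm
  have hsum : HasSum (fun n => ∫ s in (0 : ℝ)..t, H s * dysonTerm H n s)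
      (∫ s in (0 : ℝ)..t, H s * timeExp H s) := by
    refine intervalIntegral.hasSum_integral_of_dominated_convergence
      (fun n s => h s * ((∫ r in (0 : ℝ)..t, h r) ^ n / n.factorial)) (fun n => ?_) (fun n => ?_)
      ?_ ?_ ?_
    · exact (hH.int_mul (hH.continuousOn_dysonTerm n) ht).def'.aestronglyMeasurable
    · refine Eventually.of_forall fun s hs => ?_
      rw [Set.uIoc_of_le ht] at hs
      have h0 : 0 ≤ ∫ r in (0 : ℝ)..s, h r :=
        intervalIntegral.integral_nonneg hs.1.le fun r _ => hH.nonneg r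
      have h1 := hH.primitive_mono hs.1.le hs.2
      refine (norm_mul_le _ _).trans (mul_le_mul (hH.le s)
        ((hH.norm_dysonTerm_le n hs.1.le).trans ?_) (norm_nonneg _) (hH.nonneg s))
      gcongr
    · exact Eventually.of_forall fun s _ => (Real.summable_pow_div_factorial _).mul_left _
    · simp only [tsum_mul_left]
      exact (hH.int_bound t ht).mul_const _
    · refine Eventually.of_forall fun s hs => ?_
      rw [Set.uIoc_of_le ht] at hs
      exact ((hH.summable_norm_dysonTerm hs.1.le).of_norm.hasSum).mul_left _
  unfold timeExp at hsum ⊢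
  rw [hs.tsum_eq_zero_add, sub_eq_add_neg, ← neg_smul, ← (hsum.const_smul (-Complex.I)).tsum_eq]
  rfl

theorem Dominated.timeExp_sub (hH : Dominated H h) {s t : ℝ} (hs : 0 ≤ s) (hst : s ≤ t) :
    timeExp H t - timeExp H s = -(Complex.I • ∫ r in s..t, H r * timeExp H r) := by
  have ht := hs.trans hst
  rw [hH.timeExp_eq ht, hH.timeExp_eq hs, ← intervalIntegral.integral_interval_sub_left
    (hH.int_mul hH.continuousOn_timeExp ht) (hH.int_mul hH.continuousOn_timeExp hs), smul_sub]
  abel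

theorem Dominated.norm_timeExp_sub_le (hH : Dominated H h) {s t : ℝ} (hs : 0 ≤ s) (hst : s ≤ t) :
    ‖timeExp H t - timeExp H s‖ ≤ Real.exp (∫ r in (0 : ℝ)..t, h r) *
      ((∫ r in (0 : ℝ)..t, h r) - ∫ r in (0 : ℝ)..s, h r) := by
  have ht := hs.trans hst
  rw [hH.timeExp_sub hs hst, norm_neg, norm_smul, Complex.norm_I, one_mul,
    ← hH.integral_eq_sub hs ht, ← intervalIntegral.integral_const_mul]
  refine intervalIntegral.norm_integral_le_of_norm_le hst (Eventually.of_forall fun r hr => ?_)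
    ((hH.int_bound_of_le hs ht).const_mul _)
  have hr0 := hs.trans hr.1.le
  rw [mul_comm]
  refine (norm_mul_le _ _).trans (mul_le_mul (hH.le r) ((hH.norm_timeExp_le hr0).trans ?_)
    (norm_nonneg _) (hH.nonneg r))
  exact Real.exp_le_exp.2 (hH.primitive_mono hr0 hr.2)

theorem Dominated.norm_timeExp_sub_euler_le (hH : Dominated H h) {s t : ℝ} (hs : 0 ≤ s)
    (hst : s ≤ t) :
    ‖timeExp H t - (1 - Complex.I • ∫ r in s..t, H r) * timeExp H s‖ ≤
      Real.exp (∫ r in (0 : ℝ)..t, h r) *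
        ((∫ r in (0 : ℝ)..t, h r) - ∫ r in (0 : ℝ)..s, h r) ^ 2 := by
  have ht := hs.trans hst
  have hi := hH.int_of_le hs ht
  have hi1 : IntervalIntegrable (fun r => H r * timeExp H r) volume s t :=
    (hH.int_mul hH.continuousOn_timeExp hs).symm.trans (hH.int_mul hH.continuousOn_timeExp ht)
  have hi2 : IntervalIntegrable (fun r => H r * timeExp H s) volume s t :=
    hi.mul_continuousOn continuousOn_const
  have h1 : timeExp H t - (1 - Complex.I • ∫ r in s..t, H r) * timeExp H s =
      -(Complex.I • ∫ r in s..t, H r * (timeExp H r - timeExp H s)) := by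
    simp only [mul_sub]
    rw [intervalIntegral.integral_sub hi1 hi2, smul_sub, sub_mul, one_mul, smul_mul_assoc,
      neg_sub, ← sub_add, hH.timeExp_sub hs hst]
    have h2 : ∫ r in s..t, H r * timeExp H s = (∫ r in s..t, H r) * timeExp H s :=
      ((ContinuousLinearMap.mul ℂ 𝒜).flip (timeExp H s)).intervalIntegral_comp_comm hi
    rw [h2]
    abel
  rw [h1, norm_neg, norm_smul, Complex.norm_I, one_mul, pow_two, ← mul_assoc]
  set c := Real.exp (∫ r in (0 : ℝ)..t, h r) *
    ((∫ r in (0 : ℝ)..t, h r) - ∫ r in (0 : ℝ)..s, h r) with hc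
  rw [← hH.integral_eq_sub hs ht, ← intervalIntegral.integral_const_mul]
  refine intervalIntegral.norm_integral_le_of_norm_le hst (Eventually.of_forall fun r hr => ?_)
    ((hH.int_bound_of_le hs ht).const_mul _)
  rw [mul_comm]
  refine (norm_mul_le _ _).trans (mul_le_mul (hH.le r) ?_ (norm_nonneg _) (hH.nonneg r))
  refine (hH.norm_timeExp_sub_le hs hr.1.le).trans ?_
  have hm := hH.primitive_mono (hs.trans hr.1.le) hr.2
  have hm' := hH.primitive_mono hs hr.1.le
  rw [hc]
  exact mul_le_mul (Real.exp_le_exp.2 hm) (by linarith) (by linarith) (Real.exp_nonneg _)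

end Bounds

/-! ### Circuits and the product formula -/

/-- The product of the gates of a circuit, listed in the order in which they are performed. -/
def circ {I : Type*} (H : I → 𝒜) : List (I × ℝ) → 𝒜
  | [] => 1
  | p :: l => circ H l * gate (H p.1) p.2

theorem circ_append {I : Type*} (H : I → 𝒜) (l l' : List (I × ℝ)) :
    circ H (l ++ l') = circ H l' * circ H l := by
  induction l with
  | nil => simp [circ]
  | cons p l ih => simp [circ, ih, mul_assoc]

theorem heis_circ {I : Type*} (H : I → 𝒜) (l : List (I × ℝ)) (X : 𝒜) :
    heis (circ H l) X = heisList H l X := by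
  induction l with
  | nil => simp [circ, heisList, heis_one]
  | cons p l ih => rw [circ, heis_mul, ih, heisList]

theorem circ_mem_unitary {I : Type*} {H : I → 𝒜} (hH : ∀ i, IsSelfAdjoint (H i))
    (l : List (I × ℝ)) : circ H l ∈ unitary 𝒜 := by
  induction l with
  | nil => exact one_mem _
  | cons p l ih => exact mul_mem ih (gate_mem_unitary _ (hH _) _)

theorem norm_gate_sub_one_le (M : 𝒜) (hM : IsSelfAdjoint M) (θ : ℝ) :
    ‖gate M θ - 1‖ ≤ |θ| * ‖M‖ := by
  have key := convex_univ.norm_image_sub_le_of_norm_hasDerivWithin_le (f := gate M) (C := ‖M‖)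
    (fun s _ => (hasDerivAt_gate M s).hasDerivWithinAt) (fun s _ => ?_) (Set.mem_univ 0)
    (Set.mem_univ θ)
  · have h0 : gate M 0 = 1 := by simp [gate]
    rwa [h0, sub_zero, Real.norm_eq_abs, mul_comm] at key
  · rw [CStarRing.norm_mem_unitary_mul _ (gate_mem_unitary M hM s), norm_smul, norm_neg,
      Complex.norm_I, one_mul]

theorem norm_gate_sub_one_add_le (M : 𝒜) (hM : IsSelfAdjoint M) (θ : ℝ) :
    ‖gate M θ - 1 + (Complex.I * θ) • M‖ ≤ (|θ| * ‖M‖) ^ 2 := by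
  have hd : ∀ s : ℝ, HasDerivAt (fun s : ℝ => gate M s + (Complex.I * s) • M)
      ((gate M s - 1) * ((-Complex.I) • M)) s := by
    intro s
    have h1 : HasDerivAt (fun s : ℝ => Complex.I * (s : ℂ)) (Complex.I * 1) s :=
      (Complex.ofRealCLM.hasDerivAt (x := s)).const_mul Complex.I
    refine ((hasDerivAt_gate M s).add (h1.smul_const M)).congr_deriv ?_
    rw [sub_mul, one_mul, neg_smul, mul_one, sub_neg_eq_add]
  have key := (convex_uIcc 0 θ).norm_image_sub_le_of_norm_hasDerivWithin_le
    (f := fun s : ℝ => gate M s + (Complex.I * s) • M) (C := |θ| * ‖M‖ * ‖M‖)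
    (fun s _ => (hd s).hasDerivWithinAt) (fun s hs => ?_) Set.left_mem_uIcc
    Set.right_mem_uIcc
  · have h0 : gate M 0 = 1 := by simp [gate]
    simp only [h0, Complex.ofReal_zero, mul_zero, zero_smul, add_zero, sub_zero,
      Real.norm_eq_abs] at key
    rw [sub_add_eq_add_sub]
    refine key.trans (le_of_eq ?_)
    ring
  · refine (norm_mul_le _ _).trans ?_
    rw [norm_smul, norm_neg, Complex.norm_I, one_mul]
    refine mul_le_mul_of_nonneg_right ?_ (norm_nonneg _)
    refine (norm_gate_sub_one_le M hM s).trans (mul_le_mul_of_nonneg_right ?_ (norm_nonneg _))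
    rw [Set.mem_uIcc] at hs
    rcases hs with hs | hs
    · rw [abs_of_nonneg hs.1, abs_of_nonneg (hs.1.trans hs.2)]; exact hs.2
    · rw [abs_of_nonpos hs.2, abs_of_nonpos (hs.1.trans hs.2)]; linarith [hs.1]

theorem norm_circ_sub_le {I : Type*} {H : I → 𝒜} (hH : ∀ i, IsSelfAdjoint (H i))
    (l : List (I × ℝ)) :
    ‖circ H l - 1‖ ≤ (l.map fun p => |p.2| * ‖H p.1‖).sum ∧
    ‖circ H l - 1 + (l.map fun p => (Complex.I * p.2) • H p.1).sum‖ ≤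
      (l.map fun p => |p.2| * ‖H p.1‖).sum ^ 2 := by
  induction l with
  | nil => simp [circ]
  | cons p l ih =>
    obtain ⟨ih1, ih2⟩ := ih
    have g1 := norm_gate_sub_one_le (H p.1) (hH _) p.2
    have g2 := norm_gate_sub_one_add_le (H p.1) (hH _) p.2
    simp only [circ, List.map_cons, List.sum_cons]
    set r := (l.map fun p => |p.2| * ‖H p.1‖).sum
    set x := |p.2| * ‖H p.1‖
    set σ := (l.map fun p => (Complex.I * p.2) • H p.1).sum
    set g := gate (H p.1) p.2
    have hprod : ‖(circ H l - 1) * (g - 1)‖ ≤ r * x :=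
      (norm_mul_le _ _).trans (mul_le_mul ih1 g1 (norm_nonneg _) ((norm_nonneg _).trans ih1))
    have hx : 0 ≤ x := (norm_nonneg _).trans g1
    have hr : 0 ≤ r := (norm_nonneg _).trans ih1
    constructor
    · have e : circ H l * g - 1 = circ H l * (g - 1) + (circ H l - 1) := by noncomm_ring
      rw [e]
      refine (norm_add_le _ _).trans (add_le_add ?_ ih1)
      rwa [CStarRing.norm_mem_unitary_mul _ (circ_mem_unitary hH l)]
    · have e : circ H l * g - 1 + ((Complex.I * p.2) • H p.1 + σ) =
          (circ H l - 1) * (g - 1) + (circ H l - 1 + σ) + (g - 1 + (Complex.I * p.2) • H p.1) := by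
        noncomm_ring
      rw [e]
      refine (norm_add₃_le).trans ?_
      nlinarith

variable {ι : Type*}

/-- The gates of time step number `n` of a product formula for the Hamiltonian `∑ i, c i • M i`:
the coefficients are averaged over the time step. -/
def stepList (c : ι → ℝ → ℝ) (l : List ι) (Δ : ℝ) (n : ℕ) : List (ι × ℝ) :=
  l.map fun i => (i, ∫ s in (n * Δ)..((n + 1) * Δ), c i s)

/-- The gates of the first `n` time steps. -/
def timeList (c : ι → ℝ → ℝ) (l : List ι) (Δ : ℝ) : ℕ → List (ι × ℝ)
  | 0 => []
  | n + 1 => timeList c l Δ n ++ stepList c l Δ n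

theorem abs_integral_le_sub {c : ℝ → ℝ} (hc : ∀ t, 0 ≤ t → IntervalIntegrable c volume 0 t)
    {s t : ℝ} (hs : 0 ≤ s) (hst : s ≤ t) :
    |∫ r in s..t, c r| ≤ (∫ r in (0 : ℝ)..t, |c r|) - ∫ r in (0 : ℝ)..s, |c r| := by
  rw [intervalIntegral.integral_interval_sub_left (hc t (hs.trans hst)).abs (hc s hs).abs]
  exact intervalIntegral.abs_integral_le_integral_abs hst

variable [Fintype ι]

theorem sum_abs_timeList_le {c : ι → ℝ → ℝ}
    (hc : ∀ i t, 0 ≤ t → IntervalIntegrable (c i) volume 0 t) {Δ : ℝ} (hΔ : 0 < Δ) (n : ℕ) :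
    ((timeList c Finset.univ.toList Δ n).map fun p => |p.2|).sum ≤
      ∑ i, ∫ r in (0 : ℝ)..(n * Δ), |c i r| := by
  induction n with
  | zero => simp [timeList]
  | succ n ih =>
    rw [timeList, List.map_append, List.sum_append]
    have h1 : ((stepList c Finset.univ.toList Δ n).map fun p => |p.2|).sum =
        ∑ i, |∫ s in (n * Δ)..((n + 1) * Δ), c i s| := by
      rw [stepList, List.map_map, Finset.sum_map_toList (s := Finset.univ)]
      rfl
    have h2 : ∑ i, |∫ s in (n * Δ)..((n + 1) * Δ), c i s| ≤
        ∑ i, ((∫ r in (0 : ℝ)..((n + 1) * Δ), |c i r|) - ∫ r in (0 : ℝ)..(n * Δ), |c i r|) :=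
      Finset.sum_le_sum fun i _ => abs_integral_le_sub (hc i) (by positivity) (by nlinarith)
    rw [Finset.sum_sub_distrib] at h2
    push_cast
    linarith

theorem mem_timeList {c : ι → ℝ → ℝ} {Δ : ℝ} {n : ℕ} {p : ι × ℝ}
    (hp : p ∈ timeList c Finset.univ.toList Δ n) :
    ∃ k < n, p.2 = ∫ s in (k * Δ)..((k + 1) * Δ), c p.1 s := by
  induction n with
  | zero => simp [timeList] at hp
  | succ n ih =>
    rw [timeList, List.mem_append] at hp
    rcases hp with hp | hp
    · obtain ⟨k, hk, h⟩ := ih hp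
      exact ⟨k, by omega, h⟩
    · obtain ⟨i, _, rfl⟩ := List.mem_map.1 hp
      exact ⟨n, by omega, rfl⟩

theorem exists_forall_abs_integral_le {c : ι → ℝ → ℝ}
    (hc : ∀ i t, 0 ≤ t → IntervalIntegrable (c i) volume 0 t) {τ η : ℝ} (hη : 0 < η) :
    ∃ δ : ℝ, 0 < δ ∧ ∀ i, ∀ s t : ℝ, 0 ≤ s → s ≤ t → t ≤ τ → t - s < δ →
      (∫ r in (0 : ℝ)..t, |c i r|) - ∫ r in (0 : ℝ)..s, |c i r| ≤ η := by
  have h1 : ∀ i, ∃ δ : ℝ, 0 < δ ∧ ∀ s t : ℝ, 0 ≤ s → s ≤ t → t ≤ τ → t - s < δ →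
      (∫ r in (0 : ℝ)..t, |c i r|) - ∫ r in (0 : ℝ)..s, |c i r| ≤ η := by
    intro i
    by_cases hτ : 0 ≤ τ
    · have := intervalIntegral.continuousOn_primitive_interval' (hc i τ hτ).abs
        (Set.left_mem_uIcc (a := (0 : ℝ)) (b := τ))
      rw [Set.uIcc_of_le hτ] at this
      have hu := isCompact_Icc.uniformContinuousOn_of_continuous this
      rw [Metric.uniformContinuousOn_iff] at hu
      obtain ⟨δ, hδ, h⟩ := hu η hη
      refine ⟨δ, hδ, fun s t hs hst ht hts => ?_⟩
      have := h t ⟨hs.trans hst, ht⟩ s ⟨hs, hst.trans ht⟩ (by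
        rw [Real.dist_eq, abs_of_nonneg (by linarith)]; exact hts)
      rw [Real.dist_eq] at this
      exact (le_abs_self _).trans this.le
    · exact ⟨1, one_pos, fun s t hs hst ht => absurd (hs.trans (hst.trans ht)) hτ⟩
  choose δ hδ h using h1
  by_cases hne : Nonempty ι
  · refine ⟨Finset.univ.inf' Finset.univ_nonempty δ, ?_, fun i s t hs hst ht hts => ?_⟩
    · rw [Finset.lt_inf'_iff]; exact fun i _ => hδ i
    · exact h i s t hs hst ht (hts.trans_le (Finset.inf'_le _ (Finset.mem_univ i)))
  · exact ⟨1, one_pos, fun i => absurd ⟨i⟩ hne⟩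

theorem intervalIntegrable_ofReal_smul {c : ℝ → ℝ} {s t : ℝ} (hc : IntervalIntegrable c volume s t)
    (M : 𝒜) : IntervalIntegrable (fun s => (c s : ℂ) • M) volume s t := by
  have h1 : IntervalIntegrable (fun s => (c s : ℂ)) volume s t := ⟨hc.1.ofReal, hc.2.ofReal⟩
  exact h1.smul_continuousOn continuousOn_const

theorem dominated_sum_smul {c : ι → ℝ → ℝ}
    (hc : ∀ i t, 0 ≤ t → IntervalIntegrable (c i) volume 0 t) (M : ι → 𝒜) :
    Dominated (fun s => ∑ i, (c i s : ℂ) • M i) fun s => ∑ i, |c i s| * ‖M i‖ := by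
  refine ⟨fun t ht => ?_, fun t ht => ?_, fun t => ?_⟩
  · have := IntervalIntegrable.sum Finset.univ fun i _ =>
      intervalIntegrable_ofReal_smul (hc i t ht) (M i)
    simpa [Finset.sum_fn] using this
  · have := IntervalIntegrable.sum Finset.univ fun i _ => (hc i t ht).abs.mul_const ‖M i‖
    simpa [Finset.sum_fn] using this
  · refine (norm_sum_le _ _).trans (Finset.sum_le_sum fun i _ => ?_)
    rw [norm_smul, Complex.norm_real, Real.norm_eq_abs]

/-- The product formula: the circuits converge to the time-ordered exponential, uniformly for
bounded times. -/
theorem exists_forall_norm_circ_sub_timeExp_lt [Nontrivial 𝒜] {c : ι → ℝ → ℝ}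
    (hc : ∀ i t, 0 ≤ t → IntervalIntegrable (c i) volume 0 t) {M : ι → 𝒜}
    (hM : ∀ i, IsSelfAdjoint (M i)) (τ : ℝ) {ε : ℝ} (hε : 0 < ε) :
    ∃ δ : ℝ, 0 < δ ∧ ∀ Δ : ℝ, 0 < Δ → Δ < δ → ∀ t : ℝ, 0 ≤ t → t ≤ τ →
      ‖circ M (timeList c Finset.univ.toList Δ ⌊t / Δ⌋₊) -
        timeExp (fun s => ∑ i, (c i s : ℂ) • M i) t‖ < ε := by
  set H : ℝ → 𝒜 := fun s => ∑ i, (c i s : ℂ) • M i with hHdef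
  set h : ℝ → ℝ := fun s => ∑ i, |c i s| * ‖M i‖ with hh
  have hD : Dominated H h := dominated_sum_smul hc M
  set ω : ℝ → ℝ := fun t => ∫ r in (0 : ℝ)..t, h r with hω
  have hωsum : ∀ t, 0 ≤ t → ω t = ∑ i, (∫ r in (0 : ℝ)..t, |c i r|) * ‖M i‖ := by
    intro t ht
    simp only [hω, hh]
    rw [intervalIntegral.integral_finsetSum fun i _ => (hc i t ht).abs.mul_const ‖M i‖]
    simp
  have hω0 : ∀ t, 0 ≤ t → 0 ≤ ω t := fun t ht =>
    intervalIntegral.integral_nonneg ht fun r _ => hD.nonneg r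
  by_cases hτ : 0 ≤ τ
  swap
  · exact ⟨1, one_pos, fun Δ _ _ t ht htτ => absurd (ht.trans htτ) hτ⟩
  set E := Real.exp (ω τ) with hE
  have hE0 : 0 < E := Real.exp_pos _
  have hωτ := hω0 τ hτ
  have hm : 0 ≤ ∑ i, ‖M i‖ := Finset.sum_nonneg fun i _ => norm_nonneg _
  set η := ε / (2 * (1 + E) * (1 + ω τ) * (1 + ∑ i, ‖M i‖)) with hη
  have hη0 : 0 < η := by positivity
  obtain ⟨δ, hδ, hδ'⟩ := exists_forall_abs_integral_le hc (τ := τ) hη0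
  refine ⟨δ, hδ, fun Δ hΔ hΔδ t ht htτ => ?_⟩
  set η' := η * ∑ i, ‖M i‖ with hη'
  have hincr : ∀ s t, 0 ≤ s → s ≤ t → t ≤ τ → t - s < δ → ω t - ω s ≤ η' := by
    intro s t hs hst ht hts
    rw [hωsum t (hs.trans hst), hωsum s hs, ← Finset.sum_sub_distrib, hη', Finset.mul_sum]
    refine Finset.sum_le_sum fun i _ => ?_
    rw [← sub_mul]
    exact mul_le_mul_of_nonneg_right (hδ' i s t hs hst ht hts) (norm_nonneg _)
  have hstep : ∀ n : ℕ, (n : ℝ) * Δ ≤ τ →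
      ‖circ M (timeList c Finset.univ.toList Δ n) - timeExp H (n * Δ)‖ ≤
        2 * E * η' * ω (n * Δ) := by
    intro n
    induction n with
    | zero =>
      intro _
      have h0 := hD.timeExp_eq le_rfl
      have : ω 0 = 0 := by simp [hω]
      simp [timeList, circ, h0, this]
    | succ n ih =>
      intro hn
      have hs0 : 0 ≤ (n : ℝ) * Δ := by positivity
      have hst : (n : ℝ) * Δ ≤ ((n + 1 : ℕ) : ℝ) * Δ := by push_cast; nlinarith
      have ih := ih (hst.trans hn)
      rw [timeList, circ_append]
      set S := stepList c Finset.univ.toList Δ n with hS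
      set U := timeExp H (n * Δ) with hU
      set u := circ M (timeList c Finset.univ.toList Δ n) with hu
      have ht0 := hs0.trans hst
      have hcast : ((n + 1 : ℕ) : ℝ) * Δ = ((n : ℝ) + 1) * Δ := by push_cast; ring
      have hg := hincr _ _ hs0 hst hn (by rw [hcast]; linarith)
      set g := ω (((n + 1 : ℕ) : ℝ) * Δ) - ω (n * Δ) with hgdef
      have hg0 : 0 ≤ g := sub_nonneg.2 (hD.primitive_mono hs0 hst)
      have hr : (S.map fun p => |p.2| * ‖M p.1‖).sum ≤ g := by
        rw [hS, stepList, List.map_map, Finset.sum_map_toList (s := Finset.univ), hgdef,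
          hωsum _ ht0, hωsum _ hs0, ← Finset.sum_sub_distrib]
        refine Finset.sum_le_sum fun i _ => ?_
        rw [← sub_mul, hcast]
        exact mul_le_mul_of_nonneg_right (abs_integral_le_sub (hc i) hs0 (by linarith))
          (norm_nonneg _)
      have hr0 : 0 ≤ (S.map fun p => |p.2| * ‖M p.1‖).sum :=
        (norm_nonneg _).trans (norm_circ_sub_le hM S).1
      have hlin : (S.map fun p => (Complex.I * p.2) • M p.1).sum =
          Complex.I • ∫ r in (n * Δ)..(((n + 1 : ℕ) : ℝ) * Δ), H r := by
        rw [hS, stepList, List.map_map, Finset.sum_map_toList (s := Finset.univ), hHdef, hcast,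
          intervalIntegral.integral_finsetSum fun i _ =>
            intervalIntegrable_ofReal_smul ((hc i _ hs0).symm.trans
            (hc i _ (by rw [← hcast]; exact ht0))) (M i), Finset.smul_sum]
        refine Finset.sum_congr rfl fun i _ => ?_
        rw [intervalIntegral.integral_smul_const, intervalIntegral.integral_ofReal, smul_smul]
        rfl
      have hS2 := (norm_circ_sub_le hM S).2
      rw [hlin] at hS2
      have heu := hD.norm_timeExp_sub_euler_le hs0 hst
      set J := Complex.I • ∫ r in (n * Δ)..(((n + 1 : ℕ) : ℝ) * Δ), H r with hJ
      have e : circ M S * u - timeExp H (((n + 1 : ℕ) : ℝ) * Δ) =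
          circ M S * (u - U) + (circ M S - 1 + J) * U -
            (timeExp H (((n + 1 : ℕ) : ℝ) * Δ) - (1 - J) * U) := by noncomm_ring
      rw [e]
      refine (norm_sub_le _ _).trans ((add_le_add_left (norm_add_le _ _) _).trans ?_)
      rw [CStarRing.norm_mem_unitary_mul _ (circ_mem_unitary hM S)]
      have hexp : Real.exp (ω (((n + 1 : ℕ) : ℝ) * Δ)) ≤ E :=
        Real.exp_le_exp.2 (hD.primitive_mono ht0 hn)
      have hUn : ‖U‖ ≤ E := (hD.norm_timeExp_le hs0).trans
        (Real.exp_le_exp.2 (hD.primitive_mono hs0 (hst.trans hn)))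
      have b1 : ‖(circ M S - 1 + J) * U‖ ≤ g ^ 2 * E := by
        refine (norm_mul_le _ _).trans (mul_le_mul ?_ hUn (norm_nonneg _) (by positivity))
        exact hS2.trans (pow_le_pow_left₀ hr0 hr 2)
      have b2 : ‖timeExp H (((n + 1 : ℕ) : ℝ) * Δ) - (1 - J) * U‖ ≤ E * g ^ 2 :=
        heu.trans (mul_le_mul_of_nonneg_right hexp (by positivity))
      have b3 : E * g ^ 2 ≤ E * (g * η') := by
        rw [pow_two]
        exact mul_le_mul_of_nonneg_left (mul_le_mul_of_nonneg_left hg hg0) hE0.le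
      have b4 : ω (((n + 1 : ℕ) : ℝ) * Δ) = ω (n * Δ) + g := by rw [hgdef]; ring
      rw [b4]
      linarith
  set n := ⌊t / Δ⌋₊ with hn
  have hn1 : (n : ℝ) * Δ ≤ t := by
    rw [← le_div_iff₀ hΔ]
    exact Nat.floor_le (by positivity)
  have hn2 : t - n * Δ < Δ := by
    have := Nat.lt_floor_add_one (t / Δ)
    rw [div_lt_iff₀ hΔ] at this
    linarith
  have hn0 : 0 ≤ (n : ℝ) * Δ := by positivity
  have h1 := hstep n (hn1.trans htτ)
  have h2 := hD.norm_timeExp_sub_le hn0 hn1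
  have h3 := hincr _ _ hn0 hn1 htτ (hn2.trans hΔδ)
  have h4 : Real.exp (ω t) ≤ E := Real.exp_le_exp.2 (hD.primitive_mono ht htτ)
  have h5 : ω (n * Δ) ≤ ω τ := hD.primitive_mono hn0 (hn1.trans htτ)
  have h6 := norm_sub_le_norm_sub_add_norm_sub (circ M (timeList c Finset.univ.toList Δ n))
    (timeExp H (n * Δ)) (timeExp H t)
  rw [norm_sub_rev (timeExp H (n * Δ))] at h6
  have hη'0 : 0 ≤ η' := by positivity
  have h7 : Real.exp (ω t) * (ω t - ω (n * Δ)) ≤ E * η' :=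
    mul_le_mul h4 h3 (sub_nonneg.2 (hD.primitive_mono hn0 hn1)) hE0.le
  have h8 : 2 * E * η' * ω (n * Δ) ≤ 2 * E * η' * ω τ :=
    mul_le_mul_of_nonneg_left h5 (by positivity)
  have h9 : η' * (2 * (1 + E) * (1 + ω τ)) < ε := by
    rw [hη', hη, div_mul_eq_mul_div, div_mul_eq_mul_div, div_lt_iff₀ (by positivity)]
    have : 0 < ε * (2 * (1 + E) * (1 + ω τ)) := by positivity
    linarith
  have h10 : 0 ≤ η' * (2 + 2 * ω τ + E) := by positivity
  have h11 : ‖timeExp H t - timeExp H (n * Δ)‖ ≤ E * η' := h2.trans h7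
  linarith

end TimeOrdered

end QCA

namespace QCA

/-! ### Operators on finite regions -/

open scoped Matrix.Norms.L2Operator Kronecker

variable {d : ℕ} {A B B' : Finset (Site d)}

/-- Operators on a qubit. -/
abbrev QubitOp : Type := Matrix (Fin 2) (Fin 2) ℂ

/-- The operator which acts on the qubit at `x` by `F s x`, controlled by the configuration `s`. -/
def ctrlOp (F : Config A → A → QubitOp) : Op A :=
  Matrix.of fun s r => ∏ x, F s x (s x) (r x)

/-- The tensor product of one-qubit operators. -/
def prodOp (F : A → QubitOp) : Op A := ctrlOp fun _ => F

theorem ctrlOp_apply (F : Config A → A → QubitOp) (s s' : Config A) :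
    ctrlOp F s s' = ∏ x, F s x (s x) (s' x) := rfl

theorem prodOp_apply (F : A → QubitOp) (s s' : Config A) :
    prodOp F s s' = ∏ x, F x (s x) (s' x) := rfl

theorem ctrlOp_mul {F G : Config A → A → QubitOp}
    (h : ∀ s s', ctrlOp F s s' ≠ 0 → G s' = G s) :
    ctrlOp F * ctrlOp G = ctrlOp fun s x => F s x * G s x := by
  ext s s''
  rw [Matrix.mul_apply]
  have h1 : ∀ s', ctrlOp F s s' * ctrlOp G s' s'' =
      ∏ x, (F s x (s x) (s' x) * G s x (s' x) (s'' x)) := by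
    intro s'
    rw [Finset.prod_mul_distrib]
    by_cases h0 : ctrlOp F s s' = 0
    · rw [h0, zero_mul, ← ctrlOp_apply, h0, zero_mul]
    · rw [ctrlOp_apply, ctrlOp_apply, h s s' h0]
  rw [Finset.sum_congr rfl fun s' _ => h1 s', ctrlOp_apply]
  simp only [Matrix.mul_apply]
  rw [Finset.prod_univ_sum, Fintype.piFinset_univ]

theorem prodOp_mul (F G : A → QubitOp) : prodOp F * prodOp G = prodOp (F * G) :=
  ctrlOp_mul fun _ _ _ => rfl

theorem prodOp_one : prodOp (1 : A → QubitOp) = 1 := by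
  ext s s'
  rw [prodOp_apply, Matrix.one_apply]
  split_ifs with h
  · subst h
    exact Finset.prod_eq_one fun x _ => Matrix.one_apply_eq _
  · obtain ⟨x, hx⟩ := Function.ne_iff.1 h
    exact Finset.prod_eq_zero (Finset.mem_univ x) (by simp [hx])

theorem prodOp_conjTranspose (F : A → QubitOp) :
    (prodOp F).conjTranspose = prodOp fun x => (F x).conjTranspose := by
  ext s s'
  rw [Matrix.conjTranspose_apply, prodOp_apply, prodOp_apply, star_prod]
  rfl

/-- `F` acts on the sites in `R` only, and is controlled by the other sites only. -/
structure Controlled (R : A → Prop) (F : Config A → A → QubitOp) : Prop where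
  eq_one : ∀ s x, ¬ R x → F s x = 1
  congr : ∀ s s', (∀ x, ¬ R x → s x = s' x) → F s = F s'

theorem Controlled.agree {R : A → Prop} {F : Config A → A → QubitOp} (h : ∀ s x, ¬ R x → F s x = 1)
    {s s' : Config A} (h0 : ctrlOp F s s' ≠ 0) : ∀ x, ¬ R x → s x = s' x := by
  intro x hx
  by_contra hne
  refine h0 (Finset.prod_eq_zero (Finset.mem_univ x) ?_)
  rw [h s x hx, Matrix.one_apply_ne hne]

theorem Controlled.mul {R : A → Prop} {F G : Config A → A → QubitOp} (hF : Controlled R F)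
    (hG : Controlled R G) : ctrlOp F * ctrlOp G = ctrlOp fun s x => F s x * G s x :=
  ctrlOp_mul fun s s' h0 => hG.congr s' s fun x hx => (Controlled.agree hF.eq_one h0 x hx).symm

theorem Controlled.conjTranspose {R : A → Prop} {F : Config A → A → QubitOp}
    (hF : Controlled R F) :
    (ctrlOp F).conjTranspose = ctrlOp fun s x => (F s x).conjTranspose := by
  ext s s'
  by_cases h : ∀ x, ¬ R x → s x = s' x
  · rw [Matrix.conjTranspose_apply, ctrlOp_apply, ctrlOp_apply, star_prod, hF.congr s s' h]
    rfl
  · push Not at h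
    obtain ⟨x, hx, hne⟩ := h
    rw [Matrix.conjTranspose_apply, ctrlOp_apply, ctrlOp_apply,
      Finset.prod_eq_zero (Finset.mem_univ x), Finset.prod_eq_zero (Finset.mem_univ x), star_zero]
    · rw [hF.eq_one s x hx, Matrix.conjTranspose_one, Matrix.one_apply_ne hne]
    · rw [hF.eq_one s' x hx, Matrix.one_apply_ne hne.symm]

theorem ctrlOp_one : ctrlOp (fun (_ : Config A) (_ : A) => (1 : QubitOp)) = 1 := prodOp_one

theorem Controlled.mem_unitary {R : A → Prop} {F : Config A → A → QubitOp}
    (hF : Controlled R F) (hu : ∀ s x, F s x ∈ Matrix.unitaryGroup (Fin 2) ℂ) :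
    ctrlOp F ∈ unitary (Op A) := by
  have hG : Controlled R fun s x => (F s x).conjTranspose :=
    ⟨fun s x hx => by rw [hF.eq_one s x hx, Matrix.conjTranspose_one],
      fun s s' h => by rw [hF.congr s s' h]⟩
  rw [Unitary.mem_iff, Matrix.star_eq_conjTranspose, hF.conjTranspose, hG.mul hF, hF.mul hG]
  constructor
  · rw [← ctrlOp_one]
    congr 1; funext s x
    exact Matrix.UnitaryGroup.star_mul_self ⟨F s x, hu s x⟩
  · rw [← ctrlOp_one]
    congr 1; funext s x
    exact Matrix.mem_unitaryGroup_iff.1 (hu s x)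

theorem prodOp_mem_unitary {F : A → QubitOp} (hu : ∀ x, F x ∈ Matrix.unitaryGroup (Fin 2) ℂ) :
    prodOp F ∈ unitary (Op A) :=
  Controlled.mem_unitary (R := fun _ => True) ⟨fun _ _ h => absurd trivial h, fun _ _ _ => rfl⟩
    fun _ => hu

/-! ### Extension of operators to larger regions -/

/-- The restriction of a configuration to a smaller region. -/
def res (h : A ⊆ B) (s : Config B) : Config A := fun x => s ⟨x.1, h x.2⟩

/-- A configuration of `B` is a configuration of `A` and one of the rest. -/
def splitEquiv (h : A ⊆ B) : Config B ≃ Config A × Config (B \ A) where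
  toFun s := (res h s, res Finset.sdiff_subset s)
  invFun p := glue A B p.1 p.2
  left_inv s := by
    funext x
    by_cases hx : x.1 ∈ A <;> simp [glue, res, hx]
  right_inv p := by
    refine Prod.ext ?_ ?_
    · funext x
      simp [glue, res]
    · funext x
      have := (Finset.mem_sdiff.1 x.2).2
      simp [glue, res, this]

/-- The extension of an operator to a larger region, on which it acts as the identity on the
additional sites. -/
def extend (h : A ⊆ B) : Op A →⋆ₐ[ℂ] Op B where
  toFun X := (X ⊗ₖ (1 : Op (B \ A))).submatrix (splitEquiv h) (splitEquiv h)
  map_one' := by simp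
  map_mul' X Y := by
    rw [Matrix.submatrix_mul_equiv, ← Matrix.mul_kronecker_mul, one_mul]
  map_zero' := by simp
  map_add' X Y := by rw [Matrix.add_kronecker, Matrix.submatrix_add]; rfl
  commutes' r := by
    rw [Algebra.algebraMap_eq_smul_one, Algebra.algebraMap_eq_smul_one, Matrix.smul_kronecker,
      Matrix.one_kronecker_one, Matrix.submatrix_smul]
    simp
  map_star' X := by
    rw [Matrix.star_eq_conjTranspose, Matrix.star_eq_conjTranspose, Matrix.conjTranspose_submatrix,
      Matrix.conjTranspose_kronecker, Matrix.conjTranspose_one]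

theorem extend_eq (h : A ⊆ B) (X : Op A) :
    extend h X = (X ⊗ₖ (1 : Op (B \ A))).submatrix (splitEquiv h) (splitEquiv h) := rfl

theorem extend_conjTranspose (h : A ⊆ B) (X : Op A) :
    extend h X.conjTranspose = (extend h X).conjTranspose :=
  map_star (extend h) X

theorem norm_extend_le (h : A ⊆ B) (X : Op A) : ‖extend h X‖ ≤ ‖X‖ :=
  NonUnitalStarAlgHom.norm_apply_le (extend h) X

theorem extend_apply (h : A ⊆ B) (X : Op A) (s s' : Config B) :
    extend h X s s' = open Classical in
      if ∀ x : B, x.1 ∉ A → s x = s' x then X (res h s) (res h s') else 0 := by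
  rw [extend_eq, Matrix.submatrix_apply, Matrix.kroneckerMap_apply, Matrix.one_apply]
  have : (splitEquiv h s).2 = (splitEquiv h s').2 ↔ ∀ x : B, x.1 ∉ A → s x = s' x := by
    constructor
    · intro he x hx
      exact congrFun he ⟨x.1, Finset.mem_sdiff.2 ⟨x.2, hx⟩⟩
    · intro he
      funext x
      exact he ⟨x.1, _⟩ (Finset.mem_sdiff.1 x.2).2
  simp only [this, mul_ite, mul_one, mul_zero]
  rfl

theorem extend_extend (h : A ⊆ B) (h' : B ⊆ B') (X : Op A) :
    extend h' (extend h X) = extend (h.trans h') X := by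
  ext s s'
  rw [extend_apply, extend_apply, extend_apply]
  have : (∀ x : B', x.1 ∉ A → s x = s' x) ↔
      (∀ x : B', x.1 ∉ B → s x = s' x) ∧ ∀ x : B, x.1 ∉ A → res h' s x = res h' s' x := by
    constructor
    · exact fun H => ⟨fun x hx => H x fun hA => hx (h hA), fun x hx => H ⟨x.1, h' x.2⟩ hx⟩
    · rintro ⟨H1, H2⟩ x hx
      by_cases hB : x.1 ∈ B
      · exact H2 ⟨x.1, hB⟩ hx
      · exact H1 x hB
  by_cases H : ∀ x : B', x.1 ∉ A → s x = s' x
  · rw [if_pos H, if_pos (this.1 H).1, if_pos (this.1 H).2]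
    rfl
  · rw [if_neg H]
    split_ifs with h1 h2
    · exact absurd (this.2 ⟨h1, h2⟩) H
    · rfl
    · rfl

@[to_additive]
theorem prod_split {R : Type*} [CommMonoid R] (h : A ⊆ B) (f : B → R) :
    ∏ x, f x = (∏ x : A, f ⟨x.1, h x.2⟩) *
      ∏ x : (B \ A : Finset (Site d)), f ⟨x.1, Finset.sdiff_subset x.2⟩ := by
  classical
  set g : Site d → R := fun x => if hx : x ∈ B then f ⟨x, hx⟩ else 1 with hg
  have hgf : ∀ x : B, f x = g x.1 := fun x => by
    show f x = dite _ _ _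
    rw [dif_pos x.2]
  simp only [hgf]
  rw [Finset.prod_coe_sort B g, Finset.prod_coe_sort A g, Finset.prod_coe_sort (B \ A) g,
    mul_comm, Finset.prod_sdiff h]

theorem prodOp_split (h : A ⊆ B) (G : B → QubitOp) :
    prodOp G = (prodOp (fun x : A => G ⟨x.1, h x.2⟩) ⊗ₖ
      prodOp (fun x : (B \ A : Finset (Site d)) => G ⟨x.1, Finset.sdiff_subset x.2⟩)).submatrix
        (splitEquiv h) (splitEquiv h) := by
  ext s s'
  rw [Matrix.submatrix_apply, Matrix.kroneckerMap_apply, prodOp_apply, prod_split h]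
  rfl

theorem extend_commute_prodOp (h : A ⊆ B) (X : Op A) {G : B → QubitOp}
    (hG : ∀ x : B, x.1 ∈ A → G x = 1) : Commute (extend h X) (prodOp G) := by
  have h1 : (fun x : A => G ⟨x.1, h x.2⟩) = 1 := funext fun x => hG _ x.2
  rw [prodOp_split h, h1, prodOp_one, extend_eq, commute_iff_eq, Matrix.submatrix_mul_equiv,
    Matrix.submatrix_mul_equiv, ← Matrix.mul_kronecker_mul, ← Matrix.mul_kronecker_mul]
  simp

theorem extend_ctrlOp (h : A ⊆ B) (F : Config A → A → QubitOp) :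
    extend h (ctrlOp F) =
      ctrlOp fun s (x : B) => if hx : x.1 ∈ A then F (res h s) ⟨x.1, hx⟩ else 1 := by
  ext s s'
  rw [ctrlOp_apply, prod_split h, extend_eq, Matrix.submatrix_apply, Matrix.kroneckerMap_apply]
  congr 1
  · rw [ctrlOp_apply]
    refine Finset.prod_congr rfl fun x _ => ?_
    rw [dif_pos x.2]
    rfl
  · rw [← prodOp_one, prodOp_apply]
    refine Finset.prod_congr rfl fun x _ => ?_
    rw [dif_neg (Finset.mem_sdiff.1 x.2).2]
    rfl

theorem extend_prodOp (h : A ⊆ B) (F : A → QubitOp) :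
    extend h (prodOp F) = prodOp fun x : B => if hx : x.1 ∈ A then F ⟨x.1, hx⟩ else 1 :=
  extend_ctrlOp h _

/-! ### One-qubit operators inside a region -/

open Classical in
/-- The one-qubit operator `m` acting on the qubit at `x`. -/
def siteOp (x : A) : QubitOp →⋆ₐ[ℂ] Op A where
  toFun m := prodOp (Function.update (1 : A → QubitOp) x m)
  map_one' := by rw [Function.update_eq_self_iff.2 (by rfl), prodOp_one]
  map_mul' m m' := by
    rw [prodOp_mul, ← Function.update_mul, one_mul]
  map_zero' := by
    ext s s'
    rw [prodOp_apply]
    exact Finset.prod_eq_zero (Finset.mem_univ x) (by simp)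
  map_add' m m' := by
    ext s s'
    simp only [Matrix.add_apply, prodOp_apply]
    simp only [← Finset.mul_prod_erase Finset.univ _ (Finset.mem_univ x)]
    have : ∀ m : QubitOp, ∏ y ∈ Finset.univ.erase x,
        Function.update (1 : A → QubitOp) x m y (s y) (s' y) =
        ∏ y ∈ Finset.univ.erase x, (1 : QubitOp) (s y) (s' y) := by
      intro m
      refine Finset.prod_congr rfl fun y hy => ?_
      rw [Function.update_of_ne (Finset.ne_of_mem_erase hy)]
      rfl
    simp only [this, Function.update_self, Matrix.add_apply, add_mul]
  commutes' r := by
    ext s s'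
    rw [prodOp_apply, ← Finset.mul_prod_erase _ _ (Finset.mem_univ x)]
    have : ∏ y ∈ Finset.univ.erase x,
        Function.update (1 : A → QubitOp) x (algebraMap ℂ QubitOp r) y (s y) (s' y) =
        ∏ y ∈ Finset.univ.erase x, (1 : QubitOp) (s y) (s' y) := by
      refine Finset.prod_congr rfl fun y hy => ?_
      rw [Function.update_of_ne (Finset.ne_of_mem_erase hy)]
      rfl
    have h1 : (1 : Op A) s s' =
        (1 : QubitOp) (s x) (s' x) * ∏ y ∈ Finset.univ.erase x, (1 : QubitOp) (s y) (s' y) := by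
      rw [Finset.mul_prod_erase _ (fun y => (1 : QubitOp) (s y) (s' y)) (Finset.mem_univ x),
        ← prodOp_one]
      rfl
    rw [this, Function.update_self, Algebra.algebraMap_eq_smul_one, Algebra.algebraMap_eq_smul_one,
      Matrix.smul_apply, Matrix.smul_apply, h1, smul_mul_assoc]
  map_star' m := by
    rw [Matrix.star_eq_conjTranspose, Matrix.star_eq_conjTranspose, prodOp_conjTranspose]
    congr 1
    funext y
    by_cases hy : y = x
    · subst hy; simp
    · simp [Function.update_of_ne hy]

open Classical in
theorem siteOp_eq (x : A) (m : QubitOp) :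
    siteOp x m = prodOp (Function.update (1 : A → QubitOp) x m) := rfl

theorem norm_siteOp_le (x : A) (m : QubitOp) : ‖siteOp x m‖ ≤ ‖m‖ :=
  NonUnitalStarAlgHom.norm_apply_le (siteOp x) m

theorem extend_siteOp (h : A ⊆ B) (x : A) (m : QubitOp) :
    extend h (siteOp x m) = siteOp ⟨x.1, h x.2⟩ m := by
  classical
  rw [siteOp_eq, extend_prodOp, siteOp_eq]
  congr 1
  funext y
  by_cases hy : y.1 ∈ A
  · rw [dif_pos hy]
    by_cases hyx : y.1 = x.1
    · have h1 : (⟨y.1, hy⟩ : A) = x := Subtype.ext hyx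
      have h2 : y = ⟨x.1, h x.2⟩ := Subtype.ext hyx
      rw [h1, h2, Function.update_self, Function.update_self]
    · rw [Function.update_of_ne (fun h1 => hyx (congrArg Subtype.val h1)),
        Function.update_of_ne (fun h1 => hyx (congrArg Subtype.val h1))]
      rfl
  · rw [dif_neg hy, Function.update_of_ne]
    · rfl
    · rintro rfl; exact hy x.2

theorem siteOp_commute {x y : A} (hxy : x ≠ y) (m m' : QubitOp) :
    Commute (siteOp x m) (siteOp y m') := by
  classical
  rw [siteOp_eq, siteOp_eq, commute_iff_eq, prodOp_mul, prodOp_mul]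
  congr 1
  funext z
  by_cases hx : z = x
  · subst hx; simp [Function.update_of_ne hxy]
  · simp [Function.update_of_ne hx]

theorem extend_commute_siteOp (h : A ⊆ B) (X : Op A) {z : B} (hz : z.1 ∉ A) (m : QubitOp) :
    Commute (extend h X) (siteOp z m) := by
  classical
  refine extend_commute_prodOp h X fun x hx => ?_
  rw [Function.update_of_ne]
  · rfl
  · rintro rfl; exact hz hx

theorem pairOp_kronecker {x y : A} (hxy : x ≠ y) (K L : QubitOp) :
    pairOp x y (K ⊗ₖ L) = siteOp x K * siteOp y L := by
  classical
  rw [siteOp_eq, siteOp_eq, prodOp_mul]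
  ext s s'
  rw [prodOp_apply, pairOp, Matrix.of_apply]
  set G := Function.update (1 : A → QubitOp) x K * Function.update (1 : A → QubitOp) y L with hG
  have hx : G x = K := by
    simp [hG, Function.update_of_ne hxy]
  have hy : G y = L := by
    simp [hG, Function.update_of_ne hxy.symm]
  have hz : ∀ z, z ≠ x → z ≠ y →
      G z = 1 := by
    intro z h1 h2
    simp [hG, Function.update_of_ne h1, Function.update_of_ne h2]
  rw [← Finset.mul_prod_erase _ _ (Finset.mem_univ x),
    ← Finset.mul_prod_erase _ _ (Finset.mem_erase.2 ⟨hxy.symm, Finset.mem_univ y⟩), hx, hy]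
  split_ifs with h
  · rw [Finset.prod_eq_one, mul_one]
    · rfl
    · intro z hz'
      have h2 := Finset.ne_of_mem_erase hz'
      have h1 := Finset.ne_of_mem_erase (Finset.mem_of_mem_erase hz')
      rw [hz z h1 h2, h z h1 h2, Matrix.one_apply_eq]
  · push Not at h
    obtain ⟨z, h1, h2, h3⟩ := h
    rw [Finset.prod_eq_zero (i := z), mul_zero, mul_zero]
    · simp [h1, h2]
    · rw [hz z h1 h2, Matrix.one_apply_ne h3]

/-! ### Partial traces and states -/

theorem trace_mul_ptrace (h : A ⊆ B) (X : Op A) (M : Op B) :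
    (X * ptrace A B M).trace = (extend h X * M).trace := by
  have h1 : (extend h X * M).trace =
      ((X ⊗ₖ (1 : Op (B \ A))) * M.submatrix (splitEquiv h).symm (splitEquiv h).symm).trace := by
    rw [extend_eq]
    have : M = (M.submatrix (splitEquiv h).symm (splitEquiv h).symm).submatrix (splitEquiv h)
        (splitEquiv h) := by simp
    conv_lhs => rw [this]
    rw [Matrix.submatrix_mul_equiv]
    exact Fintype.sum_equiv (splitEquiv h) _ _ fun _ => rfl
  rw [h1]
  simp only [Matrix.trace, Matrix.diag, Matrix.mul_apply, Fintype.sum_prod_type,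
    Matrix.kroneckerMap_apply, Matrix.one_apply, mul_ite, mul_one, mul_zero, ite_mul, zero_mul,
    Finset.sum_ite_eq, Finset.mem_univ, if_true, Matrix.submatrix_apply]
  refine Finset.sum_congr rfl fun s _ => ?_
  rw [Finset.sum_comm]
  refine Finset.sum_congr rfl fun s' _ => ?_
  rw [← Finset.mul_sum]
  rfl

theorem apply_eq_trace (M : Op A) (i j : Config A) :
    M i j = (Matrix.single j i (1 : ℂ) * M).trace := by
  simp [Matrix.trace_single_mul]

theorem single_eq_prodOp (i j : Config A) :
    (Matrix.single i j (1 : ℂ) : Op A) = prodOp fun x => Matrix.single (i x) (j x) 1 := by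
  ext s s'
  rw [prodOp_apply, Matrix.single_apply]
  simp only [Matrix.single_apply]
  split_ifs with h
  · simp [h.1, h.2]
  · rw [not_and_or] at h
    rcases h with h | h
    · obtain ⟨x, hx⟩ := Function.ne_iff.1 h
      exact (Finset.prod_eq_zero (Finset.mem_univ x) (by simp [hx])).symm
    · obtain ⟨x, hx⟩ := Function.ne_iff.1 h
      exact (Finset.prod_eq_zero (Finset.mem_univ x) (by simp [hx])).symm

theorem ptrace_apply_eq_trace (h : A ⊆ B) (M : Op B) (i j : Config A) :
    ptrace A B M i j = (extend h (Matrix.single j i 1) * M).trace := by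
  rw [apply_eq_trace (ptrace A B M) i j, trace_mul_ptrace h]

theorem ptrace_ptrace (h : A ⊆ B) (h' : B ⊆ B') (M : Op B') :
    ptrace A B (ptrace B B' M) = ptrace A B' M := by
  ext i j
  rw [ptrace_apply_eq_trace h, trace_mul_ptrace h', extend_extend, ptrace_apply_eq_trace]

theorem trace_mul_conj (X U P : Op A) :
    (X * (U * P * U.conjTranspose)).trace = (heis U X * P).trace := by
  rw [heis, Matrix.star_eq_conjTranspose, ← mul_assoc, Matrix.trace_mul_comm, ← mul_assoc,
    ← mul_assoc]

theorem trace_ptrace (h : A ⊆ B) (M : Op B) : (ptrace A B M).trace = M.trace := by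
  rw [← one_mul (ptrace A B M), trace_mul_ptrace h, map_one, one_mul]

theorem ptrace_posSemidef (M : Op B) (hM : M.PosSemidef) : (ptrace A B M).PosSemidef := by
  have : ptrace A B M = ∑ e : Config (B \ A),
      M.submatrix (fun s => glue A B s e) (fun s => glue A B s e) := by
    ext s s'
    simp [ptrace, Matrix.sum_apply]
  rw [this]
  exact Matrix.posSemidef_sum _ fun e _ => hM.submatrix _

theorem norm_trace_mul_le {n : Type*} [Fintype n] [DecidableEq n] (Y ρ : Matrix n n ℂ)
    (hρ : ρ.PosSemidef) (htr : ρ.trace = 1) : ‖(Y * ρ).trace‖ ≤ ‖Y‖ := by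
  obtain ⟨m, v, rfl⟩ := Matrix.posSemidef_iff_eq_sum_vecMulVec.1 hρ
  have h1 : ∀ Z : Matrix n n ℂ, (Z * ∑ i, Matrix.vecMulVec (v i) (star (v i))).trace =
      ∑ i, inner ℂ (WithLp.toLp 2 (v i)) (Matrix.toEuclideanCLM (n := n) (𝕜 := ℂ) Z
        (WithLp.toLp 2 (v i))) := by
    intro Z
    rw [Finset.mul_sum, Matrix.trace_sum]
    refine Finset.sum_congr rfl fun i _ => ?_
    rw [Matrix.mul_vecMulVec, Matrix.trace_vecMulVec, Matrix.toEuclideanCLM_toLp,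
      EuclideanSpace.inner_eq_star_dotProduct]
  have h2 : ∑ i, ‖WithLp.toLp 2 (v i)‖ ^ 2 = 1 := by
    have h3 := h1 1
    rw [one_mul, htr, map_one] at h3
    simp only [one_apply_eq_self, inner_self_eq_norm_sq_to_K] at h3
    have h4 : ((∑ i, ‖WithLp.toLp 2 (v i)‖ ^ 2 : ℝ) : ℂ) = 1 := by
      rw [h3]
      push_cast
      rfl
    exact_mod_cast h4
  rw [h1]
  calc _ ≤ ∑ i, ‖Y‖ * ‖WithLp.toLp 2 (v i)‖ ^ 2 := by
        refine (norm_sum_le _ _).trans (Finset.sum_le_sum fun i _ => ?_)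
        refine (norm_inner_le_norm _ _).trans ?_
        have := (Matrix.toEuclideanCLM (n := n) (𝕜 := ℂ) Y).le_opNorm (WithLp.toLp 2 (v i))
        rw [← Matrix.cstar_norm_def] at this
        nlinarith [norm_nonneg (WithLp.toLp 2 (v i))]
    _ = ‖Y‖ := by rw [← Finset.mul_sum, h2, mul_one]

end QCA

namespace QCA

/-! ### Coloured QCA on finite regions and on the lattice -/

open scoped Matrix.Norms.L2Operator Kronecker

variable {d : ℕ} {A B B' : Finset (Site d)}

theorem conj_prodOp_extend (h : A ⊆ B) {G : B → QubitOp}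
    (hG : ∀ x, G x ∈ Matrix.unitaryGroup (Fin 2) ℂ) (Z : Op A) :
    prodOp G * extend h Z * (prodOp G).conjTranspose =
      extend h (prodOp (fun x : A => G ⟨x.1, h x.2⟩) * Z *
        (prodOp fun x : A => G ⟨x.1, h x.2⟩).conjTranspose) := by
  classical
  set G₁ : B → QubitOp := fun x => if x.1 ∈ A then 1 else G x with hG₁
  have hu : prodOp G₁ ∈ unitary (Op B) := prodOp_mem_unitary fun x => by
    simp only [hG₁]
    split_ifs
    · exact one_mem _
    · exact hG x
  have hc : Commute (extend h Z) (prodOp G₁) :=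
    extend_commute_prodOp h Z fun x hx => by simp [hG₁, hx]
  have hsplit : prodOp G = extend h (prodOp fun x : A => G ⟨x.1, h x.2⟩) * prodOp G₁ := by
    rw [extend_prodOp, prodOp_mul]
    congr 1
    funext x
    by_cases hx : x.1 ∈ A <;> simp [hG₁, hx]
  rw [hsplit, Matrix.conjTranspose_mul, map_mul, map_mul, extend_conjTranspose]
  have h1 : prodOp G₁ * (prodOp G₁).conjTranspose = 1 := (Unitary.mem_iff.1 hu).2
  set E := extend h (prodOp fun x : A => G ⟨x.1, h x.2⟩)
  calc E * prodOp G₁ * extend h Z * ((prodOp G₁).conjTranspose * E.conjTranspose)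
      = E * (prodOp G₁ * extend h Z) * (prodOp G₁).conjTranspose * E.conjTranspose := by
        simp only [mul_assoc]
    _ = E * extend h Z * (prodOp G₁ * (prodOp G₁).conjTranspose) * E.conjTranspose := by
        rw [← hc.eq]; simp only [mul_assoc]
    _ = E * extend h Z * E.conjTranspose := by rw [h1, mul_one]

theorem heis_of_commute {𝒜 : Type*} [CStarAlgebra 𝒜] {g X : 𝒜} (hg : g ∈ unitary 𝒜)
    (h : Commute g X) : heis g X = X := by
  rw [heis, mul_assoc, ← h.eq, ← mul_assoc, Unitary.star_mul_self_of_mem hg, one_mul]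

namespace CQCA

variable {k : ℕ} (Q : CQCA d k)

theorem basis_mem : Q.basis ∈ Matrix.unitaryGroup (Fin 2) ℂ := Q.obs_herm.eigenvectorUnitary.2

open Classical in
/-- The one-qubit operators of a layer in the product eigenbasis. -/
def layerFun (A : Finset (Site d)) (g : FieldControlled k) (s : Config A) (x : A) : QubitOp :=
  if Q.colouring.toFun x.1 = g.colour ∧ Q.field s x ∈ g.cond then
    Q.basis.conjTranspose * g.u.1 * Q.basis
  else 1

theorem layerMatrix_eq (A : Finset (Site d)) (g : FieldControlled k) :
    Q.layerMatrix A g = ctrlOp (Q.layerFun A g) := rfl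

theorem regionBasis_eq (A : Finset (Site d)) : Q.regionBasis A = prodOp fun _ => Q.basis := rfl

theorem layerFun_mem (g : FieldControlled k) (s : Config A) (x : A) :
    Q.layerFun A g s x ∈ Matrix.unitaryGroup (Fin 2) ℂ := by
  unfold layerFun
  split_ifs
  · exact mul_mem (mul_mem (Unitary.star_mem Q.basis_mem) g.u.2) Q.basis_mem
  · exact one_mem _

theorem field_congr {s s' : Config A} {x : A}
    (h : ∀ r : A, r ≠ x → r.1 - x.1 ∈ Q.nbhd → s r = s' r) : Q.field s x = Q.field s' x := by
  funext l
  unfold field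
  refine Finset.sum_congr rfl fun r _ => ?_
  split_ifs with hr
  · rw [h r hr.1 hr.2.1]
  · rfl

theorem layerFun_controlled (g : FieldControlled k) :
    Controlled (fun x : A => Q.colouring.toFun x.1 = g.colour) (Q.layerFun A g) := by
  refine ⟨fun s x hx => if_neg fun h => hx h.1, fun s s' h => ?_⟩
  funext x
  unfold layerFun
  by_cases hx : Q.colouring.toFun x.1 = g.colour
  · rw [Q.field_congr (s := s) (s' := s')]
    intro r hr hrx
    refine h r fun hc => Q.correct x.1 r.1 ⟨fun he => hr (Subtype.ext he.symm), Or.inl hrx⟩ ?_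
    rw [hx, hc]
  · rw [if_neg fun h => hx h.1, if_neg fun h => hx h.1]

theorem field_res (h : A ⊆ B) (s : Config B) (x : A)
    (hx : ∀ r : B, r.1 - x.1 ∈ Q.nbhd → r.1 ∈ A) :
    Q.field (res h s) x = Q.field s ⟨x.1, h x.2⟩ := by
  classical
  funext l
  unfold field
  rw [sum_split h]
  rw [Finset.sum_eq_zero (s := (Finset.univ : Finset (B \ A : Finset (Site d))))]
  · rw [add_zero]
    refine Finset.sum_congr rfl fun r _ => ?_
    simp only [ne_eq, Subtype.ext_iff, res]
  · intro r _
    rw [if_neg]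
    rintro ⟨-, h1, -⟩
    exact (Finset.mem_sdiff.1 r.2).2 (hx ⟨r.1, _⟩ h1)

theorem subset_sub_add : A ⊆ A - Q.nbhd + Q.nbhd := by
  intro x hx
  have := Finset.add_mem_add (Finset.sub_mem_sub hx Q.zero_mem) Q.zero_mem
  simpa using this

theorem heis_ctrlOp_layerFun (g : FieldControlled k) (hB : A - Q.nbhd + Q.nbhd ⊆ B)
    (G : A → QubitOp) :
    heis (ctrlOp (Q.layerFun B g)) (extend (Q.subset_sub_add.trans hB) (prodOp G)) =
      extend hB (heis (ctrlOp (Q.layerFun (A - Q.nbhd + Q.nbhd) g))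
        (extend Q.subset_sub_add (prodOp G))) := by
  classical
  have hnear : A ⊆ A - Q.nbhd := fun x hx => by
    simpa using Finset.sub_mem_sub hx Q.zero_mem
  -- only the gates at the points of `A - nbhd` have an effect
  have key : ∀ {B : Finset (Site d)} (hB : A - Q.nbhd + Q.nbhd ⊆ B),
      heis (ctrlOp (Q.layerFun B g)) (extend (Q.subset_sub_add.trans hB) (prodOp G)) =
      heis (ctrlOp fun s x => if x.1 ∈ A - Q.nbhd then Q.layerFun B g s x else 1)
        (extend (Q.subset_sub_add.trans hB) (prodOp G)) := by
    intro B hB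
    have hF := Q.layerFun_controlled (A := B) g
    have hfar : Controlled (fun x : B => Q.colouring.toFun x.1 = g.colour)
        (fun s x => if x.1 ∈ A - Q.nbhd then 1 else Q.layerFun B g s x) :=
      ⟨fun s x hx => by simp [hF.eq_one s x hx], fun s s' h => by rw [hF.congr s s' h]⟩
    have hnr : Controlled (fun x : B => Q.colouring.toFun x.1 = g.colour)
        (fun s x => if x.1 ∈ A - Q.nbhd then Q.layerFun B g s x else 1) :=
      ⟨fun s x hx => by simp [hF.eq_one s x hx], fun s s' h => by rw [hF.congr s s' h]⟩
    have hmul : ctrlOp (Q.layerFun B g) =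
        ctrlOp (fun s x => if x.1 ∈ A - Q.nbhd then 1 else Q.layerFun B g s x) *
        ctrlOp (fun s x => if x.1 ∈ A - Q.nbhd then Q.layerFun B g s x else 1) := by
      rw [hfar.mul hnr]
      congr 1
      funext s x
      split_ifs <;> simp
    rw [hmul, heis_mul]
    congr 1
    apply heis_of_commute
    · refine hfar.mem_unitary fun s x => ?_
      split_ifs
      · exact one_mem _
      · exact Q.layerFun_mem g s x
    · rw [extend_prodOp, commute_iff_eq]
      set G' : B → QubitOp := fun x => if hx : x.1 ∈ A then G ⟨x.1, hx⟩ else 1 with hG'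
      unfold prodOp
      rw [ctrlOp_mul (fun _ _ _ => rfl), ctrlOp_mul]
      · congr 1
        funext s x
        by_cases hx : x.1 ∈ A
        · simp [hnear hx]
        · simp [hG', hx]
      · intro s s' h0
        have hag := Controlled.agree (R := fun x : B => x.1 ∈ A) (F := fun _ => G')
          (fun _ x hx => dif_neg hx) h0
        funext x
        by_cases hx : x.1 ∈ A - Q.nbhd
        · simp [hx]
        · rw [if_neg hx, if_neg hx]
          unfold layerFun
          rw [Q.field_congr]
          intro r _ hr
          refine (hag r fun hrA => hx ?_).symm
          have := Finset.sub_mem_sub hrA hr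
          simpa using this
  rw [key hB, key (Finset.Subset.refl _)]
  unfold heis
  rw [map_mul, map_mul, map_star, extend_extend, extend_ctrlOp]
  have hF : (fun (s : Config B) (x : B) =>
      if x.1 ∈ A - Q.nbhd then Q.layerFun B g s x else 1) =
      fun s x => if hx : x.1 ∈ A - Q.nbhd + Q.nbhd then
        (if x.1 ∈ A - Q.nbhd then Q.layerFun (A - Q.nbhd + Q.nbhd) g (res hB s) ⟨x.1, hx⟩ else 1)
      else 1 := by
    funext s x
    by_cases hx : x.1 ∈ A - Q.nbhd
    · have hx' : x.1 ∈ A - Q.nbhd + Q.nbhd := by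
        simpa using Finset.add_mem_add hx Q.zero_mem
      rw [if_pos hx, dif_pos hx', if_pos hx]
      unfold layerFun
      rw [Q.field_res hB s ⟨x.1, hx'⟩]
      intro r hr
      simpa using Finset.add_mem_add hx hr
    · simp [hx]
  rw [hF]

theorem heis_layerOp (g : FieldControlled k) (hB : A - Q.nbhd + Q.nbhd ⊆ B) (G : A → QubitOp) :
    heis (Q.layerOp B g) (extend (Q.subset_sub_add.trans hB) (prodOp G)) =
      extend hB (heis (Q.layerOp (A - Q.nbhd + Q.nbhd) g)
        (extend Q.subset_sub_add (prodOp G))) := by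
  have hconj : ∀ {B : Finset (Site d)} (hB : A - Q.nbhd + Q.nbhd ⊆ B),
      heis (Q.layerOp B g) (extend (Q.subset_sub_add.trans hB) (prodOp G)) =
      Q.regionBasis B * heis (ctrlOp (Q.layerFun B g)) (extend (Q.subset_sub_add.trans hB)
        (prodOp fun x => Q.basis.conjTranspose * G x * Q.basis)) *
          (Q.regionBasis B).conjTranspose := by
    intro B hB
    have h1 : extend (Q.subset_sub_add.trans hB)
        (prodOp fun x => Q.basis.conjTranspose * G x * Q.basis) =
        (Q.regionBasis B).conjTranspose * extend (Q.subset_sub_add.trans hB) (prodOp G) *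
          Q.regionBasis B := by
      rw [regionBasis_eq, extend_prodOp, extend_prodOp, prodOp_conjTranspose, prodOp_mul,
        prodOp_mul]
      congr 1
      funext x
      have := Unitary.star_mul_self_of_mem Q.basis_mem
      rw [Matrix.star_eq_conjTranspose] at this
      by_cases hx : x.1 ∈ A <;> simp [hx, this]
    rw [h1, layerOp, layerMatrix_eq]
    simp only [heis, star_mul, Matrix.star_eq_conjTranspose, Matrix.conjTranspose_conjTranspose,
      mul_assoc]
  rw [hconj hB, hconj (Finset.Subset.refl _), Q.heis_ctrlOp_layerFun g hB]
  exact conj_prodOp_extend hB (fun _ => Q.basis_mem) _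

/-- The operator of a sequence of field-controlled unitaries on a region. -/
def listOp (A : Finset (Site d)) (gs : List (FieldControlled k)) : Op A :=
  gs.foldl (fun M g => Q.layerOp A g * M) 1

theorem foldl_layerOp (A : Finset (Site d)) (gs : List (FieldControlled k)) (M : Op A) :
    gs.foldl (fun M g => Q.layerOp A g * M) M = Q.listOp A gs * M := by
  induction gs generalizing M with
  | nil => simp [listOp]
  | cons g gs ih =>
    rw [listOp, List.foldl_cons, List.foldl_cons, ih, ih (Q.layerOp A g * 1), mul_one, mul_assoc]

theorem listOp_append (A : Finset (Site d)) (gs gs' : List (FieldControlled k)) :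
    Q.listOp A (gs ++ gs') = Q.listOp A gs' * Q.listOp A gs := by
  rw [listOp, List.foldl_append, foldl_layerOp]
  rfl

theorem listOp_singleton (A : Finset (Site d)) (g : FieldControlled k) :
    Q.listOp A [g] = Q.layerOp A g := by
  simp [listOp]

theorem foldl_layerAct_eq {ρ : Family d} (hρ : IsState ρ) (gs : List (FieldControlled k))
    (A : Finset (Site d)) :
    ∃ B₀, ∀ B, B₀ ⊆ B → gs.foldl (fun ρ₁ g => Q.layerAct g ρ₁) ρ A =
      ptrace A B (Q.listOp B gs * ρ B * (Q.listOp B gs).conjTranspose) := by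
  induction gs using List.reverseRecOn generalizing A with
  | nil =>
    refine ⟨A, fun B hB => ?_⟩
    simp [listOp, hρ.consistent A B hB]
  | append_singleton gs g ih =>
    obtain ⟨B₀, h₀⟩ := ih (A - Q.nbhd + Q.nbhd)
    refine ⟨B₀ ∪ (A - Q.nbhd + Q.nbhd), fun B hB => ?_⟩
    have hB₀ := Finset.union_subset_left hB
    have hB₁ := Finset.union_subset_right hB
    rw [List.foldl_append, List.foldl_cons, List.foldl_nil, layerAct, h₀ B hB₀, listOp_append,
      listOp_singleton]
    ext i j
    have e : Q.layerOp B g * Q.listOp B gs * ρ B *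
        (Q.layerOp B g * Q.listOp B gs).conjTranspose = Q.layerOp B g *
        (Q.listOp B gs * ρ B * (Q.listOp B gs).conjTranspose) * (Q.layerOp B g).conjTranspose := by
      rw [Matrix.conjTranspose_mul]
      simp only [mul_assoc]
    rw [e, ptrace_apply_eq_trace Q.subset_sub_add,
      ptrace_apply_eq_trace (Q.subset_sub_add.trans hB₁), trace_mul_conj, trace_mul_conj,
      trace_mul_ptrace hB₁, single_eq_prodOp, Q.heis_layerOp g hB₁]

/-- The field-controlled unitaries of the first `n` time steps. -/
def gates : ℕ → List (FieldControlled k)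
  | 0 => []
  | n + 1 => gates n ++ Q.program n

theorem regionEvolution_eq (A : Finset (Site d)) (n : ℕ) :
    Q.regionEvolution A n = Q.listOp A (Q.gates n) := by
  induction n with
  | zero => rfl
  | succ n ih => rw [regionEvolution, gates, listOp_append, ih]; rfl

theorem evolve_eq (n : ℕ) (ρ : Family d) :
    Q.evolve n ρ = (Q.gates n).foldl (fun ρ₁ g => Q.layerAct g ρ₁) ρ := by
  induction n with
  | zero => rfl
  | succ n ih => rw [evolve, gates, List.foldl_append, ih]; rfl

theorem exists_evolve_eq_ptrace {ρ : Family d} (hρ : IsState ρ) (n : ℕ) (A : Finset (Site d)) :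
    ∃ B₀, ∀ B, B₀ ⊆ B → Q.evolve n ρ A =
      ptrace A B (Q.regionEvolution B n * ρ B * (Q.regionEvolution B n).conjTranspose) := by
  simp only [evolve_eq, regionEvolution_eq]
  exact Q.foldl_layerAct_eq hρ _ A

end CQCA

end QCA

namespace QCA

/-! ### Interactions implemented by field-controlled unitaries -/

open scoped Matrix.Norms.L2Operator Kronecker

variable {d : ℕ} {A B : Finset (Site d)}

theorem ctrlOp_diagonal (δ : Config A → A → Fin 2 → ℂ) :
    ctrlOp (fun s x => Matrix.diagonal (δ s x)) = Matrix.diagonal fun s => ∏ x, δ s x (s x) := by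
  ext s s'
  rw [ctrlOp_apply, Matrix.diagonal_apply]
  split_ifs with h
  · subst h
    simp
  · obtain ⟨x, hx⟩ := Function.ne_iff.1 h
    exact Finset.prod_eq_zero (Finset.mem_univ x) (Matrix.diagonal_apply_ne _ hx)

theorem siteOp_diagonal (x : A) (κ : Fin 2 → ℂ) :
    siteOp x (Matrix.diagonal κ) = Matrix.diagonal fun s : Config A => κ (s x) := by
  classical
  have h : (Function.update (1 : A → QubitOp) x (Matrix.diagonal κ)) =
      fun y => Matrix.diagonal (Function.update (1 : A → Fin 2 → ℂ) x κ y) := by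
    funext y
    by_cases hy : y = x
    · subst hy; simp
    · simp only [Function.update_of_ne hy]
      exact Matrix.diagonal_one.symm
  rw [siteOp_eq, h, prodOp, ctrlOp_diagonal]
  congr 1
  funext s
  rw [Finset.prod_eq_single x]
  · simp
  · intro y _ hy
    simp [Function.update_of_ne hy]
  · simp

theorem conj_prodOp_siteOp {t : A → QubitOp} (ht : ∀ x, t x ∈ Matrix.unitaryGroup (Fin 2) ℂ)
    (x : A) (m : QubitOp) :
    prodOp t * siteOp x m * (prodOp t).conjTranspose =
      siteOp x (t x * m * (t x).conjTranspose) := by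
  classical
  rw [siteOp_eq, siteOp_eq, prodOp_conjTranspose, prodOp_mul, prodOp_mul]
  congr 1
  funext y
  by_cases hy : y = x
  · subst hy; simp
  · have := Unitary.mul_star_self_of_mem (ht y)
    rw [Matrix.star_eq_conjTranspose] at this
    simp [Function.update_of_ne hy, this]

theorem gate_conj_diagonal {n : Type} [Fintype n] [DecidableEq n] {U : Matrix n n ℂ}
    (hU : U ∈ unitary (Matrix n n ℂ)) (v : n → ℂ) (θ : ℝ) :
    gate (U * Matrix.diagonal v * U.conjTranspose) θ =
      U * Matrix.diagonal (fun i => Complex.exp (-(Complex.I * θ) * v i)) * U.conjTranspose := by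
  have h1 : U * U.conjTranspose = 1 := (Unitary.mem_iff.1 hU).2
  have hinv : U⁻¹ = U.conjTranspose := Matrix.inv_eq_right_inv h1
  have hun : IsUnit U := (Matrix.isUnit_iff_isUnit_det U).2
    ((Matrix.isUnit_det_of_right_inverse h1))
  unfold gate
  rw [← hinv, ← Matrix.smul_mul, ← Matrix.mul_smul, Matrix.exp_conj U _ hun,
    ← Matrix.diagonal_smul, Matrix.exp_diagonal]
  congr 3
  funext i
  rw [Pi.coe_exp, Complex.exp_eq_exp_ℂ]
  rfl

/-- The sum of the couplings `K ⊗ L` over the pairs of neighbours in `A` the first of which has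
colour `a` and the second of which has colour `b`. -/
def pairHam {k : ℕ} (N : Finset (Site d)) (C : Colouring d k) (a b : Fin k) (K L : QubitOp)
    (A : Finset (Site d)) : Op A :=
  open Classical in
  ∑ x : A, ∑ y : A,
    if y ≠ x ∧ y.1 - x.1 ∈ N ∧ C.toFun x.1 = a ∧ C.toFun y.1 = b then
      siteOp x K * siteOp y L else 0

/-- The unitary with diagonal entries `exp (-i v 0)` and `exp (-i v 1)`. -/
def phaseUnitary (v : Fin 2 → ℝ) : Matrix.unitaryGroup (Fin 2) ℂ :=
  ⟨Matrix.diagonal fun i => Complex.exp (-(Complex.I * v i)), by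
    rw [Matrix.mem_unitaryGroup_iff, Matrix.star_eq_conjTranspose, Matrix.diagonal_conjTranspose,
      Matrix.diagonal_mul_diagonal, ← Matrix.diagonal_one]
    congr 1
    funext i
    rw [Pi.star_apply, Complex.star_def, ← Complex.exp_conj, ← Complex.exp_add]
    simp⟩

/-- The function `f` of the field of colour `b` at a point of colour `a` is the sum over the
neighbours of colour `b` of the values `μ` of their eigenstates. -/
def CQCA.Reads {k : ℕ} (Q : CQCA d k) (f : ℝ → ℝ) (μ : Fin 2 → ℝ) : Prop :=
  ∀ (A : Finset (Site d)) (s : Config A) (x : A) (b : Fin k), open Classical in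
    f (Q.field s x b) = ∑ y : A, if y ≠ x ∧ y.1 - x.1 ∈ Q.nbhd ∧ Q.colouring.toFun y.1 = b then
      μ (s y) else 0

/-- The sequence of field-controlled unitaries that implements a coupling of the points of colour
`a` to their neighbours of colour `b`. -/
def couplingGates {k : ℕ} (a b : Fin k) (Y V : Matrix.unitaryGroup (Fin 2) ℂ) (κ : Fin 2 → ℝ)
    (f : ℝ → ℝ) (Φ : Finset ℝ) (θ : ℝ) : List (FieldControlled k) :=
  [⟨b, Set.univ, star V⟩] ++
    Φ.toList.map (fun φ =>
      ⟨a, {ψ | ψ b = φ}, Y * phaseUnitary (fun i => θ * f φ * κ i) * star Y⟩) ++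
    [⟨b, Set.univ, V⟩]

namespace CQCA

variable {k : ℕ} (Q : CQCA d k)

theorem layerOp_univ (A : Finset (Site d)) (b : Fin k) (V : Matrix.unitaryGroup (Fin 2) ℂ) :
    Q.layerOp A ⟨b, Set.univ, V⟩ =
      prodOp fun x => if Q.colouring.toFun x.1 = b then V.1 else 1 := by
  have h : ctrlOp (Q.layerFun A ⟨b, Set.univ, V⟩) = prodOp fun x =>
      if Q.colouring.toFun x.1 = b then Q.basis.conjTranspose * V.1 * Q.basis else 1 := by
    unfold prodOp
    congr 1
    funext s x
    simp [layerFun]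
  rw [layerOp, layerMatrix_eq, h, regionBasis_eq, prodOp_conjTranspose, prodOp_mul, prodOp_mul]
  congr 1
  funext x
  have := Unitary.mul_star_self_of_mem Q.basis_mem
  rw [Matrix.star_eq_conjTranspose] at this
  simp only [Pi.mul_apply]
  split_ifs
  · rw [← mul_assoc, ← mul_assoc, this, one_mul, mul_assoc, this, mul_one]
  · rw [mul_one, this]

theorem regionBasis_conjTranspose_mul (A : Finset (Site d)) :
    (Q.regionBasis A).conjTranspose * Q.regionBasis A = 1 :=
  (Unitary.mem_iff.1 (prodOp_mem_unitary fun _ => Q.basis_mem)).1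

theorem regionBasis_mul_conjTranspose (A : Finset (Site d)) :
    Q.regionBasis A * (Q.regionBasis A).conjTranspose = 1 :=
  (Unitary.mem_iff.1 (prodOp_mem_unitary fun _ => Q.basis_mem)).2

open Classical in
theorem listOp_map_field (A : Finset (Site d)) (a b : Fin k)
    (u : ℝ → Matrix.unitaryGroup (Fin 2) ℂ) (l : List ℝ) (hl : l.Nodup) :
    Q.listOp A (l.map fun φ => ⟨a, {ψ | ψ b = φ}, u φ⟩) =
      Q.regionBasis A * ctrlOp (fun s x =>
        if Q.colouring.toFun x.1 = a ∧ Q.field s x b ∈ l then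
          Q.basis.conjTranspose * (u (Q.field s x b)).1 * Q.basis else 1) *
        (Q.regionBasis A).conjTranspose := by
  have hctrl : ∀ l : List ℝ, Controlled (fun x : A => Q.colouring.toFun x.1 = a) (fun s x =>
      if Q.colouring.toFun x.1 = a ∧ Q.field s x b ∈ l then
        Q.basis.conjTranspose * (u (Q.field s x b)).1 * Q.basis else 1) := by
    intro l
    refine ⟨fun s x hx => if_neg fun h => hx h.1, fun s s' h => ?_⟩
    funext x
    by_cases hx : Q.colouring.toFun x.1 = a
    · rw [Q.field_congr (s := s) (s' := s')]
      intro r hr hrx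
      refine h r fun hc => Q.correct x.1 r.1 ⟨fun he => hr (Subtype.ext he.symm), Or.inl hrx⟩ ?_
      rw [hx, hc]
    · rw [if_neg fun h => hx h.1, if_neg fun h => hx h.1]
  induction l with
  | nil =>
    simp only [List.map_nil, List.not_mem_nil, and_false, if_false, ctrlOp_one, mul_one]
    rw [regionBasis_mul_conjTranspose]
    rfl
  | cons φ l ih =>
    have hcons : ∀ (g : FieldControlled k) gs, Q.listOp A (g :: gs) =
        Q.listOp A gs * Q.layerOp A g := fun g gs => by
      rw [← List.singleton_append, listOp_append, listOp_singleton]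
    rw [List.map_cons, hcons, ih (List.nodup_cons.1 hl).2, layerOp, layerMatrix_eq]
    set R := Q.regionBasis A with hR
    have hR1 : R.conjTranspose * R = 1 := Q.regionBasis_conjTranspose_mul A
    have hF : ctrlOp (fun s x => if Q.colouring.toFun x.1 = a ∧ Q.field s x b ∈ φ :: l then
        Q.basis.conjTranspose * (u (Q.field s x b)).1 * Q.basis else 1) =
        ctrlOp (fun s x => if Q.colouring.toFun x.1 = a ∧ Q.field s x b ∈ l then
        Q.basis.conjTranspose * (u (Q.field s x b)).1 * Q.basis else 1) *
        ctrlOp (Q.layerFun A ⟨a, {ψ | ψ b = φ}, u φ⟩) := by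
      rw [(hctrl l).mul (Q.layerFun_controlled ⟨a, {ψ | ψ b = φ}, u φ⟩)]
      congr 1
      funext s x
      unfold layerFun
      by_cases hx : Q.colouring.toFun x.1 = a
      · by_cases hφ : Q.field s x b = φ
        · have : φ ∉ l := (List.nodup_cons.1 hl).1
          simp [hx, hφ, this]
        · simp [hx, hφ]
      · simp [hx]
    rw [hF]
    set F₁ := ctrlOp (fun s x => if Q.colouring.toFun x.1 = a ∧ Q.field s x b ∈ l then
        Q.basis.conjTranspose * (u (Q.field s x b)).1 * Q.basis else 1)
    set F₂ := ctrlOp (Q.layerFun A ⟨a, {ψ | ψ b = φ}, u φ⟩)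
    calc R * F₁ * R.conjTranspose * (R * F₂ * R.conjTranspose)
        = R * F₁ * (R.conjTranspose * R) * F₂ * R.conjTranspose := by simp only [mul_assoc]
      _ = R * (F₁ * F₂) * R.conjTranspose := by rw [hR1, mul_one]; simp only [mul_assoc]

/-- The sequence `couplingGates` implements the exponential of a sum of two-qubit couplings. -/
theorem listOp_couplingGates {f : ℝ → ℝ} {μ : Fin 2 → ℝ} (hf : Q.Reads f μ) {Φ : Finset ℝ}
    {b : Fin k} (hΦ : ∀ (A : Finset (Site d)) (s : Config A) (x : A), Q.field s x b ∈ Φ)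
    {a : Fin k} (hab : a ≠ b) (Y V : Matrix.unitaryGroup (Fin 2) ℂ) (κ : Fin 2 → ℝ) (θ : ℝ)
    (A : Finset (Site d)) :
    Q.listOp A (couplingGates a b Y V κ f Φ θ) =
      gate (pairHam Q.nbhd Q.colouring a b
        (Y.1 * Matrix.diagonal (fun i => (κ i : ℂ)) * Y.1.conjTranspose)
        (V.1 * Q.basis * Matrix.diagonal (fun i => (μ i : ℂ)) *
          (V.1 * Q.basis).conjTranspose) A) θ := by
  classical
  set col := Q.colouring.toFun with hcol
  set t : A → QubitOp := fun x => if col x.1 = a then Y.1 else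
    if col x.1 = b then V.1 * Q.basis else Q.basis with ht
  have htu : ∀ x, t x ∈ Matrix.unitaryGroup (Fin 2) ℂ := by
    intro x
    simp only [ht]
    split_ifs
    · exact Y.2
    · exact mul_mem V.2 Q.basis_mem
    · exact Q.basis_mem
  have hTu : prodOp t ∈ unitary (Op A) := prodOp_mem_unitary htu
  have hT1 : (prodOp t).conjTranspose * prodOp t = 1 := (Unitary.mem_iff.1 hTu).1
  have hbas : Q.basis * Q.basis.conjTranspose = 1 := (Unitary.mem_iff.1 Q.basis_mem).2
  -- the Hamiltonian in the adapted product basis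
  have hham : pairHam Q.nbhd Q.colouring a b
        (Y.1 * Matrix.diagonal (fun i => (κ i : ℂ)) * Y.1.conjTranspose)
        (V.1 * Q.basis * Matrix.diagonal (fun i => (μ i : ℂ)) * (V.1 * Q.basis).conjTranspose) A =
      prodOp t * Matrix.diagonal (fun s : Config A => ∑ x : A, ∑ y : A,
        if y ≠ x ∧ y.1 - x.1 ∈ Q.nbhd ∧ col x.1 = a ∧ col y.1 = b then
          (κ (s x) : ℂ) * μ (s y) else 0) * (prodOp t).conjTranspose := by
    have hdiag : Matrix.diagonal (fun s : Config A => ∑ x : A, ∑ y : A,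
        if y ≠ x ∧ y.1 - x.1 ∈ Q.nbhd ∧ col x.1 = a ∧ col y.1 = b then
          (κ (s x) : ℂ) * μ (s y) else 0) = ∑ x : A, ∑ y : A,
        if y ≠ x ∧ y.1 - x.1 ∈ Q.nbhd ∧ col x.1 = a ∧ col y.1 = b then
          Matrix.diagonal (fun s : Config A => (κ (s x) : ℂ) * μ (s y)) else 0 := by
      ext s s'
      simp only [Matrix.sum_apply, Matrix.diagonal_apply, apply_ite (fun M : Op A => M s s'),
        Matrix.zero_apply]
      by_cases hs : s = s' <;> simp [hs]
    rw [hdiag, pairHam, Finset.mul_sum, Finset.sum_mul]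
    refine Finset.sum_congr rfl fun x _ => ?_
    rw [Finset.mul_sum, Finset.sum_mul]
    refine Finset.sum_congr rfl fun y _ => ?_
    split_ifs with h
    · obtain ⟨-, -, hx, hy⟩ := h
      have htx : t x = Y.1 := if_pos hx
      have hty : t y = V.1 * Q.basis := by
        simp only [ht]
        rw [if_neg (by rw [show col y.1 = b from hy]; exact hab.symm), if_pos hy]
      have e1 := conj_prodOp_siteOp htu x (Matrix.diagonal (fun i => (κ i : ℂ)))
      have e2 := conj_prodOp_siteOp htu y (Matrix.diagonal (fun i => (μ i : ℂ)))
      rw [htx] at e1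
      rw [hty] at e2
      rw [← e1, ← e2, siteOp_diagonal, siteOp_diagonal]
      have e3 : Matrix.diagonal (fun s : Config A => (κ (s x) : ℂ) * μ (s y)) =
          Matrix.diagonal (fun s : Config A => (κ (s x) : ℂ)) *
            Matrix.diagonal (fun s : Config A => (μ (s y) : ℂ)) := by
        rw [Matrix.diagonal_mul_diagonal]
      rw [e3]
      set D₁ := Matrix.diagonal (fun s : Config A => (κ (s x) : ℂ))
      set D₂ := Matrix.diagonal (fun s : Config A => (μ (s y) : ℂ))
      calc _ = prodOp t * D₁ * ((prodOp t).conjTranspose * prodOp t) * D₂ *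
            (prodOp t).conjTranspose := by simp only [mul_assoc]
        _ = _ := by rw [hT1, mul_one]; simp only [mul_assoc]
    · rw [mul_zero, zero_mul]
  rw [hham, gate_conj_diagonal hTu]
  -- the gates in the adapted product basis
  rw [couplingGates, listOp_append, listOp_append, listOp_singleton, listOp_singleton,
    layerOp_univ, layerOp_univ, listOp_map_field _ _ _ _ _ _ (Finset.nodup_toList Φ)]
  simp only [Finset.mem_toList, hΦ, and_true]
  set w : A → QubitOp := fun x => if col x.1 = a then Q.basis.conjTranspose * Y.1 else 1 with hw
  set δ : Config A → A → Fin 2 → ℂ := fun s x i =>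
    if col x.1 = a then Complex.exp (-(Complex.I * (θ * f (Q.field s x b) * κ i : ℝ))) else 1
    with hδ
  have hR : Controlled (fun x : A => col x.1 = a) (fun _ => w) :=
    ⟨fun s x hx => if_neg hx, fun _ _ _ => rfl⟩
  have hR' : Controlled (fun x : A => col x.1 = a) (fun _ x => (w x).conjTranspose) :=
    ⟨fun s x hx => by simp [hw, hx], fun _ _ _ => rfl⟩
  have hD : Controlled (fun x : A => col x.1 = a) (fun s x => Matrix.diagonal (δ s x)) := by
    refine ⟨fun s x hx => ?_, fun s s' h => ?_⟩
    · simp only [hδ, if_neg hx]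
      exact Matrix.diagonal_one
    · funext x
      congr 1
      funext i
      simp only [hδ]
      by_cases hx : col x.1 = a
      · rw [Q.field_congr (s := s) (s' := s')]
        intro r hr hrx
        refine h r fun hc => Q.correct x.1 r.1 ⟨fun he => hr (Subtype.ext he.symm), Or.inl hrx⟩ ?_
        rw [← hcol, hx, hc]
      · rw [if_neg hx, if_neg hx]
  have hval : ∀ v, (Y * phaseUnitary v * star Y).1 =
      Y.1 * Matrix.diagonal (fun i => Complex.exp (-(Complex.I * v i))) * Y.1.conjTranspose :=
    fun _ => rfl
  have hF : ctrlOp (fun (s : Config A) (x : A) => if col x.1 = a then Q.basis.conjTranspose *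
      (Y * phaseUnitary (fun i => θ * f (Q.field s x b) * κ i) * star Y).1 * Q.basis else 1) =
      prodOp w * Matrix.diagonal (fun s => ∏ x, δ s x (s x)) * (prodOp w).conjTranspose := by
    rw [← ctrlOp_diagonal, prodOp_conjTranspose, prodOp, prodOp, hR.mul hD,
      Controlled.mul ⟨fun s x hx => ?_, fun s s' h => ?_⟩ hR']
    · congr 1
      funext s x
      simp only [hw, hδ]
      split_ifs with hx
      · rw [hval]
        simp only [Matrix.conjTranspose_mul, Matrix.conjTranspose_conjTranspose, mul_assoc]
      · have : (Matrix.diagonal fun _ : Fin 2 => (1 : ℂ)) = 1 := Matrix.diagonal_one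
        simp [this]
    · rw [hw, hD.eq_one s x hx]
      simp [hx]
    · exact funext fun x => congrArg (w x * ·) (congrFun (hD.congr s s' h) x)
  rw [hF]
  have hTw : (prodOp fun x : A => if col x.1 = b then V.1 else 1) * Q.regionBasis A * prodOp w =
      prodOp t := by
    rw [regionBasis_eq, prodOp_mul, prodOp_mul]
    congr 1
    funext x
    simp only [Pi.mul_apply, hw, ht]
    by_cases hxa : col x.1 = a
    · have hxb : col x.1 ≠ b := by rw [hxa]; exact hab
      rw [if_pos hxa, if_pos hxa, if_neg hxb, one_mul, ← mul_assoc, hbas, one_mul]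
    · rw [if_neg hxa, if_neg hxa, mul_one]
      split_ifs <;> simp
  have hTw' : (prodOp w).conjTranspose * (Q.regionBasis A).conjTranspose *
      (prodOp fun x : A => if col x.1 = b then (star V).1 else 1) = (prodOp t).conjTranspose := by
    rw [← hTw, Matrix.conjTranspose_mul, Matrix.conjTranspose_mul, prodOp_conjTranspose (fun x =>
      if col x.1 = b then V.1 else 1), mul_assoc]
    congr 3
    funext x
    split_ifs
    · rfl
    · simp
  have hexp : (fun s : Config A => ∏ x, δ s x (s x)) = fun s : Config A =>
      Complex.exp (-(Complex.I * θ) * ∑ x : A, ∑ y : A,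
        if y ≠ x ∧ y.1 - x.1 ∈ Q.nbhd ∧ col x.1 = a ∧ col y.1 = b then
          (κ (s x) : ℂ) * μ (s y) else 0) := by
    funext s
    rw [Finset.mul_sum, Complex.exp_sum]
    refine Finset.prod_congr rfl fun x _ => ?_
    simp only [hδ]
    split_ifs with hx
    · rw [hf A s x b]
      congr 1
      push_cast
      simp only [hx, true_and, Finset.mul_sum, Finset.sum_mul]
      rw [← Finset.sum_neg_distrib]
      refine Finset.sum_congr rfl fun y _ => ?_
      split_ifs
      · ring
      · simp
    · simp [hx]
  rw [← hTw', ← hTw, hexp]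
  simp only [mul_assoc]
  rfl

end CQCA

end QCA

namespace QCA

/-! ### Fields, colourings and couplings -/

open scoped Kronecker

variable {d k : ℕ}

theorem CQCA.exists_finset_field_mem (Q : CQCA d k) :
    ∃ Φ : Finset ℝ, ∀ (A : Finset (Site d)) (s : Config A) (x : A) (b : Fin k),
      Q.field s x b ∈ Φ := by
  classical
  refine ⟨(Finset.range (Q.nbhd.card + 1) ×ˢ Finset.range (Q.nbhd.card + 1)).image fun p : ℕ × ℕ =>
    (p.1 : ℝ) * Q.obs_herm.eigenvalues 0 + p.2 * Q.obs_herm.eigenvalues 1, fun A s x b => ?_⟩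
  set S : Finset A := Finset.univ.filter fun r =>
    r ≠ x ∧ r.1 - x.1 ∈ Q.nbhd ∧ Q.colouring.toFun r.1 = b with hS
  have hcard : ∀ S' ⊆ S, S'.card ∈ Finset.range (Q.nbhd.card + 1) := by
    intro S' hS'
    rw [Finset.mem_range, Nat.lt_succ_iff]
    refine Finset.card_le_card_of_injOn (fun r => r.1 - x.1)
      (fun r hr => (Finset.mem_filter.1 (hS' hr)).2.2.1) fun r _ r' _ h => ?_
    exact Subtype.ext (sub_left_injective h)
  refine Finset.mem_image.2 ⟨((S.filter fun r => s r = 0).card, (S.filter fun r => s r = 1).card),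
    Finset.mem_product.2 ⟨hcard _ (Finset.filter_subset _ _), hcard _ (Finset.filter_subset _ _)⟩,
    ?_⟩
  have h1 : Q.field s x b = ∑ r ∈ S, Q.obs_herm.eigenvalues (s r) := by
    rw [hS, Finset.sum_filter]
    rfl
  rw [h1, ← Finset.sum_fiberwise S s, Fin.sum_univ_two]
  have h2 : ∀ i : Fin 2, ∑ r ∈ S.filter (fun r => s r = i), Q.obs_herm.eigenvalues (s r) =
      ((S.filter fun r => s r = i).card : ℝ) * Q.obs_herm.eigenvalues i := by
    intro i
    rw [Finset.sum_congr rfl fun r hr => by rw [(Finset.mem_filter.1 hr).2], Finset.sum_const,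
      nsmul_eq_mul]
  rw [h2, h2]

theorem CQCA.reads_eigenvalues (Q : CQCA d k) : Q.Reads id Q.obs_herm.eigenvalues :=
  fun _ _ _ _ => rfl

theorem CQCA.reads_indicator (Q : CQCA d k)
    (hsep : ∀ x y y' : Site d, y ≠ x → y' ≠ x → y - x ∈ Q.nbhd → y' - x ∈ Q.nbhd →
      Q.colouring.toFun y = Q.colouring.toFun y' → y = y')
    (h0 : Q.obs_herm.eigenvalues 0 ≠ 0)
    (h01 : Q.obs_herm.eigenvalues 0 ≠ Q.obs_herm.eigenvalues 1) :
    Q.Reads (fun φ => if φ = Q.obs_herm.eigenvalues 0 then 1 else 0)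
      (fun i => if i = 0 then 1 else 0) := by
  classical
  intro A s x b
  by_cases h : ∃ y : A, y ≠ x ∧ y.1 - x.1 ∈ Q.nbhd ∧ Q.colouring.toFun y.1 = b
  · obtain ⟨y, hy⟩ := h
    have huniq : ∀ r : A, r ≠ y →
        ¬ (r ≠ x ∧ r.1 - x.1 ∈ Q.nbhd ∧ Q.colouring.toFun r.1 = b) := by
      rintro r hr ⟨h1, h2, h3⟩
      exact hr (Subtype.ext (hsep x.1 r.1 y.1 (fun h => h1 (Subtype.ext h))
        (fun h => hy.1 (Subtype.ext h)) h2 hy.2.1 (h3.trans hy.2.2.symm)))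
    have e1 : Q.field s x b = Q.obs_herm.eigenvalues (s y) := by
      unfold field
      rw [Finset.sum_eq_single y (fun r _ hr => if_neg (huniq r hr)) (by simp), if_pos hy]
    rw [e1, Finset.sum_eq_single y (fun r _ hr => if_neg (huniq r hr)) (by simp), if_pos hy]
    rcases Fin.exists_fin_two.1 ⟨s y, rfl⟩ with h | h
    · simp [h]
    · simp [h, h01.symm]
  · push Not at h
    have e1 : Q.field s x b = 0 := by
      unfold field
      exact Finset.sum_eq_zero fun r _ => if_neg fun hr => h r hr.1 hr.2.1 hr.2.2
    rw [e1]
    dsimp only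
    rw [if_neg h0.symm]
    exact (Finset.sum_eq_zero fun r _ => if_neg fun hr => h r hr.1 hr.2.1 hr.2.2).symm

/-- Some colours of a colouring can be broken up so that points of these colours whose difference
lies in a given finite set get different colours. -/
theorem Colouring.exists_refinement (C : Colouring d k) (V : Finset (Site d))
    (bad : Fin k → Prop) :
    ∃ (k₁ : ℕ) (C₁ : Colouring d k₁), C₁.Refines C ∧
      (∀ x y, C.toFun x = C.toFun y → ¬ bad (C.toFun x) → C₁.toFun x = C₁.toFun y) ∧
      ∀ x y, x ≠ y → y - x ∈ V → bad (C.toFun x) → C₁.toFun x ≠ C₁.toFun y := by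
  classical
  obtain ⟨M, hM, hper⟩ := C.periodic
  set L : ℕ := 1 + ∑ v ∈ V, ∑ i, (v i).natAbs with hL
  set M' : ℕ := M * L with hM'
  have hM'0 : 0 < M' := by positivity
  have : NeZero M' := ⟨hM'0.ne'⟩
  set col : Site d → Fin k × (Fin d → ZMod M') := fun x =>
    (C.toFun x, if bad (C.toFun x) then fun i => (x i : ZMod M') else 0) with hcol
  refine ⟨Fintype.card (Fin k × (Fin d → ZMod M')), ⟨fun x => Fintype.equivFin _ (col x),
    M', hM'0, fun x v => ?_⟩, fun x y h => ?_, fun x y h hb => ?_, fun x y hxy hv hb h => ?_⟩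
  · have h1 : C.toFun (x + (M' : ℤ) • v) = C.toFun x := by
      have := hper x ((L : ℤ) • v)
      rwa [smul_smul, ← Nat.cast_mul] at this
    congr 1
    simp only [hcol, h1]
    congr 2
    funext i
    simp
  · exact congrArg Prod.fst ((Fintype.equivFin _).injective h)
  · show Fintype.equivFin _ (col x) = Fintype.equivFin _ (col y)
    congr 1
    simp only [hcol, ← h, if_neg hb]
  · have h1 := (Fintype.equivFin _).injective h
    have h2 : C.toFun x = C.toFun y := congrArg Prod.fst h1
    have h3 := congrArg Prod.snd h1
    simp only [hcol, ← h2, if_pos hb] at h3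
    apply hxy
    funext i
    have h4 := (ZMod.intCast_eq_intCast_iff_dvd_sub _ _ _).1 (congrFun h3 i)
    have h5 : |y i - x i| < (M' : ℤ) := by
      have h6 : ((y - x) i).natAbs ≤ ∑ v ∈ V, ∑ i, (v i).natAbs :=
        (Finset.single_le_sum (f := fun i => ((y - x) i).natAbs) (fun _ _ => Nat.zero_le _)
          (Finset.mem_univ i)).trans (Finset.single_le_sum (f := fun v : Site d =>
            ∑ i, (v i).natAbs) (fun _ _ => Nat.zero_le _) hv)
      have h7 : L ≤ M' := Nat.le_mul_of_pos_left L hM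
      rw [Int.abs_eq_natAbs]
      have h8 : (y i - x i).natAbs = ((y - x) i).natAbs := rfl
      omega
    have := Int.eq_zero_of_abs_lt_dvd h4 h5
    omega

theorem eq_conj_diagonal {σ : QubitOp} (hσ : σ.IsHermitian) :
    σ = hσ.eigenvectorUnitary.1 * Matrix.diagonal (fun i => (hσ.eigenvalues i : ℂ)) *
      hσ.eigenvectorUnitary.1.conjTranspose := by
  conv_lhs => rw [hσ.spectral_theorem, Unitary.conjStarAlgAut_apply]
  rfl

theorem eigenvalues_ne {σ : QubitOp} (hσ : σ.IsHermitian)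
    (h : ∀ c : ℂ, σ ≠ c • (1 : QubitOp)) : hσ.eigenvalues 0 ≠ hσ.eigenvalues 1 := by
  intro he
  apply h (hσ.eigenvalues 0)
  have hd : Matrix.diagonal (fun i => (hσ.eigenvalues i : ℂ)) =
      (hσ.eigenvalues 0 : ℂ) • (1 : QubitOp) := by
    rw [Matrix.smul_one_eq_diagonal]
    congr 1
    funext i
    fin_cases i
    · rfl
    · simp [he]
  have hu : hσ.eigenvectorUnitary.1 * hσ.eigenvectorUnitary.1.conjTranspose = 1 :=
    Unitary.mul_star_self_of_mem hσ.eigenvectorUnitary.2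
  have := eq_conj_diagonal hσ
  rw [hd, Matrix.mul_smul, mul_one, Matrix.smul_mul, hu] at this
  exact this

/-- The unitary that exchanges the two basis states. -/
def flipUnitary : Matrix.unitaryGroup (Fin 2) ℂ :=
  ⟨!![0, 1; 1, 0], by
    rw [Matrix.mem_unitaryGroup_iff, Matrix.star_eq_conjTranspose]
    ext i j
    fin_cases i <;> fin_cases j <;> simp [Matrix.mul_apply, Fin.sum_univ_two]⟩

theorem flip_conj_diagonal (v : Fin 2 → ℂ) :
    flipUnitary.1 * Matrix.diagonal v * flipUnitary.1.conjTranspose =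
      Matrix.diagonal ![v 1, v 0] := by
  have h1 : flipUnitary.1.conjTranspose = !![0, 1; 1, 0] := by
    ext i j
    fin_cases i <;> fin_cases j <;> simp [flipUnitary, Matrix.conjTranspose_apply]
  have h2 : Matrix.diagonal v = !![v 0, 0; 0, v 1] := by
    ext i j
    fin_cases i <;> fin_cases j <;> simp
  rw [h1, h2]
  ext i j
  fin_cases i <;> fin_cases j <;> simp [flipUnitary]

theorem exists_eq_sum_conj {μ : Fin 2 → ℝ} (h1 : μ 0 ≠ μ 1) (h2 : μ 0 + μ 1 ≠ 0)
    (b : Matrix.unitaryGroup (Fin 2) ℂ) {L : QubitOp} (hL : L.IsHermitian) :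
    ∃ (γ : Fin 2 → ℝ) (V : Fin 2 → Matrix.unitaryGroup (Fin 2) ℂ),
      L = ∑ r, (γ r : ℂ) • ((V r).1 * b.1 * Matrix.diagonal (fun i => (μ i : ℂ)) *
        ((V r).1 * b.1).conjTranspose) := by
  set W := hL.eigenvectorUnitary
  set ν := hL.eigenvalues
  have hdet : μ 0 ^ 2 - μ 1 ^ 2 ≠ 0 := by
    rw [sq_sub_sq]
    exact mul_ne_zero h2 (sub_ne_zero.2 h1)
  refine ⟨![(ν 0 * μ 0 - ν 1 * μ 1) / (μ 0 ^ 2 - μ 1 ^ 2),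
    (ν 1 * μ 0 - ν 0 * μ 1) / (μ 0 ^ 2 - μ 1 ^ 2)], ![W * star b, W * flipUnitary * star b], ?_⟩
  have hb : (star b).1 * b.1 = 1 := Unitary.star_mul_self_of_mem b.2
  have e0 : (W * star b).1 * b.1 = W.1 := by
    rw [Submonoid.coe_mul, mul_assoc, hb, mul_one]
  have e1 : (W * flipUnitary * star b).1 * b.1 = W.1 * flipUnitary.1 := by
    rw [Submonoid.coe_mul, mul_assoc, hb, mul_one, Submonoid.coe_mul]
  rw [Fin.sum_univ_two]
  simp only [Matrix.cons_val_zero, Matrix.cons_val_one]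
  rw [e0, e1, eq_conj_diagonal hL, Matrix.conjTranspose_mul]
  have e2 : Matrix.diagonal (fun i => (ν i : ℂ)) =
      (((ν 0 * μ 0 - ν 1 * μ 1) / (μ 0 ^ 2 - μ 1 ^ 2) : ℝ) : ℂ) •
        Matrix.diagonal (fun i => (μ i : ℂ)) +
      (((ν 1 * μ 0 - ν 0 * μ 1) / (μ 0 ^ 2 - μ 1 ^ 2) : ℝ) : ℂ) •
        (flipUnitary.1 * Matrix.diagonal (fun i => (μ i : ℂ)) * flipUnitary.1.conjTranspose) := by
    have hdet' : (μ 0 : ℂ) ^ 2 - (μ 1 : ℂ) ^ 2 ≠ 0 := by exact_mod_cast hdet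
    rw [flip_conj_diagonal]
    ext i j
    fin_cases i <;> fin_cases j <;> simp
    · field_simp; ring
    · field_simp; ring
  change W.1 * Matrix.diagonal (fun i => (ν i : ℂ)) * W.1.conjTranspose = _
  rw [e2, mul_add, add_mul]
  simp only [Matrix.mul_smul, Matrix.smul_mul, mul_assoc]

/-- A basis of the Hermitian one-qubit operators. -/
def hermBasis : Fin 4 → QubitOp :=
  ![!![1, 0; 0, 0], !![0, 0; 0, 1], !![0, 1; 1, 0], !![0, -Complex.I; Complex.I, 0]]

/-- The dual basis of `hermBasis` with respect to the trace. -/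
def hermDual : Fin 4 → QubitOp :=
  ![!![1, 0; 0, 0], !![0, 0; 0, 1], !![0, 1 / 2; 1 / 2, 0], !![0, -Complex.I / 2; Complex.I / 2, 0]]

theorem hermBasis_isHermitian (a : Fin 4) : (hermBasis a).IsHermitian := by
  ext i j
  fin_cases a <;> fin_cases i <;> fin_cases j <;> simp [hermBasis, Matrix.conjTranspose_apply]

theorem star_hermDual (a : Fin 4) (i j : Fin 2) : star (hermDual a i j) = hermDual a j i := by
  fin_cases a <;> fin_cases i <;> fin_cases j <;> simp [hermDual]

theorem sum_hermDual_mul_hermBasis (p q p' q' : Fin 2) :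
    ∑ a, hermDual a q' p' * hermBasis a p q = if p = p' ∧ q = q' then 1 else 0 := by
  have h1 : Complex.I / 2 * Complex.I = -(1 / 2) := by
    rw [div_mul_eq_mul_div, Complex.I_mul_I, neg_div]
  rw [Fin.sum_univ_four]
  fin_cases p <;> fin_cases q <;> fin_cases p' <;> fin_cases q' <;>
    simp [hermDual, hermBasis, neg_div, h1] <;> norm_num

/-- Every two-qubit Hamiltonian is a real linear combination of products of Hermitian one-qubit
operators, the second of which are unitarily equivalent to a given operator, provided that this is
not traceless and not a multiple of the identity. -/
theorem exists_coupling_decomposition {μ : Fin 2 → ℝ} (h1 : μ 0 ≠ μ 1) (h2 : μ 0 + μ 1 ≠ 0)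
    (b : Matrix.unitaryGroup (Fin 2) ℂ) :
    ∃ (J : Type) (_ : Fintype J) (Y V : J → Matrix.unitaryGroup (Fin 2) ℂ) (κ : J → Fin 2 → ℝ)
      (D : J → Fin 2 × Fin 2 → Fin 2 × Fin 2 → ℂ),
      ∀ h : Matrix (Fin 2 × Fin 2) (Fin 2 × Fin 2) ℂ, h.IsHermitian →
        h = ∑ j, ((∑ p, ∑ q, D j p q * h p q).re : ℂ) •
          (((Y j).1 * Matrix.diagonal (fun i => (κ j i : ℂ)) * (Y j).1.conjTranspose) ⊗ₖ
            ((V j).1 * b.1 * Matrix.diagonal (fun i => (μ i : ℂ)) *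
              ((V j).1 * b.1).conjTranspose)) := by
  choose γ V hV using fun a => exists_eq_sum_conj h1 h2 b (hermBasis_isHermitian a)
  have hY' : ∀ a, ∃ (Y : Matrix.unitaryGroup (Fin 2) ℂ) (κ : Fin 2 → ℝ), hermBasis a =
      Y.1 * Matrix.diagonal (fun i => (κ i : ℂ)) * Y.1.conjTranspose :=
    fun a => ⟨_, _, eq_conj_diagonal (hermBasis_isHermitian a)⟩
  choose Y κ hY using hY'
  refine ⟨Fin 4 × Fin 4 × Fin 2, inferInstance, fun j => Y j.1, fun j => V j.2.1 j.2.2,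
    fun j => κ j.1,
    fun j p q => (γ j.2.1 j.2.2 : ℂ) * (hermDual j.1 q.1 p.1 * hermDual j.2.1 q.2 p.2),
    fun h hh => ?_⟩
  set t : Fin 4 → Fin 4 → ℂ := fun a c =>
    ∑ p, ∑ q, hermDual a q.1 p.1 * hermDual c q.2 p.2 * h p q with ht
  have htre : ∀ a c, ((t a c).re : ℂ) = t a c := by
    intro a c
    rw [← Complex.conj_eq_iff_re]
    simp only [ht, map_sum, map_mul, ← Complex.star_def, star_hermDual]
    rw [Finset.sum_comm]
    refine Finset.sum_congr rfl fun p _ => Finset.sum_congr rfl fun q _ => ?_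
    rw [hh.apply]
  have hsum : h = ∑ a, ∑ c, t a c • (hermBasis a ⊗ₖ hermBasis c) := by
    ext p q
    have e : ∀ p' q' : Fin 2 × Fin 2, ∑ a, ∑ c, hermDual a q'.1 p'.1 * hermDual c q'.2 p'.2 *
        (hermBasis a p.1 q.1 * hermBasis c p.2 q.2) = if p = p' ∧ q = q' then 1 else 0 := by
      intro p' q'
      calc _ = (∑ a, hermDual a q'.1 p'.1 * hermBasis a p.1 q.1) *
            ∑ c, hermDual c q'.2 p'.2 * hermBasis c p.2 q.2 := by
            rw [Finset.sum_mul_sum]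
            refine Finset.sum_congr rfl fun a _ => Finset.sum_congr rfl fun c _ => by ring
        _ = _ := by
            rw [sum_hermDual_mul_hermBasis, sum_hermDual_mul_hermBasis]
            simp only [Prod.ext_iff, mul_ite, mul_one, mul_zero, ← ite_and]
            congr 1
            exact propext (by tauto)
    simp only [Matrix.sum_apply, Matrix.smul_apply, Matrix.kroneckerMap_apply, smul_eq_mul, ht]
    calc h p q = ∑ p', ∑ q', (if p = p' ∧ q = q' then 1 else 0) * h p' q' := by
          rw [Finset.sum_eq_single p, Finset.sum_eq_single q]
          · simp
          · intro q' _ hq; simp [hq.symm]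
          · simp
          · intro p' _ hp; simp [hp.symm]
          · simp
      _ = ∑ p', ∑ q', ∑ a, ∑ c, hermDual a q'.1 p'.1 * hermDual c q'.2 p'.2 * h p' q' *
            (hermBasis a p.1 q.1 * hermBasis c p.2 q.2) := by
          refine Finset.sum_congr rfl fun p' _ => Finset.sum_congr rfl fun q' _ => ?_
          rw [← e p' q']
          simp only [Finset.sum_mul]
          exact Finset.sum_congr rfl fun a _ => Finset.sum_congr rfl fun c _ => by ring
      _ = _ := by
          simp only [Finset.sum_mul]
          rw [Finset.sum_congr rfl fun p' _ => Finset.sum_comm, Finset.sum_comm]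
          refine Finset.sum_congr rfl fun a _ => ?_
          rw [Finset.sum_congr rfl fun p' _ => Finset.sum_comm, Finset.sum_comm]
  conv_lhs => rw [hsum]
  rw [Fintype.sum_prod_type]
  refine Finset.sum_congr rfl fun a _ => ?_
  rw [Fintype.sum_prod_type]
  refine Finset.sum_congr rfl fun c _ => ?_
  have e2 := hV c
  simp only [← hY]
  conv_lhs => rw [e2]
  have e3 : ∀ r, ((∑ p : Fin 2 × Fin 2, ∑ q : Fin 2 × Fin 2,
      (γ c r : ℂ) * (hermDual a q.1 p.1 * hermDual c q.2 p.2) * h p q).re : ℂ) =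
      γ c r * t a c := by
    intro r
    rw [← htre a c, ← Complex.ofReal_mul, ← Complex.re_ofReal_mul]
    simp only [ht, Finset.mul_sum, mul_assoc]
  simp only [e3]
  ext p q
  simp only [Matrix.smul_apply, Matrix.kroneckerMap_apply, Matrix.sum_apply, Finset.mul_sum,
    smul_eq_mul]
  exact Finset.sum_congr rfl fun r _ => by ring

end QCA

namespace QCA

/-! ### Locality of circuits of pair interactions -/

open scoped Matrix.Norms.L2Operator

variable {d : ℕ} {A B B' : Finset (Site d)}

/-- A summable positive function on the lattice, the logarithm of which is Lipschitz. -/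
def weight (x : Site d) : ℝ := ∏ i, (1 / 2 : ℝ) ^ (x i).natAbs

theorem weight_pos (x : Site d) : 0 < weight x := Finset.prod_pos fun _ _ => by positivity

theorem summable_weight : Summable (weight : Site d → ℝ) := by
  have h1 : Summable fun m : ℤ => (1 / 2 : ℝ) ^ m.natAbs := by
    have h := summable_geometric_of_lt_one (r := (1 / 2 : ℝ)) (by norm_num) (by norm_num)
    refine Summable.of_nat_of_neg ?_ ?_ <;> simpa using h
  refine summable_of_sum_le (c := (∑' m : ℤ, (1 / 2 : ℝ) ^ m.natAbs) ^ d)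
    (fun x => (weight_pos x).le) fun u => ?_
  have hu : u ⊆ Fintype.piFinset fun i => u.image fun x => x i := fun x hx =>
    Fintype.mem_piFinset.2 fun i => Finset.mem_image_of_mem _ hx
  refine (Finset.sum_le_sum_of_subset_of_nonneg hu fun x _ _ => (weight_pos x).le).trans ?_
  unfold weight
  rw [← Finset.prod_univ_sum (fun i => u.image fun x : Site d => x i)
    fun _ m => (1 / 2 : ℝ) ^ m.natAbs]
  refine (Finset.prod_le_prod (fun _ _ => Finset.sum_nonneg fun _ _ => by positivity)
    fun i _ => h1.sum_le_tsum _ fun _ _ => by positivity).trans ?_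
  simp

theorem weight_le (x v : Site d) : weight x ≤ (∏ i, (2 : ℝ) ^ (v i).natAbs) * weight (x + v) := by
  unfold weight
  rw [← Finset.prod_mul_distrib]
  refine Finset.prod_le_prod (fun _ _ => by positivity) fun i _ => ?_
  have h : ((x + v) i).natAbs ≤ (x i).natAbs + (v i).natAbs := Int.natAbs_add_le _ _
  have h2 := pow_le_pow_of_le_one (by norm_num : (0 : ℝ) ≤ 1 / 2) (by norm_num) h
  have h3 : (2 : ℝ) ^ (v i).natAbs * (1 / 2 : ℝ) ^ (v i).natAbs = 1 := by
    rw [← mul_pow]; norm_num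
  calc (1 / 2 : ℝ) ^ (x i).natAbs
      = (2 : ℝ) ^ (v i).natAbs * (1 / 2 : ℝ) ^ ((x i).natAbs + (v i).natAbs) := by
        rw [pow_add, mul_left_comm, h3, mul_one]
    _ ≤ _ := by gcongr

theorem exists_weight_le (N : Finset (Site d)) : ∃ C : ℝ, 0 ≤ C ∧ ∀ x y : Site d, y - x ∈ N →
    weight x ≤ C * weight y ∧ weight y ≤ C * weight x := by
  refine ⟨∑ v ∈ N, ∏ i, (2 : ℝ) ^ (v i).natAbs,
    Finset.sum_nonneg fun _ _ => by positivity, fun x y h => ?_⟩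
  have hle : ∏ i, (2 : ℝ) ^ ((y - x) i).natAbs ≤ ∑ v ∈ N, ∏ i, (2 : ℝ) ^ (v i).natAbs :=
    Finset.single_le_sum (f := fun v : Site d => ∏ i, (2 : ℝ) ^ (v i).natAbs)
      (fun _ _ => by positivity) h
  have h1 := weight_le x (y - x)
  have h2 := weight_le y (-(y - x))
  simp only [Pi.neg_apply, Int.natAbs_neg] at h2
  rw [add_sub_cancel] at h1
  rw [show y + -(y - x) = x by abel] at h2
  exact ⟨h1.trans (mul_le_mul_of_nonneg_right hle (weight_pos _).le),
    h2.trans (mul_le_mul_of_nonneg_right hle (weight_pos _).le)⟩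

/-! ### Extension of circuits to larger regions -/

theorem extend_refl (X : Op A) : extend (Finset.Subset.refl A) X = X := by
  ext s s'
  rw [extend_apply, if_pos fun x hx => absurd x.2 hx]
  rfl

theorem continuous_extend (h : A ⊆ B) : Continuous (extend h) :=
  (extend h).toAlgHom.toLinearMap.continuous_of_finiteDimensional

theorem extend_gate (h : A ⊆ B) (M : Op A) (θ : ℝ) : extend h (gate M θ) = gate (extend h M) θ := by
  unfold gate
  let _ : NormedAlgebra ℚ (Op A) := NormedAlgebra.restrictScalars ℚ ℂ (Op A)
  rw [NormedSpace.map_exp (extend h) (continuous_extend h), map_smul]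

theorem extend_circ (h : A ⊆ B) {I : Type*} (H : I → Op A) (l : List (I × ℝ)) :
    extend h (circ H l) = circ (fun i => extend h (H i)) l := by
  induction l with
  | nil => exact map_one _
  | cons p l ih => rw [circ, map_mul, ih, extend_gate]; rfl

theorem extend_heis (h : A ⊆ B) (g X : Op A) :
    extend h (heis g X) = heis (extend h g) (extend h X) := by
  simp only [heis, map_mul, map_star]

/-! ### Pair interactions as sums of local terms -/

open Classical in
/-- The pairs of sites of `B'` which lie in `B` and which are coupled by `pairHam N C a b`. -/
def pairSet {k : ℕ} (N : Finset (Site d)) (C : Colouring d k) (a b : Fin k)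
    (B B' : Finset (Site d)) : Finset (B' × B') :=
  Finset.univ.filter fun e => e.1.1 ∈ B ∧ e.2.1 ∈ B ∧
    e.2 ≠ e.1 ∧ e.2.1 - e.1.1 ∈ N ∧ C.toFun e.1.1 = a ∧ C.toFun e.2.1 = b

theorem extend_pairHam {k : ℕ} (N : Finset (Site d)) (C : Colouring d k) (a b : Fin k)
    (K L : QubitOp) (h : B ⊆ B') :
    extend h (pairHam N C a b K L B) =
      ∑ e ∈ pairSet N C a b B B', siteOp e.1 K * siteOp e.2 L := by
  classical
  have hsum : ∀ f : B' → Op B', ∑ x : B, f ⟨x.1, h x.2⟩ = ∑ x : B', if x.1 ∈ B then f x else 0 := by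
    intro f
    rw [sum_split h fun x : B' => if x.1 ∈ B then f x else 0]
    rw [Finset.sum_congr rfl fun x _ => if_pos x.2, left_eq_add]
    exact Finset.sum_eq_zero fun x _ => if_neg (Finset.mem_sdiff.1 x.2).2
  rw [pairSet, Finset.sum_filter, Fintype.sum_prod_type, pairHam, map_sum]
  set g : B' → B' → Op B' := fun x y =>
    if y ≠ x ∧ y.1 - x.1 ∈ N ∧ C.toFun x.1 = a ∧ C.toFun y.1 = b then
      siteOp x K * siteOp y L else 0 with hg
  have h1 : ∀ x y : B, extend h (if y ≠ x ∧ y.1 - x.1 ∈ N ∧ C.toFun x.1 = a ∧ C.toFun y.1 = b then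
      siteOp x K * siteOp y L else 0) = g ⟨x.1, h x.2⟩ ⟨y.1, h y.2⟩ := by
    intro x y
    have h2 : (⟨y.1, h y.2⟩ : B') ≠ ⟨x.1, h x.2⟩ ↔ y ≠ x := by
      simp only [ne_eq, Subtype.ext_iff]
    simp only [hg, h2]
    split_ifs
    · rw [map_mul, extend_siteOp, extend_siteOp]
    · exact map_zero _
  have h3 : ∀ x : B, extend h (∑ y : B, if y ≠ x ∧ y.1 - x.1 ∈ N ∧ C.toFun x.1 = a ∧
      C.toFun y.1 = b then siteOp x K * siteOp y L else 0) =
      ∑ y : B', if y.1 ∈ B then g ⟨x.1, h x.2⟩ y else 0 :=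
    fun x => (map_sum _ _ _).trans
      ((Finset.sum_congr rfl fun y _ => h1 x y).trans (hsum (g ⟨x.1, h x.2⟩)))
  refine (Finset.sum_congr rfl fun x _ => h3 x).trans ((hsum fun x => ∑ y : B',
    if y.1 ∈ B then g x y else 0).trans ?_)
  refine Finset.sum_congr rfl fun x _ => ?_
  split_ifs with hx
  · refine Finset.sum_congr rfl fun y _ => ?_
    simp only [hx, true_and]
    rw [← ite_and]
  · refine (Finset.sum_eq_zero fun y _ => if_neg fun hh => hx hh.1).symm

theorem pairHam_eq_sum {k : ℕ} (N : Finset (Site d)) (C : Colouring d k) (a b : Fin k)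
    (K L : QubitOp) :
    pairHam N C a b K L B' = ∑ e ∈ pairSet N C a b B' B', siteOp e.1 K * siteOp e.2 L := by
  rw [← extend_pairHam N C a b K L (Finset.Subset.refl B'), extend_refl]

/-- The one-qubit operators of norm at most one at a site. -/
def siteBall (A : Finset (Site d)) (z : A) : Set (Op A) :=
  {y | ∃ m : QubitOp, ‖m‖ ≤ 1 ∧ y = siteOp z m}

theorem norm_le_of_mem_siteBall {z : A} {y : Op A} (hy : y ∈ siteBall A z) : ‖y‖ ≤ 1 := by
  obtain ⟨m, hm, rfl⟩ := hy
  exact (norm_siteOp_le z m).trans hm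

theorem Osc.nonneg {X : Op A} {z : A} {c : ℝ} (h : Osc (siteBall A) X z c) : 0 ≤ c := by
  simpa using h 0 ⟨0, by simp, (map_zero _).symm⟩

theorem Osc.norm_commutator_siteOp_le {X : Op A} {z : A} {c : ℝ} (h : Osc (siteBall A) X z c)
    (m : QubitOp) : ‖X * siteOp z m - siteOp z m * X‖ ≤ ‖m‖ * c := by
  by_cases hm : ‖m‖ = 0
  · rw [norm_eq_zero] at hm
    simp [hm]
  have h1 := h (siteOp z ((‖m‖⁻¹ : ℂ) • m)) ⟨_, by
    rw [norm_smul, norm_inv, Complex.norm_real, norm_norm, inv_mul_cancel₀ hm], rfl⟩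
  rw [map_smul, mul_smul_comm, smul_mul_assoc, ← smul_sub, norm_smul, norm_inv, Complex.norm_real,
    norm_norm, inv_mul_le_iff₀ (lt_of_le_of_ne (norm_nonneg m) (Ne.symm hm))] at h1
  exact h1

theorem pairTerm_siteOp {K L : QubitOp} (hK : K.IsHermitian) (hL : L.IsHermitian) {c₀ : ℝ}
    (hc₀ : ‖K‖ * ‖L‖ ≤ c₀) {e : A × A} (he : e.2 ≠ e.1) :
    PairTerm (siteBall A) c₀ e (siteOp e.1 K * siteOp e.2 L) where
  selfAdjoint := by
    have h := siteOp_commute he L K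
    rw [IsSelfAdjoint, star_mul, ← map_star, ← map_star, Matrix.star_eq_conjTranspose,
      Matrix.star_eq_conjTranspose, hK.eq, hL.eq, h.eq]
  commute z h1 h2 y hy := by
    obtain ⟨m, -, rfl⟩ := hy
    exact (siteOp_commute h1 _ _).mul_right (siteOp_commute h2 _ _)
  bound X c₁ c₂ h1 h2 := by
    have e1 : X * (siteOp e.1 K * siteOp e.2 L) - siteOp e.1 K * siteOp e.2 L * X =
        (X * siteOp e.1 K - siteOp e.1 K * X) * siteOp e.2 L +
        siteOp e.1 K * (X * siteOp e.2 L - siteOp e.2 L * X) := by noncomm_ring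
    have p1 := h1.nonneg
    have p2 := h2.nonneg
    calc _ ≤ ‖K‖ * c₁ * ‖L‖ + ‖K‖ * (‖L‖ * c₂) := by
          rw [e1]
          refine (norm_add_le _ _).trans (add_le_add ?_ ?_)
          · exact (norm_mul_le _ _).trans (mul_le_mul (h1.norm_commutator_siteOp_le K)
              (norm_siteOp_le _ _) (norm_nonneg _) (by positivity))
          · exact (norm_mul_le _ _).trans (mul_le_mul (norm_siteOp_le _ _)
              (h2.norm_commutator_siteOp_le L) (norm_nonneg _) (by positivity))
      _ = ‖K‖ * ‖L‖ * (c₁ + c₂) := by ring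
      _ ≤ _ := by gcongr

theorem card_filter_pairSet_le {k : ℕ} (N : Finset (Site d)) (C : Colouring d k) (a b : Fin k)
    (z : B') :
    ((pairSet N C a b B B').filter fun e => e.1 = z ∨ e.2 = z).card ≤ 2 * N.card := by
  classical
  rw [Finset.filter_or]
  refine (Finset.card_union_le _ _).trans ?_
  rw [two_mul]
  refine add_le_add ?_ ?_
  · refine Finset.card_le_card_of_injOn (fun e => e.2.1 - e.1.1) ?_ ?_
    · intro e he
      simp only [pairSet, Finset.coe_filter, Finset.mem_filter, Finset.mem_univ, true_and,
        Set.mem_ofPred_eq] at he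
      exact he.1.2.2.2.1
    · intro e he e' he' hee
      simp only [Finset.coe_filter, Set.mem_ofPred_eq] at he he'
      have h1 : e.1 = e'.1 := he.2.trans he'.2.symm
      refine Prod.ext h1 (Subtype.ext ?_)
      simpa [h1] using hee
  · refine Finset.card_le_card_of_injOn (fun e => e.2.1 - e.1.1) ?_ ?_
    · intro e he
      simp only [pairSet, Finset.coe_filter, Finset.mem_filter, Finset.mem_univ, true_and,
        Set.mem_ofPred_eq] at he
      exact he.1.2.2.2.1
    · intro e he e' he' hee
      simp only [Finset.coe_filter, Set.mem_ofPred_eq] at he he'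
      have h1 : e.2 = e'.2 := he.2.trans he'.2.symm
      refine Prod.ext (Subtype.ext ?_) h1
      simpa [h1] using hee

theorem layer_pairSet {k : ℕ} {N : Finset (Site d)} {C : Colouring d k} (hC : C.Correct N)
    (a b : Fin k) {K L : QubitOp} (hK : K.IsHermitian) (hL : L.IsHermitian) {c₀ : ℝ}
    (hc₀ : ‖K‖ * ‖L‖ ≤ c₀) {c : ℝ} (hc : ∀ x y : Site d, y - x ∈ N →
      weight x ≤ c * weight y ∧ weight y ≤ c * weight x) (B' : Finset (Site d)) :
    Layer (siteBall B') c₀ c (2 * N.card) (fun x => weight x.1) (pairSet N C a b B' B')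
      (fun e => siteOp e.1 K * siteOp e.2 L) := by
  have hmem : ∀ e ∈ pairSet N C a b B' B', e.2 ≠ e.1 ∧ e.2.1 - e.1.1 ∈ N ∧
      C.toFun e.1.1 = a ∧ C.toFun e.2.1 = b := fun e he => (Finset.mem_filter.1 he).2.2.2
  refine ⟨fun e he => pairTerm_siteOp hK hL hc₀ (hmem e he).1, fun e he e' he' => ?_,
    fun e he => (hc _ _ (hmem e he).2.1).1, fun e he => (hc _ _ (hmem e he).2.1).2,
    fun z => card_filter_pairSet_le N C a b z⟩
  obtain ⟨h1, h2, h3, h4⟩ := hmem e he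
  obtain ⟨h1', h2', h3', h4'⟩ := hmem e' he'
  have hab : a ≠ b := by
    have := hC e.1.1 e.2.1 ⟨fun h => h1 (Subtype.ext h.symm), Or.inl h2⟩
    rwa [h3, h4] at this
  have n1 : e.1 ≠ e'.2 := fun h => hab (by rw [← h3, ← h4', h])
  have n2 : e.2 ≠ e'.1 := fun h => hab (by rw [← h4, ← h3', h])
  have hs : ∀ (x x' : B') (m : QubitOp), Commute (siteOp x m) (siteOp x' m) := by
    intro x x' m
    by_cases hx : x = x'
    · rw [hx]
    · exact siteOp_commute hx m m
  exact ((hs _ _ K).mul_right (siteOp_commute n1 K L)).mul_left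
    ((siteOp_commute n2 L K).mul_right (hs _ _ L))

theorem sum_pairSet_sdiff_le {k : ℕ} {N : Finset (Site d)} {C : Colouring d k} (a b : Fin k)
    {c : ℝ} (hc0 : 0 ≤ c) (hc : ∀ x y : Site d, y - x ∈ N →
      weight x ≤ c * weight y ∧ weight y ≤ c * weight x) {F : Finset (Site d)} {η : ℝ}
    (hF : ∀ G : Finset (Site d), Disjoint G F → ∑ x ∈ G, weight x ≤ η) (hB : F ∪ (F + N) ⊆ B) :
    ∑ e ∈ pairSet N C a b B' B' \ pairSet N C a b B B', (weight e.1.1 + weight e.2.1) ≤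
      (1 + c) * N.card * η := by
  classical
  have hT : ∀ e ∈ pairSet N C a b B' B' \ pairSet N C a b B B',
      e.2.1 - e.1.1 ∈ N ∧ e.1.1 ∈ B' \ F := by
    intro e he
    simp only [pairSet, Finset.mem_sdiff, Finset.mem_filter, Finset.mem_univ, true_and] at he
    obtain ⟨⟨h1, h2, h3⟩, h4⟩ := he
    refine ⟨h3.2.1, Finset.mem_sdiff.2 ⟨h1, fun hf => h4 ⟨hB (Finset.mem_union_left _ hf), ?_, h3⟩⟩⟩
    refine hB (Finset.mem_union_right _ (Finset.mem_add.2 ⟨e.1.1, hf, _, h3.2.1, ?_⟩))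
    abel
  set T := pairSet N C a b B' B' \ pairSet N C a b B B'
  have hinj : Set.InjOn (fun e : B' × B' => (e.1.1, e.2.1 - e.1.1)) T := by
    intro e _ e' _ h
    obtain ⟨h1, h2⟩ := Prod.mk.inj h
    rw [h1] at h2
    exact Prod.ext (Subtype.ext h1) (Subtype.ext (sub_left_injective h2))
  calc ∑ e ∈ T, (weight e.1.1 + weight e.2.1) ≤ ∑ e ∈ T, (1 + c) * weight e.1.1 := by
        refine Finset.sum_le_sum fun e he => ?_
        have := (hc _ _ (hT e he).1).2
        linarith
    _ = ∑ p ∈ T.image (fun e : B' × B' => (e.1.1, e.2.1 - e.1.1)), (1 + c) * weight p.1 := by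
        rw [Finset.sum_image hinj]
    _ ≤ ∑ p ∈ (B' \ F) ×ˢ N, (1 + c) * weight p.1 := by
        refine Finset.sum_le_sum_of_subset_of_nonneg (fun p hp => ?_) fun p _ _ =>
          mul_nonneg (by linarith) (weight_pos _).le
        obtain ⟨e, he, rfl⟩ := Finset.mem_image.1 hp
        exact Finset.mem_product.2 ⟨(hT e he).2, (hT e he).1⟩
    _ = (1 + c) * N.card * ∑ x ∈ B' \ F, weight x := by
        rw [Finset.sum_product]
        simp only [Finset.sum_const, nsmul_eq_mul, Finset.mul_sum]
        exact Finset.sum_congr rfl fun x _ => by ring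
    _ ≤ _ := by
        refine mul_le_mul_of_nonneg_left (hF _ Finset.sdiff_disjoint) ?_
        have : 0 ≤ 1 + c := by linarith
        positivity

theorem exists_osc_extend_le (A : Finset (Site d)) : ∃ K : ℝ, 0 ≤ K ∧ ∀ (B : Finset (Site d))
    (h : A ⊆ B) (X : Op A), ‖X‖ ≤ 1 → ∀ z : B,
      Osc (siteBall B) (extend h X) z (K * weight z.1) := by
  refine ⟨∑ x ∈ A, 2 * (weight x)⁻¹, Finset.sum_nonneg fun x _ => by
    have := weight_pos x; positivity, fun B h X hX z y hy => ?_⟩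
  have h0 : 0 ≤ ∑ x ∈ A, 2 * (weight x)⁻¹ := Finset.sum_nonneg fun x _ => by
    have := weight_pos x; positivity
  by_cases hz : z.1 ∈ A
  · have h1 : 2 * (weight z.1)⁻¹ ≤ ∑ x ∈ A, 2 * (weight x)⁻¹ :=
      Finset.single_le_sum (f := fun x => 2 * (weight x)⁻¹) (fun x _ => by
        have := weight_pos x; positivity) hz
    have hy1 := norm_le_of_mem_siteBall hy
    have hX1 : ‖extend h X‖ ≤ 1 := (norm_extend_le h X).trans hX
    have h2 : ‖extend h X * y - y * extend h X‖ ≤ 2 := by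
      refine (norm_sub_le _ _).trans ?_
      have a1 := norm_mul_le (extend h X) y
      have a2 := norm_mul_le y (extend h X)
      nlinarith [norm_nonneg (extend h X), norm_nonneg y]
    refine h2.trans ?_
    have hw := weight_pos z.1
    calc (2 : ℝ) = 2 * (weight z.1)⁻¹ * weight z.1 := by field_simp
      _ ≤ _ := by gcongr
  · obtain ⟨m, -, rfl⟩ := hy
    rw [(extend_commute_siteOp h X hz m).eq, sub_self, norm_zero]
    exact mul_nonneg h0 (weight_pos _).le

/-- The evolution of a local observable by circuits of pair interactions in a large region depends
little on that region, uniformly in all fine circuits of bounded duration. -/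
theorem exists_norm_heis_circ_sub_le {k : ℕ} {N : Finset (Site d)} {C : Colouring d k}
    (hC : C.Correct N) {I : Type*} [Fintype I] (a b : I → Fin k) {K L : I → QubitOp}
    (hK : ∀ i, (K i).IsHermitian) (hL : ∀ i, (L i).IsHermitian) :
    ∃ η : ℝ, 0 < η ∧ ∀ (A : Finset (Site d)) (s ε : ℝ), 0 < ε →
      ∃ B₀ : Finset (Site d), A ⊆ B₀ ∧ ∀ (B B' : Finset (Site d)) (h : A ⊆ B) (h' : B ⊆ B'),
        B₀ ⊆ B → ∀ l : List (I × ℝ), (∀ p ∈ l, |p.2| ≤ η) → (l.map fun p => |p.2|).sum ≤ s →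
        ∀ X : Op A, ‖X‖ ≤ 1 →
          ‖heis (circ (fun i => pairHam N C (a i) (b i) (K i) (L i) B') l) (extend (h.trans h') X) -
            extend h' (heis (circ (fun i => pairHam N C (a i) (b i) (K i) (L i) B) l)
              (extend h X))‖ ≤ ε := by
  obtain ⟨c, hc0, hc⟩ := exists_weight_le N
  set c₀ : ℝ := ∑ i, ‖K i‖ * ‖L i‖ with hc₀
  have hc₀0 : 0 ≤ c₀ := Finset.sum_nonneg fun _ _ => by positivity
  have hle : ∀ i, ‖K i‖ * ‖L i‖ ≤ c₀ := fun i =>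
    Finset.single_le_sum (f := fun i => ‖K i‖ * ‖L i‖) (fun _ _ => by positivity)
      (Finset.mem_univ i)
  set D : ℝ := 4 * c₀ * (1 + c) * (2 * N.card : ℕ) with hD
  have hD0 : 0 ≤ D := by positivity
  refine ⟨1 / (D + 1), by positivity, fun A s ε hε => ?_⟩
  obtain ⟨κ, hκ0, hκ⟩ := exists_osc_extend_le A
  set G : ℝ := 2 * c₀ * κ * Real.exp (D * |s|) * |s| * ((1 + c) * N.card) with hG
  have hG0 : 0 ≤ G := by positivity
  obtain ⟨F, hF⟩ := summable_iff_vanishing_norm.1 (summable_weight (d := d)) (ε / (G + 1))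
    (by positivity)
  have hF' : ∀ G' : Finset (Site d), Disjoint G' F → ∑ x ∈ G', weight x ≤ ε / (G + 1) :=
    fun G' hd => (le_abs_self _).trans (hF G' hd).le
  refine ⟨A ∪ (F ∪ (F + N)), Finset.subset_union_left, fun B B' h h' hB l hl hls X hX => ?_⟩
  rw [extend_heis, extend_circ, extend_extend, heis_circ, heis_circ]
  simp only [extend_pairHam, pairHam_eq_sum (B' := B')]
  have hlr := norm_heisList_sub_heisList_le (Y := siteBall B') (w := fun x : B' => weight x.1)
    (M := fun i e => siteOp e.1 (K i) * siteOp e.2 (L i)) (D := 2 * N.card)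
    (S := fun i => pairSet N C (a i) (b i) B B') (S' := fun i => pairSet N C (a i) (b i) B' B')
    (fun z y hy => norm_le_of_mem_siteBall hy) hc₀0 hc0 (fun z => (weight_pos _).le) hκ0
    (hκ B' (h.trans h') X hX)
    (fun i e he => by
      simp only [pairSet, Finset.mem_filter, Finset.mem_univ, true_and] at he ⊢
      exact ⟨e.1.2, e.2.2, he.2.2⟩)
    (fun i => layer_pairSet hC (a i) (b i) (hK i) (hL i) (hle i) hc B')
    (τ := (1 + c) * N.card * (ε / (G + 1))) (by positivity)
    (fun i => sum_pairSet_sdiff_le (a i) (b i) hc0 hc hF' (Finset.union_subset_right hB)) l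
    (fun p hp => by
      have h1 : D * |p.2| ≤ D * (1 / (D + 1)) := mul_le_mul_of_nonneg_left (hl p hp) hD0
      have h2 : D * (1 / (D + 1)) ≤ 1 := by
        rw [mul_one_div, div_le_one (by positivity)]; linarith
      calc _ = D * |p.2| := by rw [hD]; ring
        _ ≤ 1 := h1.trans h2)
  refine hlr.trans ?_
  set q := (l.map fun p => |p.2|).sum with hq
  have hq0 : 0 ≤ q := List.sum_nonneg fun x hx => by
    obtain ⟨q, _, rfl⟩ := List.mem_map.1 hx
    exact abs_nonneg _
  have hqs : q ≤ |s| := hls.trans (le_abs_self s)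
  calc _ ≤ 2 * c₀ * κ * Real.exp (D * |s|) * |s| * ((1 + c) * N.card * (ε / (G + 1))) := by
        gcongr
    _ = G * (ε / (G + 1)) := by rw [hG]; ring
    _ ≤ ε := by
        rw [mul_div_assoc', div_le_iff₀ (by positivity)]
        nlinarith

end QCA

namespace QCA

/-! ### The Hamiltonian as a sum of commuting layers, and the product formula -/

open scoped Matrix.Norms.L2Operator Kronecker

variable {d : ℕ} {A B : Finset (Site d)}

theorem dyson_eq_dysonTerm {H : ℝ → Op A} {h : ℝ → ℝ} (hH : Dominated H h) (n : ℕ) {t : ℝ}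
    (ht : 0 ≤ t) : dyson H n t = dysonTerm H n t := by
  induction n generalizing t with
  | zero => rfl
  | succ n ih =>
    ext i j
    have h1 : ∫ s in (0 : ℝ)..t, (H s * dyson H n s) i j =
        ∫ s in (0 : ℝ)..t, (H s * dysonTerm H n s) i j := by
      refine intervalIntegral.integral_congr fun s hs => ?_
      rw [Set.uIcc_of_le ht] at hs
      simp only [ih hs.1]
    have h2 := (LinearMap.toContinuousLinearMap
      (Matrix.entryLinearMap ℂ ℂ i j : Op A →ₗ[ℂ] ℂ)).intervalIntegral_comp_comm
      (hH.int_mul (hH.continuousOn_dysonTerm n) ht)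
    rw [dyson, Matrix.of_apply, h1, dysonTerm, Matrix.smul_apply, smul_eq_mul]
    exact congrArg (-Complex.I * ·) h2

theorem propagator_eq_timeExp {H : ℝ → Op A} {h : ℝ → ℝ} (hH : Dominated H h) {t : ℝ}
    (ht : 0 ≤ t) : propagator H t = timeExp H t := by
  unfold propagator timeExp
  exact tsum_congr fun n => dyson_eq_dysonTerm hH n ht

theorem pairOp_swap (x y : A) (m : Matrix (Fin 2 × Fin 2) (Fin 2 × Fin 2) ℂ) :
    pairOp y x (m.submatrix Prod.swap Prod.swap) = pairOp x y m := by
  ext s s'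
  simp only [pairOp, Matrix.of_apply, Matrix.submatrix_apply, Prod.swap_prod_mk]
  have : (∀ z, z ≠ y → z ≠ x → s z = s' z) ↔ ∀ z, z ≠ x → z ≠ y → s z = s' z :=
    ⟨fun h z h1 h2 => h z h2 h1, fun h z h1 h2 => h z h2 h1⟩
  simp only [this]

theorem pairOp_sum_smul {J : Type*} [Fintype J] (x y : A) (r : J → ℂ)
    (m : J → Matrix (Fin 2 × Fin 2) (Fin 2 × Fin 2) ℂ) :
    pairOp x y (∑ j, r j • m j) = ∑ j, r j • pairOp x y (m j) := by
  ext s s'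
  simp only [pairOp, Matrix.of_apply, Matrix.sum_apply, Matrix.smul_apply]
  split_ifs <;> simp

theorem neighbours_iff {N : Finset (Site d)} {x y : A} :
    Neighbours N x.1 y.1 ↔ y ≠ x ∧ y.1 - x.1 ∈ N ∪ -N := by
  rw [Neighbours, Finset.mem_union, Finset.mem_neg']
  simp only [ne_eq, Subtype.ext_iff, neg_sub, eq_comm]

theorem Colouring.Correct.union_neg {k : ℕ} {C : Colouring d k} {N : Finset (Site d)}
    (h : C.Correct N) : C.Correct (N ∪ -N) := by
  rintro x y ⟨hxy, h1⟩
  refine h x y ⟨hxy, ?_⟩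
  simp only [Finset.mem_union, Finset.mem_neg', neg_sub] at h1
  tauto

theorem Colouring.Refines.exists_map {k k₁ : ℕ} {C : Colouring d k} {C₁ : Colouring d k₁}
    (h : C₁.Refines C) : ∃ c : Fin k₁ → Fin k, ∀ x, c (C₁.toFun x) = C.toFun x := by
  refine ⟨Function.extend C₁.toFun C.toFun fun _ => C.toFun 0, fun x => ?_⟩
  exact Function.FactorsThrough.extend_apply (fun x y hxy => h x y hxy) _ x

namespace CTQCA

variable {k : ℕ} (T : CTQCA d k)

/-- The Hamiltonian as a sum over ordered pairs. -/
theorem two_smul_hamiltonian (A : Finset (Site d)) (t : ℝ) :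
    (2 : ℂ) • T.hamiltonian A t = open Classical in ∑ x : A, ∑ y : A,
      if Neighbours T.nbhd x.1 y.1 then
        pairOp x y (T.h (T.colouring.toFun x.1) (T.colouring.toFun y.1) t) else 0 := by
  classical
  set f : A → A → Op A := fun x y =>
    pairOp x y (T.h (T.colouring.toFun x.1) (T.colouring.toFun y.1) t) with hf
  have hfs : ∀ x y, f y x = f x y := by
    intro x y
    simp only [hf]
    rw [T.symm, pairOp_swap]
  have hns : ∀ x y : A, Neighbours T.nbhd y.1 x.1 ↔ Neighbours T.nbhd x.1 y.1 := fun x y => by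
    simp only [Neighbours, ne_eq, eq_comm, or_comm]
  have h1 : T.hamiltonian A t = ∑ x : A, ∑ y : A,
      if Neighbours T.nbhd x.1 y.1 ∧ toLex x.1 < toLex y.1 then f x y else 0 := rfl
  have h2 : T.hamiltonian A t = ∑ x : A, ∑ y : A,
      if Neighbours T.nbhd x.1 y.1 ∧ toLex y.1 < toLex x.1 then f x y else 0 := by
    rw [h1, Finset.sum_comm]
    simp only [hfs, hns]
  rw [two_smul]
  nth_rewrite 1 [h1]
  rw [h2, ← Finset.sum_add_distrib]
  refine Finset.sum_congr rfl fun x _ => ?_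
  rw [← Finset.sum_add_distrib]
  refine Finset.sum_congr rfl fun y _ => ?_
  by_cases h : Neighbours T.nbhd x.1 y.1
  · have hne : toLex x.1 ≠ toLex y.1 := fun he => h.1 (toLex_inj.1 he)
    rcases lt_or_gt_of_ne hne with hl | hl
    · rw [if_pos ⟨h, hl⟩, if_neg fun h' => lt_asymm hl h'.2, if_pos h, add_zero]
    · rw [if_neg fun h' => lt_asymm hl h'.2, if_pos ⟨h, hl⟩, if_pos h, zero_add]
  · simp [h]

/-- The coefficients of the Hamiltonian in a decomposition of the couplings. -/
def coefficient {k₁ : ℕ} {J : Type} (c : Fin k₁ → Fin k)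
    (D : J → Fin 2 × Fin 2 → Fin 2 × Fin 2 → ℂ) (i : Fin k₁ × Fin k₁ × J) (t : ℝ) : ℝ :=
  (∑ p, ∑ q, D i.2.2 p q * T.h (c i.1) (c i.2.1) t p q).re / 2

theorem intervalIntegrable_coefficient {k₁ : ℕ} {J : Type} (c : Fin k₁ → Fin k)
    (D : J → Fin 2 × Fin 2 → Fin 2 × Fin 2 → ℂ) (i : Fin k₁ × Fin k₁ × J) (t : ℝ) (ht : 0 ≤ t) :
    IntervalIntegrable (T.coefficient c D i) volume 0 t := by
  have h : IntervalIntegrable (fun s => ∑ p, ∑ q, D i.2.2 p q * T.h (c i.1) (c i.2.1) s p q)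
      volume 0 t := by
    have := IntervalIntegrable.sum Finset.univ fun p _ =>
      IntervalIntegrable.sum Finset.univ fun q _ =>
        (T.integrable (c i.1) (c i.2.1) p q t ht).const_mul (D i.2.2 p q)
    simpa [Finset.sum_fn] using this
  have h2 : IntervalIntegrable (fun s =>
      (∑ p, ∑ q, D i.2.2 p q * T.h (c i.1) (c i.2.1) s p q).re) volume 0 t :=
    ⟨h.1.re, h.2.re⟩
  exact h2.div_const 2

theorem hamiltonian_eq_sum {k₁ : ℕ} {J : Type} [Fintype J] {C₁ : Colouring d k₁}
    {c : Fin k₁ → Fin k} (hc : ∀ x, c (C₁.toFun x) = T.colouring.toFun x) {K L : J → QubitOp}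
    {D : J → Fin 2 × Fin 2 → Fin 2 × Fin 2 → ℂ}
    (hD : ∀ h : Matrix (Fin 2 × Fin 2) (Fin 2 × Fin 2) ℂ, h.IsHermitian →
        h = ∑ j, ((∑ p, ∑ q, D j p q * h p q).re : ℂ) • (K j ⊗ₖ L j))
    (A : Finset (Site d)) (t : ℝ) :
    T.hamiltonian A t = ∑ i : Fin k₁ × Fin k₁ × J, (T.coefficient c D i t : ℂ) •
      pairHam (T.nbhd ∪ -T.nbhd) C₁ i.1 i.2.1 (K i.2.2) (L i.2.2) A := by
  classical
  have h2 : (2 : ℂ) ≠ 0 := two_ne_zero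
  refine smul_right_injective (Op A) h2 ?_
  dsimp only
  rw [T.two_smul_hamiltonian, Finset.smul_sum]
  have hi : ∀ i : Fin k₁ × Fin k₁ × J, (2 : ℂ) • (T.coefficient c D i t : ℂ) •
      pairHam (T.nbhd ∪ -T.nbhd) C₁ i.1 i.2.1 (K i.2.2) (L i.2.2) A =
      ∑ x : A, ∑ y : A, if Neighbours T.nbhd x.1 y.1 then
        if C₁.toFun x.1 = i.1 ∧ C₁.toFun y.1 = i.2.1 then
          ((∑ p, ∑ q, D i.2.2 p q * T.h (c i.1) (c i.2.1) t p q).re : ℂ) •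
            pairOp x y (K i.2.2 ⊗ₖ L i.2.2) else 0 else 0 := by
    intro i
    rw [smul_smul, coefficient, Complex.ofReal_div, Complex.ofReal_ofNat, mul_div_cancel₀ _ h2,
      pairHam, Finset.smul_sum]
    refine Finset.sum_congr rfl fun x _ => ?_
    rw [Finset.smul_sum]
    refine Finset.sum_congr rfl fun y _ => ?_
    rw [neighbours_iff, smul_ite, smul_zero, ← ite_and]
    simp only [and_assoc]
    split_ifs with h
    · rw [pairOp_kronecker h.1.symm]
    · rfl
  refine Eq.trans ?_ (Finset.sum_congr rfl fun i _ => hi i).symm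
  rw [eq_comm, Finset.sum_comm]
  refine Finset.sum_congr rfl fun x _ => ?_
  rw [Finset.sum_comm]
  refine Finset.sum_congr rfl fun y _ => Eq.symm ?_
  by_cases h : Neighbours T.nbhd x.1 y.1
  · simp only [if_pos h]
    rw [Fintype.sum_prod_type, Finset.sum_eq_single (C₁.toFun x.1), Fintype.sum_prod_type,
      Finset.sum_eq_single (C₁.toFun y.1)]
    · simp only [and_self, if_true, hc]
      conv_lhs => rw [hD _ (T.herm _ _ t)]
      rw [pairOp_sum_smul]
    · intro b _ hb
      simp [hb.symm]
    · simp
    · intro a _ ha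
      simp [ha.symm]
    · simp
  · simp [h]

theorem regionEvolution_eq_timeExp {k₁ : ℕ} {J : Type} [Fintype J] {C₁ : Colouring d k₁}
    {c : Fin k₁ → Fin k} (hc : ∀ x, c (C₁.toFun x) = T.colouring.toFun x) {K L : J → QubitOp}
    {D : J → Fin 2 × Fin 2 → Fin 2 × Fin 2 → ℂ}
    (hD : ∀ h : Matrix (Fin 2 × Fin 2) (Fin 2 × Fin 2) ℂ, h.IsHermitian →
        h = ∑ j, ((∑ p, ∑ q, D j p q * h p q).re : ℂ) • (K j ⊗ₖ L j))
    (A : Finset (Site d)) {t : ℝ} (ht : 0 ≤ t) :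
    T.regionEvolution A t = timeExp (fun s => ∑ i : Fin k₁ × Fin k₁ × J,
      (T.coefficient c D i s : ℂ) •
        pairHam (T.nbhd ∪ -T.nbhd) C₁ i.1 i.2.1 (K i.2.2) (L i.2.2) A) t := by
  rw [regionEvolution, funext (T.hamiltonian_eq_sum hc hD A)]
  exact propagator_eq_timeExp (dominated_sum_smul (T.intervalIntegrable_coefficient c D) _) ht

end CTQCA

theorem pairHam_isSelfAdjoint {k : ℕ} (N : Finset (Site d)) (C : Colouring d k) (a b : Fin k)
    {K L : QubitOp} (hK : K.IsHermitian) (hL : L.IsHermitian) (A : Finset (Site d)) :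
    IsSelfAdjoint (pairHam N C a b K L A) := by
  rw [pairHam_eq_sum]
  exact isSelfAdjoint_sum _ fun e he =>
    (pairTerm_siteOp hK hL le_rfl (Finset.mem_filter.1 he).2.2.2.1).selfAdjoint

theorem pairHam_self {k : ℕ} {N : Finset (Site d)} {C : Colouring d k} (hC : C.Correct N)
    (a : Fin k) (K L : QubitOp) (A : Finset (Site d)) : pairHam N C a a K L A = 0 := by
  rw [pairHam_eq_sum]
  refine Finset.sum_eq_zero fun e he => ?_
  obtain ⟨-, -, h1, h2, h3, h4⟩ := (Finset.mem_filter.1 he).2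
  exact absurd (h3.trans h4.symm) (hC _ _ ⟨fun h => h1 (Subtype.ext h.symm), Or.inl h2⟩)

namespace CQCA

variable {k : ℕ} (Q : CQCA d k)

theorem Reads.program {Q : CQCA d k} {f : ℝ → ℝ} {μ : Fin 2 → ℝ} (h : Q.Reads f μ)
    (p : ℕ → List (FieldControlled k)) : ({Q with program := p} : CQCA d k).Reads f μ := h

/-- The gates of one time step of a product formula. -/
def trotterGates {J : Type} [Fintype J] (Y V : J → Matrix.unitaryGroup (Fin 2) ℂ)
    (κ : J → Fin 2 → ℝ) (f : ℝ → ℝ) (Φ : Finset ℝ) (θ : Fin k × Fin k × J → ℝ) :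
    List (FieldControlled k) :=
  Finset.univ.toList.flatMap fun i : Fin k × Fin k × J => if i.1 = i.2.1 then [] else
    couplingGates i.1 i.2.1 (Y i.2.2) (V i.2.2) (κ i.2.2) f Φ (θ i)

theorem map_colour_couplingGates (a b : Fin k) (Y V : Matrix.unitaryGroup (Fin 2) ℂ)
    (κ : Fin 2 → ℝ) (f : ℝ → ℝ) (Φ : Finset ℝ) (θ : ℝ) :
    (couplingGates a b Y V κ f Φ θ).map FieldControlled.colour =
      [b] ++ Φ.toList.map (fun _ => a) ++ [b] := by
  simp [couplingGates, Function.comp_def]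

theorem controlledBy_of_mem_trotterGates {J : Type} [Fintype J]
    {Y V : J → Matrix.unitaryGroup (Fin 2) ℂ} {κ : J → Fin 2 → ℝ} {f : ℝ → ℝ} {Φ : Finset ℝ}
    {θ : Fin k × Fin k × J → ℝ} {g : FieldControlled k} (hg : g ∈ trotterGates Y V κ f Φ θ) :
    ∃ l, g.ControlledBy l := by
  obtain ⟨i, -, hi⟩ := List.mem_flatMap.1 hg
  split_ifs at hi with h
  · simp at hi
  simp only [couplingGates, List.mem_append, List.mem_singleton, List.mem_map] at hi
  refine ⟨i.2.1, ?_⟩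
  rcases hi with (rfl | ⟨φ, -, rfl⟩) | rfl
  · exact fun _ _ _ => Iff.rfl
  · intro ψ ψ' h
    simp only [Set.mem_ofPred_eq, h]
  · exact fun _ _ _ => Iff.rfl

theorem listOp_nil (A : Finset (Site d)) : Q.listOp A [] = 1 := rfl

theorem listOp_flatMap {I : Type*} (g : I → List (FieldControlled k)) (H : I → Op A) (θ : I → ℝ)
    (h : ∀ i, Q.listOp A (g i) = gate (H i) (θ i)) (l : List I) :
    Q.listOp A (l.flatMap g) = circ H (l.map fun i => (i, θ i)) := by
  induction l with
  | nil => rfl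
  | cons i l ih => rw [List.flatMap_cons, listOp_append, ih, h, List.map_cons, circ]

theorem listOp_trotterGates {f : ℝ → ℝ} {μ : Fin 2 → ℝ} (hf : Q.Reads f μ) {Φ : Finset ℝ}
    (hΦ : ∀ (A : Finset (Site d)) (s : Config A) (x : A) (b : Fin k), Q.field s x b ∈ Φ)
    {J : Type} [Fintype J] (Y V : J → Matrix.unitaryGroup (Fin 2) ℂ) (κ : J → Fin 2 → ℝ)
    (θ : Fin k × Fin k × J → ℝ) (A : Finset (Site d)) :
    Q.listOp A (trotterGates Y V κ f Φ θ) =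
      circ (fun i : Fin k × Fin k × J => pairHam Q.nbhd Q.colouring i.1 i.2.1
        ((Y i.2.2).1 * Matrix.diagonal (fun r => (κ i.2.2 r : ℂ)) * (Y i.2.2).1.conjTranspose)
        ((V i.2.2).1 * Q.basis * Matrix.diagonal (fun r => (μ r : ℂ)) *
          ((V i.2.2).1 * Q.basis).conjTranspose) A)
        (Finset.univ.toList.map fun i => (i, θ i)) := by
  refine Q.listOp_flatMap _ _ _ (fun i => ?_) _
  split_ifs with h
  · rw [h, pairHam_self Q.correct, gate_zero, listOp_nil]
  · exact Q.listOp_couplingGates hf (fun A s x => hΦ A s x _) h _ _ _ _ A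

end CQCA

end QCA

namespace QCA

/-! ### The thermodynamic limit and the approximation -/

open scoped Matrix.Norms.L2Operator Kronecker

variable {d : ℕ} {A B B' : Finset (Site d)}

theorem norm_single_le (i j : Config A) : ‖(Matrix.single j i 1 : Op A)‖ ≤ 1 := by
  have hp : ‖(Matrix.single i i 1 : Op A)‖ ≤ 1 := by
    rw [← Matrix.diagonal_single, Matrix.l2_opNorm_diagonal, pi_norm_le_iff_of_nonneg zero_le_one]
    intro x
    by_cases hx : x = i
    · subst hx; simp
    · simp [Pi.single_eq_of_ne hx]
  have h1 : star (Matrix.single j i 1 : Op A) * Matrix.single j i 1 = Matrix.single i i 1 := by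
    rw [Matrix.star_eq_conjTranspose, Matrix.conjTranspose_single, star_one,
      Matrix.single_mul_single_same, one_mul]
  have h2 := CStarRing.norm_star_mul_self (x := (Matrix.single j i 1 : Op A))
  rw [h1] at h2
  nlinarith [norm_nonneg (Matrix.single j i 1 : Op A)]

theorem norm_apply_le (M : Op A) (i j : Config A) : ‖M i j‖ ≤ ‖M‖ := by
  have h1 : (Matrix.single i i 1 : Op A) * M * Matrix.single j i 1 =
      Matrix.single i i (M i j) := by simp
  have h2 : ‖M i j‖ ≤ ‖(Matrix.single i i (M i j) : Op A)‖ := by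
    rw [← Matrix.diagonal_single, Matrix.l2_opNorm_diagonal]
    simpa using norm_le_pi_norm (Pi.single i (M i j) : Config A → ℂ) i
  have a1 := norm_single_le (A := A) i i
  have a2 := norm_single_le (A := A) i j
  have b1 := norm_mul_le ((Matrix.single i i 1 : Op A) * M) (Matrix.single j i 1)
  have b2 := norm_mul_le (Matrix.single i i 1 : Op A) M
  rw [h1] at b1
  have b3 : ‖(Matrix.single i i 1 : Op A) * M‖ ≤ ‖M‖ :=
    b2.trans (mul_le_of_le_one_left (norm_nonneg M) a1)
  exact h2.trans (b1.trans ((mul_le_of_le_one_right (norm_nonneg _) a2).trans b3))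

theorem isClosed_unitary_op (A : Finset (Site d)) : IsClosed (unitary (Op A) : Set (Op A)) :=
  isClosed_unitary

theorem isClosed_posSemidef_op (A : Finset (Site d)) : IsClosed {M : Op A | M.PosSemidef} := by
  have : {M : Op A | M.PosSemidef} = {M | M.conjTranspose = M} ∩
      ⋂ v : Config A → ℂ, {M | 0 ≤ star v ⬝ᵥ M.mulVec v} := by
    ext M
    simp only [Set.mem_inter_iff, Set.mem_iInter]
    exact Matrix.posSemidef_iff_dotProduct_mulVec
  rw [this]
  refine (isClosed_eq (by fun_prop) continuous_id).inter (isClosed_iInter fun v => ?_)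
  exact isClosed_le continuous_const (by fun_prop)

theorem continuous_ptrace (A B : Finset (Site d)) : Continuous (ptrace A B) := by
  refine continuous_matrix fun i j => ?_
  simp only [ptrace, Matrix.of_apply]
  exact continuous_finsetSum _ fun e _ => continuous_apply_apply _ _

/-- The state of the region `A` if the region `B` evolves by `U`. -/
def localState (ρ : Family d) (A B : Finset (Site d)) (U : Op B) : Op A :=
  ptrace A B (U * ρ B * U.conjTranspose)

theorem localState_apply (ρ : Family d) (h : A ⊆ B) (U : Op B) (i j : Config A) :
    localState ρ A B U i j = (heis U (extend h (Matrix.single j i 1)) * ρ B).trace := by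
  rw [localState, ptrace_apply_eq_trace h, trace_mul_conj]

theorem norm_localState_sub_le {ρ : Family d} (hρ : IsState ρ) (h : A ⊆ B) (h' : B ⊆ B')
    (U : Op B) (U' : Op B') (i j : Config A) :
    ‖localState ρ A B' U' i j - localState ρ A B U i j‖ ≤
      ‖heis U' (extend (h.trans h') (Matrix.single j i 1)) -
        extend h' (heis U (extend h (Matrix.single j i 1)))‖ := by
  rw [localState_apply ρ h, localState_apply ρ (h.trans h'), ← hρ.consistent B B' h',
    trace_mul_ptrace h', ← Matrix.trace_sub, ← sub_mul]
  exact norm_trace_mul_le _ _ (hρ.posSemidef B') (hρ.trace_eq_one B')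

theorem norm_heis_sub_heis_le {U U' : Op A} (hU : U ∈ unitary (Op A)) (hU' : U' ∈ unitary (Op A))
    {X : Op A} (hX : ‖X‖ ≤ 1) : ‖heis U' X - heis U X‖ ≤ 2 * ‖U' - U‖ := by
  have e : heis U' X - heis U X = star U' * X * (U' - U) + star (U' - U) * X * U := by
    rw [heis, heis, star_sub]
    noncomm_ring
  have b1 : ‖star U' * X * (U' - U)‖ ≤ ‖U' - U‖ := by
    rw [mul_assoc, CStarRing.norm_mem_unitary_mul _ (Unitary.star_mem hU')]
    exact (norm_mul_le _ _).trans (mul_le_of_le_one_left (norm_nonneg _) hX)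
  have b2 : ‖star (U' - U) * X * U‖ ≤ ‖U' - U‖ := by
    rw [CStarRing.norm_mul_mem_unitary _ hU]
    refine (norm_mul_le _ _).trans ?_
    rw [norm_star]
    exact mul_le_of_le_one_right (norm_nonneg _) hX
  rw [e]
  exact (norm_add_le _ _).trans (by linarith)

theorem norm_localState_sub_le_of_unitary {ρ : Family d} (hρ : IsState ρ) (h : A ⊆ B) {U U' : Op B}
    (hU : U ∈ unitary (Op B)) (hU' : U' ∈ unitary (Op B)) (i j : Config A) :
    ‖localState ρ A B U' i j - localState ρ A B U i j‖ ≤ 2 * ‖U' - U‖ := by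
  refine (norm_localState_sub_le hρ h (Finset.Subset.refl B) U U' i j).trans ?_
  rw [extend_refl]
  exact norm_heis_sub_heis_le hU hU' ((norm_extend_le _ _).trans (norm_single_le i j))

theorem localState_posSemidef {ρ : Family d} (hρ : IsState ρ) (U : Op B) :
    (localState ρ A B U).PosSemidef :=
  ptrace_posSemidef _ ((hρ.posSemidef B).mul_mul_conjTranspose_same U)

theorem localState_trace {ρ : Family d} (hρ : IsState ρ) (h : A ⊆ B) {U : Op B}
    (hU : U ∈ unitary (Op B)) : (localState ρ A B U).trace = 1 := by
  have hU1 : U.conjTranspose * U = 1 := (Unitary.mem_iff.1 hU).1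
  rw [localState, trace_ptrace h, Matrix.trace_mul_comm, ← mul_assoc, hU1, one_mul,
    hρ.trace_eq_one]

theorem ptrace_localState (ρ : Family d) (h : A ⊆ B) (h' : B ⊆ B') (U : Op B') :
    ptrace A B (localState ρ B B' U) = localState ρ A B' U := by
  rw [localState, ptrace_ptrace h h', localState]

/-- A decomposition of the Hamiltonian of a continuous-time QCA into layers of commuting pair
interactions: on all finite regions, the evolution operator is the time-ordered exponential of
`-i` times a combination of the layers with time-dependent coefficients. -/
structure ProductFormula {k : ℕ} (T : CTQCA d k) (I : Type) [Fintype I] where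
  nbhd : Finset (Site d)
  numColours : ℕ
  colouring : Colouring d numColours
  correct : colouring.Correct nbhd
  fst : I → Fin numColours
  snd : I → Fin numColours
  K : I → QubitOp
  L : I → QubitOp
  hK : ∀ i, (K i).IsHermitian
  hL : ∀ i, (L i).IsHermitian
  coeff : I → ℝ → ℝ
  integrable : ∀ i t, 0 ≤ t → IntervalIntegrable (coeff i) volume 0 t
  regionEvolution_eq : ∀ (A : Finset (Site d)) (t : ℝ), 0 ≤ t → T.regionEvolution A t =
    timeExp (fun s => ∑ i, (coeff i s : ℂ) •
      pairHam nbhd colouring (fst i) (snd i) (K i) (L i) A) t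

namespace ProductFormula

variable {k : ℕ} {T : CTQCA d k} {I : Type} [Fintype I]

/-- The evolution operator of a region over a number of time steps of the product formula. -/
def evolution (F : ProductFormula T I) (Δ : ℝ) (n : ℕ) (A : Finset (Site d)) : Op A :=
  circ (fun i => pairHam F.nbhd F.colouring (F.fst i) (F.snd i) (F.K i) (F.L i) A)
    (timeList F.coeff Finset.univ.toList Δ n)

theorem evolution_mem_unitary (F : ProductFormula T I) (Δ : ℝ) (n : ℕ) (A : Finset (Site d)) :
    F.evolution Δ n A ∈ unitary (Op A) :=
  circ_mem_unitary (fun i => pairHam_isSelfAdjoint _ _ _ _ (F.hK i) (F.hL i) A) _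

theorem exists_norm_evolution_sub_lt (F : ProductFormula T I) (A : Finset (Site d)) (τ : ℝ)
    {ε : ℝ} (hε : 0 < ε) :
    ∃ δ : ℝ, 0 < δ ∧ ∀ Δ : ℝ, 0 < Δ → Δ < δ → ∀ t : ℝ, 0 ≤ t → t ≤ τ →
      ‖F.evolution Δ ⌊t / Δ⌋₊ A - T.regionEvolution A t‖ < ε := by
  obtain ⟨δ, hδ, h⟩ := exists_forall_norm_circ_sub_timeExp_lt F.integrable
    (fun i => pairHam_isSelfAdjoint F.nbhd F.colouring (F.fst i) (F.snd i) (F.hK i) (F.hL i) A) τ hε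
  refine ⟨δ, hδ, fun Δ hΔ hΔδ t ht htτ => ?_⟩
  rw [F.regionEvolution_eq A t ht]
  exact h Δ hΔ hΔδ t ht htτ

theorem regionEvolution_mem_unitary (F : ProductFormula T I) (A : Finset (Site d)) {t : ℝ}
    (ht : 0 ≤ t) : T.regionEvolution A t ∈ unitary (Op A) := by
  refine (isClosed_unitary_op A).closure_subset (Metric.mem_closure_iff.2 fun ε hε => ?_)
  obtain ⟨δ, hδ, h⟩ := F.exists_norm_evolution_sub_lt A t hε
  refine ⟨_, F.evolution_mem_unitary (δ / 2) ⌊t / (δ / 2)⌋₊ A, ?_⟩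
  rw [dist_comm, dist_eq_norm]
  exact h (δ / 2) (by positivity) (by linarith) t ht le_rfl

theorem exists_norm_localState_evolution_sub_le (F : ProductFormula T I) (A : Finset (Site d))
    (τ : ℝ) {ε : ℝ} (hε : 0 < ε) :
    ∃ δ : ℝ, 0 < δ ∧ ∃ B₀ : Finset (Site d), A ⊆ B₀ ∧ ∀ Δ : ℝ, 0 < Δ → Δ < δ → ∀ t : ℝ,
      0 ≤ t → t ≤ τ → ∀ B B' : Finset (Site d), B₀ ⊆ B → B ⊆ B' → ∀ ρ : Family d, IsState ρ →
      ∀ i j : Config A, ‖localState ρ A B' (F.evolution Δ ⌊t / Δ⌋₊ B') i j -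
        localState ρ A B (F.evolution Δ ⌊t / Δ⌋₊ B) i j‖ ≤ ε := by
  obtain ⟨η, hη, h⟩ := exists_norm_heis_circ_sub_le F.correct F.fst F.snd F.hK F.hL
  obtain ⟨B₀, hAB₀, h⟩ := h A (∑ i, ∫ r in (0 : ℝ)..τ, |F.coeff i r|) ε hε
  obtain ⟨δ, hδ, hinc⟩ := exists_forall_abs_integral_le F.integrable (τ := τ) hη
  refine ⟨δ, hδ, B₀, hAB₀, fun Δ hΔ hΔδ t ht htτ B B' hB hB' ρ hρ i j => ?_⟩
  have hn1 : (⌊t / Δ⌋₊ : ℝ) * Δ ≤ τ := by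
    refine le_trans ?_ htτ
    rw [← le_div_iff₀ hΔ]
    exact Nat.floor_le (by positivity)
  refine (norm_localState_sub_le hρ (hAB₀.trans hB) hB' _ _ i j).trans
    (h B B' (hAB₀.trans hB) hB' hB _ (fun p hp => ?_) ?_ _ (norm_single_le i j))
  · obtain ⟨m, hm, hpm⟩ := mem_timeList hp
    have h1 : ((m : ℝ) + 1) * Δ ≤ τ := by
      refine le_trans (mul_le_mul_of_nonneg_right ?_ hΔ.le) hn1
      exact_mod_cast hm
    have h2 : (m : ℝ) * Δ ≤ (m + 1) * Δ := by nlinarith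
    rw [hpm]
    exact (abs_integral_le_sub (F.integrable p.1) (by positivity) h2).trans
      (hinc p.1 _ _ (by positivity) h2 h1 (by linarith))
  · refine (sum_abs_timeList_le F.integrable hΔ _).trans (Finset.sum_le_sum fun i _ => ?_)
    have hτ0 : 0 ≤ τ := ht.trans htτ
    exact intervalIntegral.integral_mono_interval le_rfl (by positivity) hn1
      (Eventually.of_forall fun _ => abs_nonneg _) (F.integrable i τ hτ0).abs

theorem evolveIn_eq (B : Finset (Site d)) (t : ℝ) (ρ : Family d) (A : Finset (Site d)) :
    T.evolveIn B t ρ A = localState ρ A B (T.regionEvolution B t) := rfl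

theorem exists_norm_localState_sub_evolveIn_lt (F : ProductFormula T I) (h : A ⊆ B) (τ : ℝ)
    {ε : ℝ} (hε : 0 < ε) :
    ∃ δ : ℝ, 0 < δ ∧ ∀ Δ : ℝ, 0 < Δ → Δ < δ → ∀ t : ℝ, 0 ≤ t → t ≤ τ →
      ∀ ρ : Family d, IsState ρ → ∀ i j : Config A,
        ‖localState ρ A B (F.evolution Δ ⌊t / Δ⌋₊ B) i j - T.evolveIn B t ρ A i j‖ < ε := by
  obtain ⟨δ, hδ, hF⟩ := F.exists_norm_evolution_sub_lt B τ (half_pos hε)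
  refine ⟨δ, hδ, fun Δ hΔ hΔδ t ht htτ ρ hρ i j => ?_⟩
  have h1 := norm_localState_sub_le_of_unitary hρ h (F.regionEvolution_mem_unitary B ht)
    (F.evolution_mem_unitary Δ ⌊t / Δ⌋₊ B) i j
  have h2 := hF Δ hΔ hΔδ t ht htτ
  rw [evolveIn_eq]
  linarith

theorem exists_norm_evolveIn_sub_le (F : ProductFormula T I) (A : Finset (Site d)) (τ : ℝ)
    {ε : ℝ} (hε : 0 < ε) :
    ∃ B₀ : Finset (Site d), A ⊆ B₀ ∧ ∀ t : ℝ, 0 ≤ t → t ≤ τ → ∀ B B' : Finset (Site d),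
      B₀ ⊆ B → B ⊆ B' → ∀ ρ : Family d, IsState ρ → ∀ i j : Config A,
        ‖T.evolveIn B' t ρ A i j - T.evolveIn B t ρ A i j‖ ≤ ε := by
  obtain ⟨δ, hδ, B₀, hAB₀, h⟩ := F.exists_norm_localState_evolution_sub_le A τ
    (show 0 < ε / 3 by positivity)
  refine ⟨B₀, hAB₀, fun t ht htτ B B' hB hB' ρ hρ i j => ?_⟩
  obtain ⟨δ₁, hδ₁, h₁⟩ := F.exists_norm_localState_sub_evolveIn_lt (hAB₀.trans hB) τ
    (show 0 < ε / 3 by positivity)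
  obtain ⟨δ₂, hδ₂, h₂⟩ := F.exists_norm_localState_sub_evolveIn_lt ((hAB₀.trans hB).trans hB') τ
    (show 0 < ε / 3 by positivity)
  obtain ⟨Δ, hΔ0, hΔ⟩ := exists_between (lt_min hδ (lt_min hδ₁ hδ₂))
  rw [lt_min_iff, lt_min_iff] at hΔ
  have e0 := h Δ hΔ0 hΔ.1 t ht htτ B B' hB hB' ρ hρ i j
  have e1 := h₁ Δ hΔ0 hΔ.2.1 t ht htτ ρ hρ i j
  have e2 := h₂ Δ hΔ0 hΔ.2.2 t ht htτ ρ hρ i j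
  set a := localState ρ A B' (F.evolution Δ ⌊t / Δ⌋₊ B') i j
  set b := localState ρ A B (F.evolution Δ ⌊t / Δ⌋₊ B) i j
  have e : T.evolveIn B' t ρ A i j - T.evolveIn B t ρ A i j =
      (a - b) - (a - T.evolveIn B' t ρ A i j) + (b - T.evolveIn B t ρ A i j) := by ring
  rw [e]
  have := norm_add_le ((a - b) - (a - T.evolveIn B' t ρ A i j)) (b - T.evolveIn B t ρ A i j)
  have := norm_sub_le (a - b) (a - T.evolveIn B' t ρ A i j)
  linarith

/-- The evolution of the infinite lattice is well-defined. -/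
theorem tendsto_evolveIn (F : ProductFormula T I) {t : ℝ} (ht : 0 ≤ t) {ρ : Family d}
    (hρ : IsState ρ) (A : Finset (Site d)) :
    Tendsto (fun B : Finset (Site d) => T.evolveIn B t ρ A) atTop (𝓝 (T.evolve t ρ A)) := by
  have h1 : ∀ i j, ∃ z : ℂ, Tendsto (fun B : Finset (Site d) => T.evolveIn B t ρ A i j) atTop
      (𝓝 z) := by
    intro i j
    refine cauchySeq_tendsto_of_complete (Metric.cauchySeq_iff'.2 fun ε hε => ?_)
    obtain ⟨B₀, -, h⟩ := F.exists_norm_evolveIn_sub_le A t (half_pos hε)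
    refine ⟨B₀, fun B hB => ?_⟩
    rw [dist_eq_norm]
    have := h t ht le_rfl B₀ B (Finset.Subset.refl _) hB ρ hρ i j
    linarith
  choose M hM using h1
  have h2 : Tendsto (fun B : Finset (Site d) => T.evolveIn B t ρ A) atTop
      (𝓝 (Matrix.of M : Op A)) :=
    tendsto_pi_nhds.2 fun i => tendsto_pi_nhds.2 fun j => hM i j
  have h3 : T.evolve t ρ A = Matrix.of M := h2.limUnder_eq
  rw [h3]
  exact h2

theorem isState_evolve (F : ProductFormula T I) {t : ℝ} (ht : 0 ≤ t) {ρ : Family d}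
    (hρ : IsState ρ) : IsState (T.evolve t ρ) where
  posSemidef A := (isClosed_posSemidef_op A).mem_of_tendsto (F.tendsto_evolveIn ht hρ A)
    (Eventually.of_forall fun B => localState_posSemidef hρ (T.regionEvolution B t))
  trace_eq_one A := by
    have hc : Continuous fun M : Op A => M.trace := by fun_prop
    refine tendsto_nhds_unique ((hc.tendsto _).comp (F.tendsto_evolveIn ht hρ A))
      (tendsto_const_nhds.congr' ?_)
    filter_upwards [eventually_ge_atTop A] with B hB
    exact (localState_trace hρ hB (F.regionEvolution_mem_unitary B ht)).symm
  consistent A B h := by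
    refine tendsto_nhds_unique (((continuous_ptrace A B).tendsto _).comp
      (F.tendsto_evolveIn ht hρ B)) ((F.tendsto_evolveIn ht hρ A).congr' ?_)
    filter_upwards [eventually_ge_atTop B] with B' hB'
    exact (ptrace_localState ρ h hB' _).symm

/-- Coloured QCAs with the evolution operators of a product formula approximate the
continuous-time QCA. -/
theorem approximates (F : ProductFormula T I) {k₁ : ℕ} {Q : ℝ → CQCA d k₁}
    (hQ : ∀ Δ : ℝ, 0 < Δ → ∀ A n, (Q Δ).regionEvolution A n = F.evolution Δ n A) :
    Approximates Q T := by
  refine ⟨fun A τ ε hε => ?_, fun A τ ε hε => ?_⟩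
  · obtain ⟨δ, hδ, h⟩ := F.exists_norm_evolution_sub_lt A τ hε
    refine ⟨δ, hδ, fun Δ hΔ hΔδ t ht htτ i j => ?_⟩
    rw [hQ Δ hΔ, ← Matrix.sub_apply]
    exact (norm_apply_le _ i j).trans_lt (h Δ hΔ hΔδ t ht htτ)
  · have hε4 : 0 < ε / 4 := by positivity
    obtain ⟨δ, hδ, B₀, hAB₀, h⟩ := F.exists_norm_localState_evolution_sub_le A τ hε4
    obtain ⟨B₁, hAB₁, h'⟩ := F.exists_norm_evolveIn_sub_le A τ hε4
    set B := B₀ ∪ B₁ with hB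
    have hB0 : B₀ ⊆ B := Finset.subset_union_left
    have hB1 : B₁ ⊆ B := Finset.subset_union_right
    obtain ⟨δ₁, hδ₁, h₁⟩ := F.exists_norm_localState_sub_evolveIn_lt (hAB₀.trans hB0) τ hε4
    refine ⟨min δ δ₁, lt_min hδ hδ₁, fun Δ hΔ hΔδ t ht htτ ρ hρ i j => ?_⟩
    rw [lt_min_iff] at hΔδ
    obtain ⟨B₂, hB₂⟩ := (Q Δ).exists_evolve_eq_ptrace hρ ⌊t / Δ⌋₊ A
    have e0 : ‖(Q Δ).evolve ⌊t / Δ⌋₊ ρ A i j -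
        localState ρ A B (F.evolution Δ ⌊t / Δ⌋₊ B) i j‖ ≤ ε / 4 := by
      rw [hB₂ (B ∪ B₂) Finset.subset_union_right, hQ Δ hΔ]
      exact h Δ hΔ hΔδ.1 t ht htτ B (B ∪ B₂) hB0 Finset.subset_union_left ρ hρ i j
    have e1 := h₁ Δ hΔ hΔδ.2 t ht htτ ρ hρ i j
    have e2 : ‖T.evolve t ρ A i j - T.evolveIn B t ρ A i j‖ ≤ ε / 4 := by
      have hlim : Tendsto (fun B' : Finset (Site d) => T.evolveIn B' t ρ A i j) atTop
          (𝓝 (T.evolve t ρ A i j)) :=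
        tendsto_pi_nhds.1 (tendsto_pi_nhds.1 (F.tendsto_evolveIn ht hρ A) i) j
      refine le_of_tendsto (hlim.sub_const _).norm ?_
      filter_upwards [eventually_ge_atTop B] with B' hB'
      exact h' t ht htτ B B' hB1 hB' ρ hρ i j
    set a := localState ρ A B (F.evolution Δ ⌊t / Δ⌋₊ B) i j
    have e : (Q Δ).evolve ⌊t / Δ⌋₊ ρ A i j - T.evolve t ρ A i j =
        ((Q Δ).evolve ⌊t / Δ⌋₊ ρ A i j - a) + (a - T.evolveIn B t ρ A i j) -
          (T.evolve t ρ A i j - T.evolveIn B t ρ A i j) := by ring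
    rw [e]
    have := norm_sub_le (((Q Δ).evolve ⌊t / Δ⌋₊ ρ A i j - a) + (a - T.evolveIn B t ρ A i j))
      (T.evolve t ρ A i j - T.evolveIn B t ρ A i j)
    have := norm_add_le ((Q Δ).evolve ⌊t / Δ⌋₊ ρ A i j - a) (a - T.evolveIn B t ρ A i j)
    linarith

end ProductFormula

end QCA

namespace QCA

/-! ### The approximation theorem -/

open scoped Matrix.Norms.L2Operator Kronecker

variable {d k : ℕ}

/-- A coloured QCA without operations. -/
def CQCA.idle {k₁ : ℕ} (T : CTQCA d k) {C₁ : Colouring d k₁} (hC : C₁.Correct T.nbhd)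
    {σ : QubitOp} (hσ : σ.IsHermitian) : CQCA d k₁ where
  nbhd := T.nbhd ∪ -T.nbhd
  zero_mem := Finset.mem_union_left _ T.zero_mem
  colouring := C₁
  correct := hC.union_neg
  obs := σ
  obs_herm := hσ
  program _ := []

theorem conj_diagonal_isHermitian (W : QubitOp) (v : Fin 2 → ℝ) :
    (W * Matrix.diagonal (fun i => (v i : ℂ)) * W.conjTranspose).IsHermitian := by
  refine Matrix.isHermitian_mul_mul_conjTranspose W ?_
  rw [Matrix.IsHermitian, Matrix.diagonal_conjTranspose]
  congr 1
  funext i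
  simp

theorem CTQCA.TimeIndependent.coefficient_eq {T : CTQCA d k} (hT : T.TimeIndependent) {k₁ : ℕ}
    {J : Type} (c : Fin k₁ → Fin k) (D : J → Fin 2 × Fin 2 → Fin 2 × Fin 2 → ℂ)
    (i : Fin k₁ × Fin k₁ × J) (t : ℝ) : T.coefficient c D i t = T.coefficient c D i 0 := by
  unfold CTQCA.coefficient
  rw [hT (c i.1) (c i.2.1) t]

/-- If the fields allow one to read off the sum over the neighbours of a given colour of an
observable that is not traceless and not a multiple of the identity, then the evolution of the
lattice has a product formula and can be approximated. -/
theorem approximable_of_reads (T : CTQCA d k) {k₁ : ℕ} {C₁ : Colouring d k₁}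
    (hC : C₁.Correct T.nbhd) (hR : C₁.Refines T.colouring) {σ : QubitOp} (hσ : σ.IsHermitian)
    {f : ℝ → ℝ} {μ : Fin 2 → ℝ} (hf : (CQCA.idle T hC hσ).Reads f μ) (h1 : μ 0 ≠ μ 1)
    (h2 : μ 0 + μ 1 ≠ 0) :
    (∃ (I : Type) (_ : Fintype I), Nonempty (ProductFormula T I)) ∧ Approximable T σ C₁ := by
  classical
  obtain ⟨c, hc⟩ := hR.exists_map
  obtain ⟨J, _, Y, V, κ, D, hD⟩ := exists_coupling_decomposition h1 h2 hσ.eigenvectorUnitary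
  obtain ⟨Φ, hΦ⟩ := (CQCA.idle T hC hσ).exists_finset_field_mem
  let F : ProductFormula T (Fin k₁ × Fin k₁ × J) :=
    { nbhd := T.nbhd ∪ -T.nbhd
      numColours := k₁
      colouring := C₁
      correct := hC.union_neg
      fst := fun i => i.1
      snd := fun i => i.2.1
      K := fun i => (Y i.2.2).1 * Matrix.diagonal (fun r => (κ i.2.2 r : ℂ)) *
        (Y i.2.2).1.conjTranspose
      L := fun i => (V i.2.2).1 * hσ.eigenvectorUnitary.1 *
        Matrix.diagonal (fun r => (μ r : ℂ)) *
          ((V i.2.2).1 * hσ.eigenvectorUnitary.1).conjTranspose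
      hK := fun i => conj_diagonal_isHermitian _ _
      hL := fun i => conj_diagonal_isHermitian _ _
      coeff := T.coefficient c D
      integrable := T.intervalIntegrable_coefficient c D
      regionEvolution_eq := fun A t ht => T.regionEvolution_eq_timeExp hc hD A ht }
  set θ : ℝ → ℕ → Fin k₁ × Fin k₁ × J → ℝ := fun Δ n i =>
    ∫ s in (n * Δ)..((n + 1) * Δ), T.coefficient c D i s with hθ
  set Q : ℝ → CQCA d k₁ := fun Δ => { CQCA.idle T hC hσ with
    program := fun n => CQCA.trotterGates Y V κ f Φ (θ Δ n) } with hQ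
  refine ⟨⟨_, inferInstance, ⟨F⟩⟩, Q, (Finset.univ.toList : List (Fin k₁ × Fin k₁ × J)).flatMap
    fun i => if i.1 = i.2.1 then [] else [i.2.1] ++ Φ.toList.map (fun _ => i.1) ++ [i.2.1],
    fun Δ _ => ⟨rfl, rfl, rfl, fun n => ?_, fun n g hg => ?_, fun hT n => ?_⟩, ?_⟩
  · show (CQCA.trotterGates Y V κ f Φ (θ Δ n)).map FieldControlled.colour = _
    rw [CQCA.trotterGates, List.map_flatMap]
    congr 1
    funext i
    split_ifs
    · rfl
    · exact CQCA.map_colour_couplingGates _ _ _ _ _ _ _ _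
  · exact CQCA.controlledBy_of_mem_trotterGates hg
  · show CQCA.trotterGates Y V κ f Φ (θ Δ n) = CQCA.trotterGates Y V κ f Φ (θ Δ 0)
    congr 1
    funext i
    simp only [hθ, hT.coefficient_eq c D i, intervalIntegral.integral_const, smul_eq_mul]
    push_cast
    ring
  · refine F.approximates fun Δ _ A n => ?_
    induction n with
    | zero => rfl
    | succ n ih =>
      have hstep : (Q Δ).stepOp A n = (Q Δ).listOp A (CQCA.trotterGates Y V κ f Φ (θ Δ n)) := rfl
      have hlist := (Q Δ).listOp_trotterGates (f := f) (μ := μ) hf hΦ Y V κ (θ Δ n) A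
      rw [CQCA.regionEvolution, ih, hstep, hlist]
      unfold ProductFormula.evolution
      rw [timeList, circ_append]
      rfl

theorem approximable_of_trace_ne_zero (T : CTQCA d k) {σ : QubitOp} (hσ : σ.IsHermitian)
    (hns : ∀ c : ℂ, σ ≠ c • (1 : QubitOp)) (htr : σ.trace ≠ 0) {k₁ : ℕ} {C₁ : Colouring d k₁}
    (hC : C₁.Correct T.nbhd) (hR : C₁.Refines T.colouring) :
    (∃ (I : Type) (_ : Fintype I), Nonempty (ProductFormula T I)) ∧ Approximable T σ C₁ := by
  refine approximable_of_reads T hC hR hσ (CQCA.reads_eigenvalues _) (eigenvalues_ne hσ hns) ?_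
  intro h
  apply htr
  rw [hσ.trace_eq_sum_eigenvalues, Fin.sum_univ_two, ← RCLike.ofReal_add]
  exact RCLike.ofReal_eq_zero.2 h

theorem exists_approximable (T : CTQCA d k) {σ : QubitOp} (hσ : σ.IsHermitian)
    (hns : ∀ c : ℂ, σ ≠ c • (1 : QubitOp)) :
    ∃ (k₁ : ℕ) (C₁ : Colouring d k₁), C₁.Correct T.nbhd ∧ C₁.Refines T.colouring ∧
      (∃ (I : Type) (_ : Fintype I), Nonempty (ProductFormula T I)) ∧ Approximable T σ C₁ := by
  set N := T.nbhd ∪ -T.nbhd with hN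
  obtain ⟨k₁, C₁, hR, -, hsep⟩ := T.colouring.exists_refinement (N ∪ (N - N)) fun _ => True
  have hC : C₁.Correct T.nbhd := by
    rintro x y ⟨hxy, h⟩
    refine hsep x y hxy (Finset.mem_union_left _ ?_) trivial
    rw [hN, Finset.mem_union, Finset.mem_neg', neg_sub]
    exact h
  refine ⟨k₁, C₁, hC, hR, ?_⟩
  by_cases htr : σ.trace = 0
  · have hne := eigenvalues_ne hσ hns
    rw [hσ.trace_eq_sum_eigenvalues, Fin.sum_univ_two, ← RCLike.ofReal_add] at htr
    have htr' := RCLike.ofReal_eq_zero.1 htr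
    refine approximable_of_reads T hC hR hσ (CQCA.reads_indicator (CQCA.idle T hC hσ)
      (fun x y y' _ _ hy hy' h => ?_) (fun h0 => hne ?_) hne) (by simp) (by simp)
    · by_contra hyy
      refine hsep y y' hyy (Finset.mem_union_right _ (Finset.mem_sub.2 ⟨_, hy', _, hy, ?_⟩))
        trivial h
      abel
    · change hσ.eigenvalues 0 = 0 at h0
      linarith
  · exact approximable_of_trace_ne_zero T hσ hns htr hC hR

end QCA

end

theorem theorem3 (d k : ℕ) (T : QCA.CTQCA d k) (σ : Matrix (Fin 2) (Fin 2) ℂ)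
    (hσ : σ.IsHermitian) (hσ_ns : ∀ c : ℂ, σ ≠ c • (1 : Matrix (Fin 2) (Fin 2) ℂ)) :
    (∀ (t : ℝ), 0 ≤ t → ∀ ρ : QCA.Family d, QCA.IsState ρ →
      QCA.IsState (T.evolve t ρ) ∧
      ∀ A : Finset (QCA.Site d),
        Tendsto (fun B : Finset (QCA.Site d) => T.evolveIn B t ρ A) atTop
          (𝓝 (T.evolve t ρ A))) ∧
    (∃ (k₁ : ℕ) (C₁ : QCA.Colouring d k₁),
      C₁.Correct T.nbhd ∧ C₁.Refines T.colouring ∧ QCA.Approximable T σ C₁) ∧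
    (∃ (k₁ : ℕ) (C₁ : QCA.Colouring d k₁),
      C₁.Correct T.nbhd ∧ C₁.Refines T.colouring ∧
      ∀ x y, T.colouring.toFun x = T.colouring.toFun y →
        (∀ v w, T.colouring.toFun v = T.colouring.toFun x →
          T.colouring.toFun w = T.colouring.toFun x → ¬ QCA.Neighbours T.nbhd v w) →
        C₁.toFun x = C₁.toFun y) ∧
    (σ.trace ≠ 0 → ∀ (k₁ : ℕ) (C₁ : QCA.Colouring d k₁),
      C₁.Correct T.nbhd → C₁.Refines T.colouring → QCA.Approximable T σ C₁) := by
  obtain ⟨k₁, C₁, hC, hR, ⟨I, _, ⟨F⟩⟩, hA⟩ := QCA.exists_approximable T hσ hσ_ns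
  refine ⟨fun t ht ρ hρ => ⟨F.isState_evolve ht hρ, F.tendsto_evolveIn ht hρ⟩,
    ⟨k₁, C₁, hC, hR, hA⟩, ?_, fun htr k₂ C₂ hC₂ hR₂ =>
      (QCA.approximable_of_trace_ne_zero T hσ hσ_ns htr hC₂ hR₂).2⟩
  obtain ⟨k₂, C₂, hR₂, hkeep, hsep⟩ := T.colouring.exists_refinement (T.nbhd ∪ -T.nbhd) fun a =>
    ∃ v w, T.colouring.toFun v = a ∧ T.colouring.toFun w = a ∧ QCA.Neighbours T.nbhd v w
  refine ⟨k₂, C₂, fun x y h hxy => ?_, hR₂, fun x y hxy h => hkeep x y hxy ?_⟩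
  · refine hsep x y h.1 ?_ ⟨x, y, rfl, (hR₂ x y hxy).symm, h⟩ hxy
    rw [Finset.mem_union, Finset.mem_neg', neg_sub]
    exact h.2
  · rintro ⟨v, w, hv, hw, hvw⟩
    exact h v w hv hw hvw
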